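/- Let $\mathbb K$ be a field of characteristic $0$ and let $(A,d)$, $A=\bigoplus_{p\in\mathbb Z}A^p$, be a unital differential graded commutative $\mathbb K$-algebra: the product satisfies $A^pA^q\subset A^{p+q}$ and $ab=(-1)^{pq}ba$ for $a\in A^p$, $b\in A^q$, and $d$ is a derivation of degree $1$ with $d^2=0$. Write $[f,g]=fg-(-1)^{\bar f\,\bar g}gf$ for the graded commutator of homogeneous linear maps $A\to A$. A homogeneous linear map $f\colon A\to A$ is a differential operator of order $\le 0$ if $[f,a]=0$ for all homogeneous $a\in A$, and of order $\le m$, for $m\geq 1$, if $[f,a]$ is one of order $\le m-1$ for all homogeneous $a\in A$, where $a$ denotes the left multiplication by $a$. It is called a quasi-Batalin–Vilkovisky (quasi-BV) operator if it is a differential operator of order $\le 2$ and $f(1)=0$. Let $k\in\mathbb Z$, let $\boldsymbol i\colon A\to A$ be a quasi-BV operator of degree $-2k$, put $\boldsymbol l=[\boldsymbol i,d]$ (of degree $-2k+1$), and assume that $[\boldsymbol l,\boldsymbol i]$ is also a quasi-BV operator. Put \[R(a,b)=\boldsymbol i(ab)-\boldsymbol i(a)\,b-a\,\boldsymbol i(b),\qquad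 [a,b]_{\boldsymbol l}=(-1)^{p}\bigl(\boldsymbol l(ab)-\boldsymbol l(a)\,b\bigr)-a\,\boldsymbol l(b)\quad(a\in A^p,\ b\in A).\] Let $B\subset A$ be a graded linear subspace with $d(B)\subset B$ and $R(B,B)\subset B$. Then $B$ is closed under $[\,,]_{\boldsymbol l}$, and $(B[2k-1],d,[\,,]_{\boldsymbol l})$, where $B[2k-1]^n=B\cap A^{n+2k-1}$, is a differential graded Lie algebra which is formal, i.e. it is linked by a finite zigzag of quasi-isomorphisms of differential graded Lie algebras to its cohomology, endowed with the induced bracket and zero differential. -/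

import Mathlib

universe u v w v₁ v₂

/-! ### Differential graded Lie algebras

Graded vector spaces are `ℤ`-graded, written internally: a `K`-module together with a family of
submodules indexed by `ℤ` of which it is the direct sum. The sign `(-1) ^ p` is
`Int.negOnePow p : ℤˣ`. -/

/-- The structure of a differential graded Lie algebra on a `K`-vector space `L`: a grading
`L = ⨁ Lⁿ`, a differential of degree `1` and square zero, and a bilinear bracket of degree `0`
which satisfies graded antisymmetry, the graded Leibniz rule and the graded Jacobi identity. -/
structure DGLA (K : Type u) (L : Type v) [Field K] [AddCommGroup L] [Module K L] where
  gr : ℤ → Submodule K L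
  isInternal : DirectSum.IsInternal gr
  d : L →ₗ[K] L
  bracket : L →ₗ[K] L →ₗ[K] L
  d_mem : ∀ {n : ℤ} {x : L}, x ∈ gr n → d x ∈ gr (n + 1)
  d_d : ∀ x : L, d (d x) = 0
  bracket_mem : ∀ {p q : ℤ} {x y : L}, x ∈ gr p → y ∈ gr q → bracket x y ∈ gr (p + q)
  antisymm : ∀ {p q : ℤ} {x y : L}, x ∈ gr p → y ∈ gr q →
    bracket x y = -((p * q).negOnePow • bracket y x)
  leibniz : ∀ {p : ℤ} {x : L} (y : L), x ∈ gr p →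
    d (bracket x y) = bracket (d x) y + p.negOnePow • bracket x (d y)
  jacobi : ∀ {p q : ℤ} {x y : L} (z : L), x ∈ gr p → y ∈ gr q →
    bracket x (bracket y z) =
      bracket (bracket x y) z + (p * q).negOnePow • bracket y (bracket x z)

namespace DGLA

section Cohomology

variable {K : Type u} {L : Type v} [Field K] [AddCommGroup L] [Module K L]

/-- A direct sum decomposition can be recognised by a family of projections. -/
theorem isInternal_of_proj {V : Type w} [AddCommGroup V] [Module K V] (G : ℤ → Submodule K V)
    (π : ℤ → V →ₗ[K] V) (same : ∀ n, ∀ x ∈ G n, π n x = x)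
    (other : ∀ m n, m ≠ n → ∀ x ∈ G m, π n x = 0) (span : ∀ x, x ∈ iSup G) :
    DirectSum.IsInternal G := by
  rw [DirectSum.isInternal_submodule_iff_iSupIndep_and_iSup_eq_top]
  refine ⟨?_, eq_top_iff.2 fun x _ => span x⟩
  rw [iSupIndep_def]
  intro i
  rw [Submodule.disjoint_def]
  intro x hx hx'
  have hle : (⨆ j, ⨆ (_ : j ≠ i), G j) ≤ LinearMap.ker (π i) :=
    iSup_le fun j => iSup_le fun hj y hy => LinearMap.mem_ker.2 (other j i hj y hy)
  rw [← same i x hx]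
  exact LinearMap.mem_ker.1 (hle hx')

variable (𝓛 : DGLA K L)

/-- The projection of `L` onto its component of degree `n`. -/
noncomputable def proj (n : ℤ) : L →ₗ[K] L :=
  letI := 𝓛.isInternal.chooseDecomposition
  (𝓛.gr n).subtype ∘ₗ DirectSum.component K ℤ (fun i => 𝓛.gr i) n ∘ₗ
    (DirectSum.decomposeLinearEquiv 𝓛.gr).toLinearMap

theorem proj_mem (n : ℤ) (x : L) : 𝓛.proj n x ∈ 𝓛.gr n := by
  simp [proj]

theorem proj_same {n : ℤ} {x : L} (hx : x ∈ 𝓛.gr n) : 𝓛.proj n x = x := by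
  let _ := 𝓛.isInternal.chooseDecomposition
  exact DirectSum.decompose_of_mem_same 𝓛.gr hx

theorem proj_ne {m n : ℤ} (h : m ≠ n) {x : L} (hx : x ∈ 𝓛.gr m) : 𝓛.proj n x = 0 := by
  let _ := 𝓛.isInternal.chooseDecomposition
  exact DirectSum.decompose_of_mem_ne 𝓛.gr hx h

theorem exists_sum_proj (x : L) : ∃ s : Finset ℤ, ∑ n ∈ s, 𝓛.proj n x = x := by
  classical
  let _ := 𝓛.isInternal.chooseDecomposition
  exact ⟨_, DirectSum.sum_support_decompose 𝓛.gr x⟩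

theorem d_proj (n : ℤ) (x : L) : 𝓛.d (𝓛.proj n x) = 𝓛.proj (n + 1) (𝓛.d x) := by
  let _ := 𝓛.isInternal.chooseDecomposition
  induction x using DirectSum.Decomposition.inductionOn 𝓛.gr with
  | zero => simp
  | @homogeneous i m =>
    by_cases h : i = n
    · subst h
      rw [𝓛.proj_same m.2, 𝓛.proj_same (𝓛.d_mem m.2)]
    · rw [𝓛.proj_ne h m.2, 𝓛.proj_ne (by omega) (𝓛.d_mem m.2), map_zero]
  | add x y hx hy => simp [hx, hy]

/-- The cocycles. -/
abbrev cocycles : Submodule K L := LinearMap.ker 𝓛.d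

/-- The coboundaries, as a subspace of the cocycles. -/
abbrev coboundaries : Submodule K 𝓛.cocycles := (LinearMap.range 𝓛.d).submoduleOf 𝓛.cocycles

/-- The total cohomology space `ker d / im d`. -/
abbrev H : Type v := 𝓛.cocycles ⧸ 𝓛.coboundaries

variable {𝓛}

theorem proj_mem_cocycles (n : ℤ) {z : L} (hz : z ∈ 𝓛.cocycles) :
    𝓛.proj n z ∈ 𝓛.cocycles := by
  rw [LinearMap.mem_ker] at hz ⊢
  rw [𝓛.d_proj, hz, map_zero]

theorem bracket_mem_cocycles {z w : L} (hz : z ∈ 𝓛.cocycles) (hw : w ∈ 𝓛.cocycles) :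
    𝓛.bracket z w ∈ 𝓛.cocycles := by
  obtain ⟨s, hs⟩ := 𝓛.exists_sum_proj z
  rw [← hs, map_sum, LinearMap.sum_apply]
  refine Submodule.sum_mem _ fun n _ => ?_
  have h1 : 𝓛.d (𝓛.proj n z) = 0 := proj_mem_cocycles n hz
  have h2 : 𝓛.d w = 0 := hw
  rw [LinearMap.mem_ker, 𝓛.leibniz w (𝓛.proj_mem n z), h1, h2]
  simp

theorem bracket_d_mem_range {z : L} (hz : z ∈ 𝓛.cocycles) (m : L) :
    𝓛.bracket z (𝓛.d m) ∈ LinearMap.range 𝓛.d := by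
  obtain ⟨s, hs⟩ := 𝓛.exists_sum_proj z
  rw [← hs, map_sum, LinearMap.sum_apply]
  refine Submodule.sum_mem _ fun n _ => ?_
  have h1 : 𝓛.d (𝓛.proj n z) = 0 := proj_mem_cocycles n hz
  have h := 𝓛.leibniz m (𝓛.proj_mem n z)
  rw [h1, map_zero, LinearMap.zero_apply, zero_add] at h
  rcases Int.units_eq_one_or n.negOnePow with e | e
  · exact ⟨𝓛.bracket (𝓛.proj n z) m, by rw [h, e, one_smul]⟩
  · exact ⟨-𝓛.bracket (𝓛.proj n z) m, by rw [map_neg, h, e, Units.neg_smul, one_smul, neg_neg]⟩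

theorem d_bracket_mem_range (m : L) {w : L} (hw : w ∈ 𝓛.cocycles) :
    𝓛.bracket (𝓛.d m) w ∈ LinearMap.range 𝓛.d := by
  obtain ⟨s, hs⟩ := 𝓛.exists_sum_proj m
  rw [← hs, map_sum, map_sum, LinearMap.sum_apply]
  refine Submodule.sum_mem _ fun n _ => ⟨𝓛.bracket (𝓛.proj n m) w, ?_⟩
  have h2 : 𝓛.d w = 0 := hw
  rw [𝓛.leibniz w (𝓛.proj_mem n m), h2]
  simp

variable (𝓛)

/-- The bracket of two cocycles. -/
def bracketCocycles : 𝓛.cocycles →ₗ[K] 𝓛.cocycles →ₗ[K] 𝓛.cocycles :=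
  LinearMap.mk₂ K (fun z w => ⟨𝓛.bracket z w, bracket_mem_cocycles z.2 w.2⟩)
    (fun _ _ _ => Subtype.ext (by simp)) (fun _ _ _ => Subtype.ext (by simp))
    (fun _ _ _ => Subtype.ext (by simp)) (fun _ _ _ => Subtype.ext (by simp))

/-- The bracket induced on cohomology: `[cl z, cl w] = cl [z, w]`. -/
def bracketH : 𝓛.H →ₗ[K] 𝓛.H →ₗ[K] 𝓛.H :=
  𝓛.coboundaries.liftQ
    { toFun := fun z => 𝓛.coboundaries.mapQ 𝓛.coboundaries (𝓛.bracketCocycles z) (by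
        rintro w ⟨m, hm⟩
        change 𝓛.bracket z w ∈ LinearMap.range 𝓛.d
        have hm' : 𝓛.d m = w := hm
        rw [← hm']
        exact bracket_d_mem_range z.2 m)
      map_add' := fun z z' => by
        ext w
        simp
      map_smul' := fun c z => by
        ext w
        simp }
    (by
      rintro z ⟨m, hm⟩
      rw [LinearMap.mem_ker]
      ext w
      refine (Submodule.Quotient.mk_eq_zero 𝓛.coboundaries).2 ?_
      change 𝓛.bracket z w ∈ LinearMap.range 𝓛.d
      have hm' : 𝓛.d m = z := hm
      rw [← hm']
      exact d_bracket_mem_range m w.2)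

/-- The part of degree `n` of the cohomology: the classes of the cocycles of degree `n`. -/
def grH (n : ℤ) : Submodule K 𝓛.H :=
  ((𝓛.gr n).submoduleOf 𝓛.cocycles).map 𝓛.coboundaries.mkQ

variable {𝓛}

theorem mem_grH {n : ℤ} {x : 𝓛.H} :
    x ∈ 𝓛.grH n ↔ ∃ z : 𝓛.cocycles, (z : L) ∈ 𝓛.gr n ∧ 𝓛.coboundaries.mkQ z = x :=
  Iff.rfl

theorem bracketH_mkQ (z w : 𝓛.cocycles) :
    𝓛.bracketH (𝓛.coboundaries.mkQ z) (𝓛.coboundaries.mkQ w) =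
      𝓛.coboundaries.mkQ (𝓛.bracketCocycles z w) :=
  rfl

theorem isInternal_grH : DirectSum.IsInternal 𝓛.grH := by
  let π : ℤ → 𝓛.H →ₗ[K] 𝓛.H := fun n =>
    𝓛.coboundaries.mapQ 𝓛.coboundaries
      ((𝓛.proj n).restrict fun z hz => proj_mem_cocycles n hz) (by
        rintro z ⟨m, hm⟩
        have hm' : 𝓛.d m = z := hm
        refine ⟨𝓛.proj (n - 1) m, ?_⟩
        rw [𝓛.d_proj, hm', sub_add_cancel]
        rfl)
  refine isInternal_of_proj 𝓛.grH π ?_ ?_ ?_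
  · rintro n x ⟨z, hz, rfl⟩
    exact congrArg 𝓛.coboundaries.mkQ (Subtype.ext (𝓛.proj_same hz))
  · rintro m n h x ⟨z, hz, rfl⟩
    have : (𝓛.proj n).restrict (fun z hz => proj_mem_cocycles n hz) z = (0 : 𝓛.cocycles) :=
      Subtype.ext (𝓛.proj_ne h hz)
    exact (congrArg 𝓛.coboundaries.mkQ this).trans (map_zero _)
  · intro x
    obtain ⟨z, rfl⟩ := 𝓛.coboundaries.mkQ_surjective x
    obtain ⟨s, hs⟩ := 𝓛.exists_sum_proj (z : L)
    have : z = ∑ n ∈ s, (⟨𝓛.proj n z, proj_mem_cocycles n z.2⟩ : 𝓛.cocycles) :=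
      Subtype.ext (by simp [hs])
    rw [this, map_sum]
    exact Submodule.sum_mem _ fun n _ =>
      Submodule.mem_iSup_of_mem n (mem_grH.2 ⟨_, 𝓛.proj_mem n z, rfl⟩)

variable (𝓛)

/-- The cohomology of a differential graded Lie algebra, with the induced grading and bracket and
with zero differential. -/
def cohomology : DGLA K 𝓛.H where
  gr := 𝓛.grH
  isInternal := isInternal_grH
  d := 0
  bracket := 𝓛.bracketH
  d_mem := fun _ => Submodule.zero_mem _
  d_d := fun _ => rfl
  bracket_mem := by
    rintro p q _ _ ⟨z, hz, rfl⟩ ⟨w, hw, rfl⟩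
    exact ⟨𝓛.bracketCocycles z w, 𝓛.bracket_mem hz hw, rfl⟩
  antisymm := by
    rintro p q _ _ ⟨z, hz, rfl⟩ ⟨w, hw, rfl⟩
    exact congrArg 𝓛.coboundaries.mkQ (Subtype.ext (𝓛.antisymm hz hw) :
      𝓛.bracketCocycles z w = -((p * q).negOnePow • 𝓛.bracketCocycles w z))
  leibniz := by simp
  jacobi := by
    rintro p q _ _ t ⟨x, hx, rfl⟩ ⟨y, hy, rfl⟩
    obtain ⟨z, rfl⟩ := 𝓛.coboundaries.mkQ_surjective t
    exact congrArg 𝓛.coboundaries.mkQ (Subtype.ext (𝓛.jacobi (z : L) hx hy) :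
      𝓛.bracketCocycles x (𝓛.bracketCocycles y z) =
        𝓛.bracketCocycles (𝓛.bracketCocycles x y) z +
          (p * q).negOnePow • 𝓛.bracketCocycles y (𝓛.bracketCocycles x z))

end Cohomology

section QuasiIsomorphism

variable {K : Type u} [Field K]

/-- Morphisms of differential graded Lie algebras. -/
structure IsHom {L : Type v₁} {M : Type v₂} [AddCommGroup L] [Module K L] [AddCommGroup M]
    [Module K M] (𝓛 : DGLA K L) (𝓜 : DGLA K M) (f : L →ₗ[K] M) : Prop where
  map_mem : ∀ {n : ℤ} {x : L}, x ∈ 𝓛.gr n → f x ∈ 𝓜.gr n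
  map_d : ∀ x : L, f (𝓛.d x) = 𝓜.d (f x)
  map_bracket : ∀ x y : L, f (𝓛.bracket x y) = 𝓜.bracket (f x) (f y)

/-- The map induced on cohomology by a morphism. -/
def IsHom.mapH {L : Type v₁} {M : Type v₂} [AddCommGroup L] [Module K L] [AddCommGroup M]
    [Module K M] {𝓛 : DGLA K L} {𝓜 : DGLA K M} {f : L →ₗ[K] M} (hf : IsHom 𝓛 𝓜 f) :
    𝓛.H →ₗ[K] 𝓜.H :=
  𝓛.coboundaries.mapQ 𝓜.coboundaries
    (f.restrict fun x hx => by
      rw [LinearMap.mem_ker] at hx ⊢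
      rw [← hf.map_d, hx, map_zero])
    (by
      rintro x ⟨m, hm⟩
      have hm' : 𝓛.d m = x := hm
      refine ⟨f m, ?_⟩
      rw [← hf.map_d, hm']
      rfl)

/-- A linear map is a quasi-isomorphism of differential graded Lie algebras if it is a morphism
and induces an isomorphism on cohomology. -/
def IsQuasiIso {L : Type v₁} {M : Type v₂} [AddCommGroup L] [Module K L] [AddCommGroup M]
    [Module K M] (𝓛 : DGLA K L) (𝓜 : DGLA K M) (f : L →ₗ[K] M) : Prop :=
  ∃ hf : IsHom 𝓛 𝓜 f, Function.Bijective hf.mapH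

/-- A differential graded Lie algebra bundled with its underlying vector space. -/
structure Bundled (K : Type u) [Field K] where
  carrier : Type v
  [addCommGroup : AddCommGroup carrier]
  [module : Module K carrier]
  dgla : DGLA K carrier

attribute [instance] Bundled.addCommGroup Bundled.module

/-- Two differential graded Lie algebras are quasi-isomorphic if they are linked by a finite zigzag
`𝓛 ← X — ⋯ — Y → 𝓜` of quasi-isomorphisms of differential graded Lie algebras, where each
intermediate arrow may point either way. (The zigzag begins and ends with an outward arrow, which
may be an isomorphism, so that the intermediate objects can live in a common universe.) -/
def QuasiIsomorphic {L : Type v₁} {M : Type v₂} [AddCommGroup L] [Module K L] [AddCommGroup M]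
    [Module K M] (𝓛 : DGLA K L) (𝓜 : DGLA K M) : Prop :=
  ∃ X Y : Bundled.{u, max u v₁ v₂} K,
    (∃ f : X.carrier →ₗ[K] L, IsQuasiIso X.dgla 𝓛 f) ∧
    Relation.EqvGen
      (fun S T : Bundled.{u, max u v₁ v₂} K =>
        ∃ f : S.carrier →ₗ[K] T.carrier, IsQuasiIso S.dgla T.dgla f) X Y ∧
    (∃ g : Y.carrier →ₗ[K] M, IsQuasiIso Y.dgla 𝓜 g)

/-- A differential graded Lie algebra is formal if it is quasi-isomorphic to its cohomology. -/
def IsFormal {L : Type v} [AddCommGroup L] [Module K L] (𝓛 : DGLA K L) : Prop :=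
  QuasiIsomorphic 𝓛 𝓛.cohomology

end QuasiIsomorphism

end DGLA

/-! ### Graded commutative algebras and differential operators -/

section GradedAlgebra

variable {K : Type u} {A : Type v} [Field K] [Ring A] [Algebra K A]

/-- `f` is homogeneous of degree `n`. -/
def IsHomogeneousMap (𝒜 : ℤ → Submodule K A) (n : ℤ) (f : A →ₗ[K] A) : Prop :=
  ∀ (p : ℤ) (a : A), a ∈ 𝒜 p → f a ∈ 𝒜 (p + n)

/-- The graded commutator `[f, g] = f g - (-1) ^ (m n) g f` of linear maps `f` of degree `m` and
`g` of degree `n`. -/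
def gradedCommutator (m n : ℤ) (f g : A →ₗ[K] A) : A →ₗ[K] A :=
  f ∘ₗ g - (m * n).negOnePow • (g ∘ₗ f)

/-- `IsDiffOp 𝒜 k n f`: `f` is a differential operator of order at most `k`, homogeneous of degree
`n`. For `k ≥ 0` the condition is that all `[f, a]` have order at most `k - 1`, where `a` stands
for the left multiplication by `a`, and the only operator of negative order is `0`. It suffices to
ask this for homogeneous `a`, since `[f, a]` is additive in `a`. -/
def IsDiffOp (𝒜 : ℤ → Submodule K A) : ℕ → ℤ → (A →ₗ[K] A) → Prop
  | 0, n, f => IsHomogeneousMap 𝒜 n f ∧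
      ∀ (p : ℤ) (a : A), a ∈ 𝒜 p → gradedCommutator n p f (LinearMap.mulLeft K a) = 0
  | k + 1, n, f => IsHomogeneousMap 𝒜 n f ∧
      ∀ (p : ℤ) (a : A), a ∈ 𝒜 p →
        IsDiffOp 𝒜 k (n + p) (gradedCommutator n p f (LinearMap.mulLeft K a))

/-- Quasi-Batalin-Vilkovisky operators of degree `n`: differential operators of order at most `2`
that vanish on the unit. -/
def IsQuasiBV (𝒜 : ℤ → Submodule K A) (n : ℤ) (f : A →ₗ[K] A) : Prop :=
  IsDiffOp 𝒜 2 n f ∧ f 1 = 0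

/-- `(A, d)`, graded by `𝒜`, is a differential graded commutative algebra. -/
structure IsDGCA (𝒜 : ℤ → Submodule K A) (d : A →ₗ[K] A) : Prop where
  mul_comm : ∀ (p q : ℤ) (a b : A), a ∈ 𝒜 p → b ∈ 𝒜 q → a * b = (p * q).negOnePow • (b * a)
  d_mem : IsHomogeneousMap 𝒜 1 d
  d_d : ∀ a : A, d (d a) = 0
  leibniz : ∀ (p : ℤ) (a b : A), a ∈ 𝒜 p → d (a * b) = d a * b + p.negOnePow • (a * d b)

/-- The operator `R = [i, μ₁]` attached to a linear map `i` of even degree, where `μ₁` is the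
multiplication: `R(a, b) = i(ab) - i(a)b - a i(b)`. -/
def leibnizDefect (i : A →ₗ[K] A) (a b : A) : A :=
  i (a * b) - i a * b - a * i b

/-- The Koszul bracket `[a, b]_l = (-1) ^ p (l(ab) - l(a)b) - a l(b)`, for `a` of degree `p`. -/
def koszulBracket (l : A →ₗ[K] A) (p : ℤ) (a b : A) : A :=
  p.negOnePow • (l (a * b) - l a * b) - a * l b

end GradedAlgebra

/-! An operator f on A is replaced by the formal vector field Φ(f) = `koszul f` on the graded vector
space A, whose Taylor coefficients are the Koszul brackets [⋯[[f, a₁], a₂], ⋯, aₙ](1). Φ takes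
graded commutators to commutators of vector fields (`koszul_gradedCommutator`), and an operator of
order at most m has no coefficient above degree m (`koszul_component_eq_zero`). So Φ(d) is a linear
field δ with [δ, δ] = 0, Φ(i) is a linear field plus the quadratic field R given by R(a, b), and
Φ(l) is a linear field plus q = [R, δ], which is the bracket [ , ]_l up to sign. The cubic
coefficient of Φ([l, i]) is that of [q, R]; since [l, i] has order at most 2, [R, [R, δ]] = 0
(`bracket_quadraticPart_bracket`). After the even shift by 2k, R has degree 0 and δ degree 1
(`isGaugePair`), and exp(-ad R)(δ + q) = δ. Thus the L∞-structure δ + q is gauge equivalent to the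
abelian structure δ, and since d and R preserve B this restricts to B.

To obtain a zigzag of differential graded Lie algebras, let L be B with its bracket, M the algebra
of vector fields preserving B with differential -[δ, ·], and S ⊂ M the fields vanishing at the
origin. In the algebra with differential -[δ + q, ·], the constants y and the fields -∂q/∂x span an
image of the cone of L; composing with exp(-ad R) gives a morphism κ from the cone to M
(`δ_coneField`, `bracket_coneField`). Since exp(-ad R) does not change values at the origin, κ
induces an isomorphism cone(L)/L → M/S. Hence the homotopy fibres of L → cone(L) and S → M are
quasi-isomorphic. The first is quasi-isomorphic to L because the cone is acyclic. The second has the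
cohomology of L, and it is represented by the constant fields multiplied by dt, which commute. The
bracket on H(L) vanishes because q = [R, δ] is exact on cocycles (`bracket_mem_range_of_mem`), so
H(L) maps quasi-isomorphically to the second fibre. This is `isFormal_of_cone`, applied in
`isFormal_dgla`. -/

namespace DGLA

/-! ### Subalgebras and extensions of differential graded Lie algebras by an odd variable -/

section Constructions

variable {K : Type u} {L : Type v} {M : Type w} [Field K] [AddCommGroup L] [Module K L]
  [AddCommGroup M] [Module K M]

theorem homogeneous_induction (𝓛 : DGLA K L) {P : L → Prop}
    (hom : ∀ n, ∀ x ∈ 𝓛.gr n, P x) (add : ∀ x y, P x → P y → P (x + y)) (x : L) : P x := by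
  have hx : x ∈ iSup 𝓛.gr := by
    rw [𝓛.isInternal.submodule_iSup_eq_top]
    trivial
  exact Submodule.iSup_induction 𝓛.gr (motive := P) hx hom (hom 0 0 (Submodule.zero_mem _)) add

/-- The operator which is multiplication by `(-1) ^ n` in degree `n`. -/
noncomputable def sgn (𝓛 : DGLA K L) : L →ₗ[K] L :=
  letI := 𝓛.isInternal.chooseDecomposition
  DirectSum.toModule K ℤ L (fun n => n.negOnePow • (𝓛.gr n).subtype) ∘ₗ
    (DirectSum.decomposeLinearEquiv 𝓛.gr).toLinearMap

theorem sgn_apply (𝓛 : DGLA K L) {n : ℤ} {x : L} (hx : x ∈ 𝓛.gr n) :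
    𝓛.sgn x = n.negOnePow • x := by
  let _ := 𝓛.isInternal.chooseDecomposition
  lift x to 𝓛.gr n using hx
  simp only [sgn, LinearMap.comp_apply, LinearEquiv.coe_coe, DirectSum.decomposeLinearEquiv_apply,
    DirectSum.decompose_coe]
  rw [← DirectSum.lof_eq_of K, DirectSum.toModule_lof]
  rfl

/-- A graded subspace closed under the differential and the bracket. -/
structure IsSub (𝓛 : DGLA K L) (S : Submodule K L) : Prop where
  proj_mem : ∀ n, ∀ x ∈ S, 𝓛.proj n x ∈ S
  d_mem : ∀ x ∈ S, 𝓛.d x ∈ S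
  bracket_mem : ∀ x ∈ S, ∀ y ∈ S, 𝓛.bracket x y ∈ S

/-- The restriction of the structure to a graded subspace closed under all operations. -/
noncomputable def restrict (𝓛 : DGLA K L) {S : Submodule K L} (hS : 𝓛.IsSub S) : DGLA K S where
  gr n := (𝓛.gr n).submoduleOf S
  isInternal := by
    refine isInternal_of_proj _ (fun n => (𝓛.proj n).restrict (hS.proj_mem n)) ?_ ?_ ?_
    · exact fun n x hx => Subtype.ext (𝓛.proj_same hx)
    · exact fun m n h x hx => Subtype.ext (𝓛.proj_ne h hx)
    · intro x
      obtain ⟨s, hs⟩ := 𝓛.exists_sum_proj (x : L)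
      have : x = ∑ n ∈ s, (⟨𝓛.proj n x, hS.proj_mem n x x.2⟩ : S) := Subtype.ext (by simp [hs])
      rw [this]
      exact Submodule.sum_mem _ fun n _ => Submodule.mem_iSup_of_mem n (𝓛.proj_mem n x)
  d := 𝓛.d.restrict hS.d_mem
  bracket := LinearMap.mk₂ K (fun x y => ⟨𝓛.bracket x y, hS.bracket_mem x x.2 y y.2⟩)
    (fun _ _ _ => Subtype.ext (by simp)) (fun _ _ _ => Subtype.ext (by simp))
    (fun _ _ _ => Subtype.ext (by simp)) (fun _ _ _ => Subtype.ext (by simp))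
  d_mem := fun hx => 𝓛.d_mem hx
  d_d := fun x => Subtype.ext (𝓛.d_d x)
  bracket_mem := fun hx hy => 𝓛.bracket_mem hx hy
  antisymm := fun hx hy => Subtype.ext (𝓛.antisymm hx hy)
  leibniz := fun y hx => Subtype.ext (𝓛.leibniz (y : L) hx)
  jacobi := fun z hx hy => Subtype.ext (𝓛.jacobi (z : L) hx hy)

/-- Bijectivity on cohomology, unwound to representatives; every quasi-isomorphism below is checked
in this form, except composites. -/
theorem IsHom.isQuasiIso {𝓛 : DGLA K L} {𝓜 : DGLA K M} {f : L →ₗ[K] M} (hf : IsHom 𝓛 𝓜 f)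
    (inj : ∀ x, 𝓛.d x = 0 → ∀ w, f x = 𝓜.d w → ∃ u, 𝓛.d u = x)
    (surj : ∀ y, 𝓜.d y = 0 → ∃ x w, 𝓛.d x = 0 ∧ f x - y = 𝓜.d w) : IsQuasiIso 𝓛 𝓜 f := by
  refine ⟨hf, ?_, ?_⟩
  · rw [injective_iff_map_eq_zero]
    intro a ha
    obtain ⟨z, rfl⟩ := 𝓛.coboundaries.mkQ_surjective a
    obtain ⟨w, hw⟩ := (Submodule.Quotient.mk_eq_zero 𝓜.coboundaries).1 ha
    obtain ⟨u, hu⟩ := inj z z.2 w hw.symm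
    exact (Submodule.Quotient.mk_eq_zero 𝓛.coboundaries).2 ⟨u, hu⟩
  · intro b
    obtain ⟨y, rfl⟩ := 𝓜.coboundaries.mkQ_surjective b
    obtain ⟨x, w, hx, hw⟩ := surj y y.2
    exact ⟨𝓛.coboundaries.mkQ ⟨x, hx⟩, (Submodule.Quotient.eq 𝓜.coboundaries).2 ⟨w, hw.symm⟩⟩

theorem map_proj {𝓛 : DGLA K L} {𝓜 : DGLA K M} {f : L →ₗ[K] M}
    (h : ∀ n, ∀ x ∈ 𝓛.gr n, f x ∈ 𝓜.gr n) (n : ℤ) (x : L) : f (𝓛.proj n x) = 𝓜.proj n (f x) := by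
  induction x using 𝓛.homogeneous_induction with
  | add x x' hx hx' => simp [hx, hx']
  | hom p x hx =>
    by_cases hp : p = n
    · subst hp
      rw [𝓛.proj_same hx, 𝓜.proj_same (h _ _ hx)]
    · rw [𝓛.proj_ne hp hx, 𝓜.proj_ne hp (h _ _ hx), map_zero]

theorem map_sgn {𝓛 : DGLA K L} {𝓜 : DGLA K M} {f : L →ₗ[K] M}
    (h : ∀ n, ∀ x ∈ 𝓛.gr n, f x ∈ 𝓜.gr n) (x : L) : f (𝓛.sgn x) = 𝓜.sgn (f x) := by
  induction x using 𝓛.homogeneous_induction with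
  | add x x' hx hx' => simp [hx, hx']
  | hom p x hx => rw [𝓛.sgn_apply hx, 𝓜.sgn_apply (h _ _ hx), map_zsmul_unit]

/-- A bilinear identity between brackets may be checked on homogeneous elements. -/
theorem map_bracket_of_homogeneous {𝓛 : DGLA K L} {𝓜 : DGLA K M} {f : L →ₗ[K] M}
    (h : ∀ p q, ∀ x ∈ 𝓛.gr p, ∀ y ∈ 𝓛.gr q, f (𝓛.bracket x y) = 𝓜.bracket (f x) (f y))
    (x y : L) : f (𝓛.bracket x y) = 𝓜.bracket (f x) (f y) := by
  induction x using 𝓛.homogeneous_induction with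
  | add x x' hx hx' => simp [hx, hx']
  | hom p x hx =>
    induction y using 𝓛.homogeneous_induction with
    | add y y' hy hy' => simp [hy, hy']
    | hom q y hy => exact h p q x hx y hy

/-- The extension of a differential graded Lie algebra by an odd variable `η` of degree `s`: the
elements are `f + η g`, and `d (f + η g) = (d f + c g) + η (β f - d g)`. -/
noncomputable def oddExt (𝓛 : DGLA K L) (s : ℤ) (hs : Odd s) (c : K) (hc : c = 0 ∨ s = -1)
    (β : L →ₗ[K] L) (hβ : β = 0 ∨ s = 1) (hβgr : ∀ n, ∀ x ∈ 𝓛.gr n, β x ∈ 𝓛.gr n)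
    (hβd : ∀ x, β (𝓛.d x) = 𝓛.d (β x))
    (hβb : ∀ x y, β (𝓛.bracket x y) = 𝓛.bracket (β x) y + 𝓛.bracket x (β y)) :
    DGLA K (L × L) where
  gr n := (𝓛.gr n).prod (𝓛.gr (n - s))
  isInternal := by
    refine isInternal_of_proj _ (fun n => (𝓛.proj n).prodMap (𝓛.proj (n - s))) ?_ ?_ ?_
    · exact fun n x hx => Prod.ext (𝓛.proj_same hx.1) (𝓛.proj_same hx.2)
    · exact fun m n h x hx => Prod.ext (𝓛.proj_ne h hx.1) (𝓛.proj_ne (by omega) hx.2)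
    · rintro ⟨x, y⟩
      have hx : ((x, 0) : L × L) ∈ ⨆ n, (𝓛.gr n).prod (𝓛.gr (n - s)) := by
        induction x using 𝓛.homogeneous_induction with
        | add x x' h h' => simpa using Submodule.add_mem _ h h'
        | hom n x h => exact Submodule.mem_iSup_of_mem n ⟨h, Submodule.zero_mem _⟩
      have hy : ((0, y) : L × L) ∈ ⨆ n, (𝓛.gr n).prod (𝓛.gr (n - s)) := by
        induction y using 𝓛.homogeneous_induction with
        | add x x' h h' => simpa using Submodule.add_mem _ h h'
        | hom n x h =>
          exact Submodule.mem_iSup_of_mem (n + s) ⟨Submodule.zero_mem _, by simpa using h⟩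
      simpa using Submodule.add_mem _ hx hy
  d := (𝓛.d.coprod (c • LinearMap.id)).prod (β.coprod (-𝓛.d))
  bracket := LinearMap.mk₂ K (fun x y => (𝓛.bracket x.1 y.1,
      𝓛.bracket x.2 y.1 + 𝓛.bracket (𝓛.sgn x.1) y.2))
    (fun _ _ _ => Prod.ext (by simp) (by simp; abel))
    (fun _ _ _ => Prod.ext (by simp) (by simp))
    (fun _ _ _ => Prod.ext (by simp) (by simp; abel))
    (fun _ _ _ => Prod.ext (by simp) (by simp))
  d_mem := by
    rintro n ⟨x, y⟩ ⟨hx, hy⟩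
    refine ⟨Submodule.add_mem _ (𝓛.d_mem hx) ?_, Submodule.add_mem _ ?_ (Submodule.neg_mem _ ?_)⟩
    · rcases hc with rfl | rfl
      · simp
      · exact Submodule.smul_mem _ _ (by simpa using hy)
    · rcases hβ with rfl | rfl
      · simp
      · simpa using hβgr n x hx
    · have := 𝓛.d_mem hy
      rwa [show n - s + 1 = n + 1 - s by ring] at this
  d_d := by
    rintro ⟨x, y⟩
    -- The square of the differential is `c • β` on each component. A nonzero `c` forces `s = -1`
    -- and a nonzero `β` forces `s = 1`, so one of them vanishes.
    have hcβ : c • β = 0 := by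
      rcases hc with rfl | rfl
      · simp
      · rcases hβ with rfl | h
        · simp
        · omega
    have hx : c • β x = 0 := congrArg (· x) hcβ
    have hy : c • β y = 0 := congrArg (· y) hcβ
    refine Prod.ext ?_ ?_
    · simp [𝓛.d_d, hx]
    · simp [𝓛.d_d, hβd, hy]
  bracket_mem := by
    rintro p q ⟨x, y⟩ ⟨x', y'⟩ ⟨hx, hy⟩ ⟨hx', hy'⟩
    refine ⟨𝓛.bracket_mem hx hx', Submodule.add_mem _ ?_ ?_⟩
    · have := 𝓛.bracket_mem hy hx'
      rwa [show p - s + q = p + q - s by ring] at this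
    · have := 𝓛.bracket_mem hx hy'
      rw [show p + (q - s) = p + q - s by ring] at this
      simp only [𝓛.sgn_apply hx, map_zsmul_unit, LinearMap.smul_apply]
      rcases Int.units_eq_one_or p.negOnePow with e | e <;> simpa [e] using this
  antisymm := by
    rintro p q ⟨x, y⟩ ⟨x', y'⟩ ⟨hx, hy⟩ ⟨hx', hy'⟩
    dsimp at hx hy hx' hy'
    refine Prod.ext (𝓛.antisymm hx hx') ?_
    simp only [LinearMap.mk₂_apply, Prod.snd_neg, Prod.smul_snd, 𝓛.sgn_apply hx, 𝓛.sgn_apply hx']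
    have h1 := 𝓛.antisymm hy hx'
    have h2 := 𝓛.antisymm hx hy'
    have hsq : (s * q).negOnePow = q.negOnePow := by
      obtain ⟨m, rfl⟩ := hs
      simp [add_mul, Int.negOnePow_add, mul_assoc]
    have hps : (p * s).negOnePow = p.negOnePow := by
      obtain ⟨m, rfl⟩ := hs
      simp [mul_add, Int.negOnePow_add, mul_left_comm p 2 m]
    simp only [sub_mul, mul_sub, Int.negOnePow_sub, hsq, hps] at h1 h2
    simp only [map_zsmul_unit, LinearMap.smul_apply, h1, h2]
    rcases Int.units_eq_one_or (p * q).negOnePow with e | e <;>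
    rcases Int.units_eq_one_or p.negOnePow with e' | e' <;>
    rcases Int.units_eq_one_or q.negOnePow with e'' | e'' <;>
    simp [e, e', e'', add_comm]
  leibniz := by
    rintro p ⟨x, y⟩ ⟨x', y'⟩ ⟨hx, hy⟩
    dsimp at hx hy
    have hsub : (p - s).negOnePow = -p.negOnePow := by
      rw [Int.negOnePow_sub, Int.negOnePow_odd s hs, mul_neg, mul_one]
    have hsy : c • 𝓛.sgn y = -(p.negOnePow • c • y) := by
      rw [𝓛.sgn_apply hy, hsub, Units.neg_smul, smul_neg, smul_comm]
    have h1 := 𝓛.leibniz x' hx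
    have h2 := 𝓛.leibniz x' hy
    have h3 := 𝓛.leibniz y' hx
    rw [hsub] at h2
    have hdx := 𝓛.sgn_apply (𝓛.d_mem hx)
    rw [Int.negOnePow_succ] at hdx
    refine Prod.ext ?_ ?_
    · simp only [LinearMap.mk₂_apply, LinearMap.prod_apply, Function.prod_apply,
        LinearMap.coprod_apply, Prod.fst_add, Prod.smul_fst, 𝓛.sgn_apply hx, h1, map_add,
        map_smul, LinearMap.smul_apply, LinearMap.id_apply, LinearMap.add_apply, map_zsmul_unit]
      rcases Int.units_eq_one_or p.negOnePow with e | e <;> simp [e] <;> module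
    · simp only [LinearMap.mk₂_apply, LinearMap.prod_apply, Function.prod_apply,
        LinearMap.coprod_apply, Prod.snd_add, Prod.smul_snd, 𝓛.sgn_apply hx, h2, h3, map_add,
        map_smul, LinearMap.smul_apply, LinearMap.id_apply, LinearMap.add_apply, map_zsmul_unit,
        hβb, hdx, hsy, LinearMap.neg_apply, map_neg]
      rcases Int.units_eq_one_or p.negOnePow with e | e <;> simp [e] <;> module
  jacobi := by
    rintro p q ⟨x, y⟩ ⟨x', y'⟩ ⟨z, z'⟩ ⟨hx, hy⟩ ⟨hx', hy'⟩
    dsimp at hx hy hx' hy'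
    refine Prod.ext (𝓛.jacobi z hx hx') ?_
    have h1 := 𝓛.jacobi z hy hx'
    have h2 := 𝓛.jacobi z hx hy'
    have h3 := 𝓛.jacobi z' hx hx'
    have hsq : (s * q).negOnePow = q.negOnePow := by
      obtain ⟨m, rfl⟩ := hs
      simp [add_mul, Int.negOnePow_add, mul_assoc]
    have hps : (p * s).negOnePow = p.negOnePow := by
      obtain ⟨m, rfl⟩ := hs
      simp [mul_add, Int.negOnePow_add, mul_left_comm p 2 m]
    simp only [sub_mul, mul_sub, Int.negOnePow_sub, hsq, hps] at h1 h2
    have h4 := 𝓛.sgn_apply (𝓛.bracket_mem hx hx')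
    rw [Int.negOnePow_add] at h4
    simp only [LinearMap.mk₂_apply, Prod.snd_add, Prod.smul_snd, 𝓛.sgn_apply hx,
      𝓛.sgn_apply hx', h4, map_zsmul_unit, LinearMap.smul_apply, map_add, LinearMap.add_apply,
      h1, h2, h3]
    rcases Int.units_eq_one_or (p * q).negOnePow with e | e <;>
    rcases Int.units_eq_one_or p.negOnePow with e' | e' <;>
    rcases Int.units_eq_one_or q.negOnePow with e'' | e'' <;>
    simp [e, e', e''] <;> abel

end Constructions

end DGLA

open scoped TensorProduct

namespace DGLA

/-! ### Polynomial forms on the line, and the cone -/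

section Polynomials

open Polynomial

variable {K : Type u} {L : Type v} [Field K] [AddCommGroup L] [Module K L]

/-- The structure on `K[t] ⊗ L` obtained by extension of scalars. -/
noncomputable def polynomial (𝓛 : DGLA K L) : DGLA K (K[X] ⊗[K] L) where
  gr n := Submodule.span K {t | ∃ p : K[X], ∃ x ∈ 𝓛.gr n, p ⊗ₜ[K] x = t}
  isInternal := by
    refine isInternal_of_proj _ (fun n => (𝓛.proj n).lTensor K[X]) ?_ ?_ ?_
    · intro n x hx
      induction hx using Submodule.span_induction with
      | mem x h => obtain ⟨p, y, hy, rfl⟩ := h; simp [𝓛.proj_same hy]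
      | zero => simp
      | add x y _ _ hx hy => simp [hx, hy]
      | smul a x _ hx => simp [hx]
    · intro m n h x hx
      induction hx using Submodule.span_induction with
      | mem x h' => obtain ⟨p, y, hy, rfl⟩ := h'; simp [𝓛.proj_ne h hy]
      | zero => simp
      | add x y _ _ hx hy => simp [hx, hy]
      | smul a x _ hx => simp [hx]
    · intro x
      induction x with
      | zero => exact Submodule.zero_mem _
      | add x y hx hy => exact Submodule.add_mem _ hx hy
      | tmul p y =>
        induction y using 𝓛.homogeneous_induction with
        | add x x' h h' => simpa [TensorProduct.tmul_add] using Submodule.add_mem _ h h'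
        | hom n x h =>
          exact Submodule.mem_iSup_of_mem n (Submodule.subset_span ⟨p, x, h, rfl⟩)
  d := 𝓛.d.lTensor K[X]
  bracket := TensorProduct.map₂ (LinearMap.mul K K[X]) 𝓛.bracket
  d_mem := by
    intro n x hx
    induction hx using Submodule.span_induction with
    | mem x h => obtain ⟨p, y, hy, rfl⟩ := h; exact Submodule.subset_span ⟨p, _, 𝓛.d_mem hy, rfl⟩
    | zero => simp
    | add x y _ _ hx hy => simpa using Submodule.add_mem _ hx hy
    | smul a x _ hx => simpa using Submodule.smul_mem _ a hx
  d_d := by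
    intro x
    induction x with
    | zero => simp
    | add x y hx hy => simp [hx, hy]
    | tmul p y => simp [𝓛.d_d]
  bracket_mem := by
    intro p q x y hx hy
    induction hx using Submodule.span_induction with
    | zero => simp
    | add x y _ _ hx hy => simpa using Submodule.add_mem _ hx hy
    | smul a x _ hx => simpa using Submodule.smul_mem _ a hx
    | mem x h =>
      obtain ⟨f, x, hx, rfl⟩ := h
      induction hy using Submodule.span_induction with
      | zero => simp
      | add x y _ _ hx hy => simpa using Submodule.add_mem _ hx hy
      | smul a x _ hx => simpa using Submodule.smul_mem _ a hx
      | mem y h =>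
        obtain ⟨g, y, hy, rfl⟩ := h
        exact Submodule.subset_span ⟨f * g, _, 𝓛.bracket_mem hx hy, rfl⟩
  antisymm := by
    intro p q x y hx hy
    induction hx using Submodule.span_induction with
    | zero => simp
    | add x y _ _ hx hy => simp only [map_add, LinearMap.add_apply, hx, hy, smul_add, neg_add]
    | smul a x _ hx => rw [map_smul, map_smul, LinearMap.smul_apply, hx, smul_neg, smul_comm]
    | mem x h =>
      obtain ⟨f, x, hx, rfl⟩ := h
      induction hy using Submodule.span_induction with
      | zero => simp
      | add x y _ _ hx hy => simp only [map_add, LinearMap.add_apply, hx, hy, smul_add, neg_add]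
      | smul a x _ hx => rw [map_smul, map_smul, LinearMap.smul_apply, hx, smul_neg, smul_comm]
      | mem y h =>
        obtain ⟨g, y, hy, rfl⟩ := h
        have := 𝓛.antisymm hx hy
        rcases Int.units_eq_one_or (p * q).negOnePow with e | e <;>
          simp [this, e, mul_comm f g, TensorProduct.tmul_neg]
  leibniz := by
    intro p x y hx
    induction hx using Submodule.span_induction with
    | zero => simp
    | add x x' _ _ hx hx' => simp only [map_add, LinearMap.add_apply, hx, hx', smul_add]; abel
    | smul a x _ hx =>
      simp only [map_smul, LinearMap.smul_apply, hx, smul_add, smul_comm a (p.negOnePow)]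
    | mem x h =>
      obtain ⟨f, x, hx, rfl⟩ := h
      induction y with
      | zero => simp
      | add y y' hy hy' => simp only [map_add, hy, hy', smul_add]; abel
      | tmul g y =>
        have := 𝓛.leibniz y hx
        rcases Int.units_eq_one_or p.negOnePow with e | e <;>
          simp [this, e, TensorProduct.tmul_add, TensorProduct.tmul_neg]
  jacobi := by
    intro p q x y z hx hy
    induction hx using Submodule.span_induction with
    | zero => simp
    | add x x' _ _ hx hx' => simp only [map_add, LinearMap.add_apply, hx, hx', smul_add]; abel
    | smul a x _ hx =>
      simp only [map_smul, LinearMap.smul_apply, hx, smul_add, smul_comm a (p * q).negOnePow]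
    | mem x h =>
      obtain ⟨f, x, hx, rfl⟩ := h
      induction hy using Submodule.span_induction with
      | zero => simp
      | add x x' _ _ hx hx' => simp only [map_add, LinearMap.add_apply, hx, hx', smul_add]; abel
      | smul a x _ hx =>
        simp only [map_smul, LinearMap.smul_apply, hx, smul_add, smul_comm a (p * q).negOnePow]
      | mem y h =>
        obtain ⟨g, y, hy, rfl⟩ := h
        induction z with
        | zero => simp
        | add y y' hy hy' => simp only [map_add, hy, hy', smul_add]; abel
        | tmul h z =>
          have := 𝓛.jacobi z hx hy
          rcases Int.units_eq_one_or (p * q).negOnePow with e | e <;>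
            simp [this, e, TensorProduct.tmul_add, TensorProduct.tmul_neg, mul_assoc,
              mul_left_comm g f h]

/-- Differentiation of polynomials with coefficients in `L`. -/
noncomputable def polyDeriv : K[X] ⊗[K] L →ₗ[K] K[X] ⊗[K] L :=
  (Polynomial.derivative : K[X] →ₗ[K] K[X]).rTensor L

/-- Evaluation at `c` of polynomials with coefficients in `L`. -/
noncomputable def polyEval (c : K) : K[X] ⊗[K] L →ₗ[K] L :=
  (TensorProduct.lid K L).toLinearMap ∘ₗ (Polynomial.leval c).rTensor L

/-- The primitive of a polynomial that vanishes at `0`. -/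
noncomputable def primitive : K[X] →ₗ[K] K[X] :=
  (Polynomial.basisMonomials K).constr K fun n => monomial (n + 1) ((n + 1 : K)⁻¹)

/-- The primitive of a polynomial with coefficients in `L` that vanishes at `0`. -/
noncomputable def polyPrim : K[X] ⊗[K] L →ₗ[K] K[X] ⊗[K] L :=
  (primitive : K[X] →ₗ[K] K[X]).rTensor L

theorem primitive_monomial (n : ℕ) :
    primitive (monomial n (1 : K)) = monomial (n + 1) ((n + 1 : K)⁻¹) := by
  simpa [primitive] using (Polynomial.basisMonomials K).constr_basis K
    (fun n => monomial (n + 1) ((n + 1 : K)⁻¹)) n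

@[simp] theorem polyDeriv_tmul (p : K[X]) (x : L) :
    polyDeriv (p ⊗ₜ[K] x) = derivative p ⊗ₜ[K] x := rfl

@[simp] theorem polyEval_tmul (c : K) (p : K[X]) (x : L) :
    polyEval c (p ⊗ₜ[K] x) = p.eval c • x := rfl

@[simp] theorem polyPrim_tmul (p : K[X]) (x : L) :
    polyPrim (p ⊗ₜ[K] x) = primitive p ⊗ₜ[K] x := rfl

theorem derivative_primitive [CharZero K] (p : K[X]) : derivative (primitive p) = p := by
  have : (derivative : K[X] →ₗ[K] K[X]) ∘ₗ primitive = LinearMap.id := by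
    refine (Polynomial.basisMonomials K).ext fun n => ?_
    have hn : (n + 1 : K) ≠ 0 := by exact_mod_cast n.succ_ne_zero
    simp [primitive_monomial, hn]
  exact LinearMap.congr_fun this p

theorem primitive_derivative [CharZero K] (p : K[X]) :
    primitive (derivative p) = p - C (p.eval 0) := by
  have : primitive ∘ₗ (derivative : K[X] →ₗ[K] K[X]) =
      LinearMap.id - (monomial 0) ∘ₗ Polynomial.leval 0 := by
    refine (Polynomial.basisMonomials K).ext fun n => ?_
    rcases n with _ | n
    · simp
    · have hn : (n + 1 : K) ≠ 0 := by exact_mod_cast n.succ_ne_zero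
      have h : monomial n (n + 1 : K) = (n + 1 : K) • monomial n (1 : K) := by
        simp [smul_monomial]
      have h' : derivative (monomial (n + 1) (1 : K)) = (n + 1 : K) • monomial n (1 : K) := by
        rw [← h, derivative_monomial]
        simp
      have h0 : (monomial (n + 1) (1 : K)).eval 0 = 0 := by simp
      change primitive (derivative (basisMonomials K (n + 1))) =
        basisMonomials K (n + 1) - monomial 0 ((basisMonomials K (n + 1)).eval 0)
      rw [coe_basisMonomials, h', map_smul, primitive_monomial, h0, smul_monomial, smul_eq_mul,
        mul_inv_cancel₀ hn, map_zero, sub_zero]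
  exact LinearMap.congr_fun this p

theorem eval_zero_primitive (p : K[X]) : (primitive p).eval 0 = 0 := by
  have : Polynomial.leval (0 : K) ∘ₗ primitive = 0 := by
    refine (Polynomial.basisMonomials K).ext fun n => ?_
    simp [primitive_monomial, leval]
  exact LinearMap.congr_fun this p

theorem polyDeriv_polyPrim [CharZero K] (x : K[X] ⊗[K] L) : polyDeriv (polyPrim x) = x := by
  induction x with
  | zero => simp
  | add x y hx hy => simp [hx, hy]
  | tmul p y => simp [derivative_primitive]

/-- Characteristic `0` enters here: with `polyDeriv_polyPrim` this is the Poincaré lemma on the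
line, with primitives normalised to vanish at `0`. -/
theorem polyPrim_polyDeriv [CharZero K] (x : K[X] ⊗[K] L) :
    polyPrim (polyDeriv x) = x - 1 ⊗ₜ polyEval 0 x := by
  induction x with
  | zero => simp
  | add x y hx hy => simp [hx, hy, TensorProduct.tmul_add]; abel
  | tmul p y =>
    simp [primitive_derivative, TensorProduct.sub_tmul, TensorProduct.smul_tmul', smul_eq_C_mul]

theorem polyEval_zero_polyPrim (x : K[X] ⊗[K] L) : polyEval 0 (polyPrim x) = 0 := by
  induction x with
  | zero => simp
  | add x y hx hy => simp [hx, hy]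
  | tmul p y => simp [eval_zero_primitive]

variable (𝓛 : DGLA K L)

@[simp] theorem polynomial_d_tmul (p : K[X]) (x : L) :
    𝓛.polynomial.d (p ⊗ₜ x) = p ⊗ₜ 𝓛.d x := rfl

@[simp] theorem polynomial_bracket_tmul (p q : K[X]) (x y : L) :
    𝓛.polynomial.bracket (p ⊗ₜ x) (q ⊗ₜ y) = (p * q) ⊗ₜ 𝓛.bracket x y := rfl

theorem tmul_mem_polynomial_gr {n : ℤ} {x : L} (hx : x ∈ 𝓛.gr n) (p : K[X]) :
    p ⊗ₜ[K] x ∈ 𝓛.polynomial.gr n :=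
  Submodule.subset_span ⟨p, x, hx, rfl⟩

theorem polyDeriv_d (x : K[X] ⊗[K] L) :
    polyDeriv (𝓛.polynomial.d x) = 𝓛.polynomial.d (polyDeriv x) := by
  induction x with
  | zero => simp
  | add x y hx hy => simp [hx, hy]
  | tmul p y => simp

theorem polyPrim_d (x : K[X] ⊗[K] L) :
    polyPrim (𝓛.polynomial.d x) = 𝓛.polynomial.d (polyPrim x) := by
  induction x with
  | zero => simp
  | add x y hx hy => simp [hx, hy]
  | tmul p y => simp

theorem polyEval_d (c : K) (x : K[X] ⊗[K] L) :
    polyEval c (𝓛.polynomial.d x) = 𝓛.d (polyEval c x) := by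
  induction x with
  | zero => simp
  | add x y hx hy => simp [hx, hy]
  | tmul p y => simp

theorem polyEval_bracket (c : K) (x y : K[X] ⊗[K] L) :
    polyEval c (𝓛.polynomial.bracket x y) = 𝓛.bracket (polyEval c x) (polyEval c y) := by
  induction x with
  | zero => simp
  | add x y hx hy => simp [hx, hy]
  | tmul p x =>
    induction y with
    | zero => simp
    | add x y hx hy => simp [hx, hy]
    | tmul q y => simp [mul_smul, smul_comm (q.eval c)]

theorem polyDeriv_bracket (x y : K[X] ⊗[K] L) :
    polyDeriv (𝓛.polynomial.bracket x y) =
      𝓛.polynomial.bracket (polyDeriv x) y + 𝓛.polynomial.bracket x (polyDeriv y) := by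
  induction x with
  | zero => simp
  | add x x' hx hx' => simp [hx, hx']; abel
  | tmul p x =>
    induction y with
    | zero => simp
    | add y y' hy hy' => simp [hy, hy']; abel
    | tmul q y => simp [TensorProduct.add_tmul]

theorem polyDeriv_mem {n : ℤ} {x : K[X] ⊗[K] L} (hx : x ∈ 𝓛.polynomial.gr n) :
    polyDeriv x ∈ 𝓛.polynomial.gr n := by
  induction hx using Submodule.span_induction with
  | mem x h => obtain ⟨p, y, hy, rfl⟩ := h; exact 𝓛.tmul_mem_polynomial_gr hy _
  | zero => simp
  | add x y _ _ hx hy => simpa using Submodule.add_mem _ hx hy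
  | smul a x _ hx => simpa using Submodule.smul_mem _ a hx

theorem polyEval_mem (c : K) {n : ℤ} {x : K[X] ⊗[K] L} (hx : x ∈ 𝓛.polynomial.gr n) :
    polyEval c x ∈ 𝓛.gr n := by
  induction hx using Submodule.span_induction with
  | mem x h => obtain ⟨p, y, hy, rfl⟩ := h; exact Submodule.smul_mem _ _ hy
  | zero => simp
  | add x y _ _ hx hy => simpa using Submodule.add_mem _ hx hy
  | smul a x _ hx => simpa using Submodule.smul_mem _ a hx

/-- Polynomial differential forms `f + dt g` on the line with coefficients in `L`. -/
noncomputable def path : DGLA K ((K[X] ⊗[K] L) × (K[X] ⊗[K] L)) :=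
  𝓛.polynomial.oddExt 1 odd_one 0 (Or.inl rfl) polyDeriv (Or.inr rfl)
    (fun _ _ => 𝓛.polyDeriv_mem) 𝓛.polyDeriv_d 𝓛.polyDeriv_bracket

theorem path_d (f g : K[X] ⊗[K] L) :
    𝓛.path.d (f, g) = (𝓛.polynomial.d f, polyDeriv f - 𝓛.polynomial.d g) := by
  simp [path, oddExt, sub_eq_add_neg]

theorem path_bracket (f g f' g' : K[X] ⊗[K] L) :
    𝓛.path.bracket (f, g) (f', g') = (𝓛.polynomial.bracket f f',
      𝓛.polynomial.bracket g f' + 𝓛.polynomial.bracket (𝓛.polynomial.sgn f) g') :=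
  rfl

/-- The cone of the identity of `L`: the elements are `x + ε y` with `d ε = 1`. -/
noncomputable def cone : DGLA K (L × L) :=
  𝓛.oddExt (-1) (by decide) 1 (Or.inr rfl) 0 (Or.inl rfl) (fun _ _ _ => Submodule.zero_mem _)
    (fun _ => by simp) (fun _ _ => by simp)

theorem cone_d (x y : L) : 𝓛.cone.d (x, y) = (𝓛.d x + y, -𝓛.d y) := by
  simp [cone, oddExt]

theorem cone_bracket (x y x' y' : L) :
    𝓛.cone.bracket (x, y) (x', y') =
      (𝓛.bracket x x', 𝓛.bracket y x' + 𝓛.bracket (𝓛.sgn x) y') :=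
  rfl

theorem mem_cone_gr {n : ℤ} {x y : L} :
    (x, y) ∈ 𝓛.cone.gr n ↔ x ∈ 𝓛.gr n ∧ y ∈ 𝓛.gr (n + 1) := by
  rw [show n + 1 = n - (-1) by ring]
  exact Iff.rfl

end Polynomials

end DGLA

open scoped TensorProduct

namespace DGLA

/-! ### The homotopy fibre of the inclusion of a subalgebra -/

section HomotopyFiber

open Polynomial

variable {K : Type u} {L : Type v} {M : Type w} [Field K] [AddCommGroup L] [Module K L]
  [AddCommGroup M] [Module K M]

/-- Integration over `[0, 1]`. -/
noncomputable def integral : K[X] ⊗[K] L →ₗ[K] L := polyEval 1 ∘ₗ polyPrim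

theorem primitive_one : primitive (1 : K[X]) = X := by
  rw [← monomial_zero_one, primitive_monomial]
  simp [monomial_one_one_eq_X]

theorem integral_one_tmul (x : L) : integral ((1 : K[X]) ⊗ₜ[K] x) = x := by
  simp [integral, primitive_one]

theorem integral_polyDeriv [CharZero K] (f : K[X] ⊗[K] L) :
    integral (polyDeriv f) = polyEval 1 f - polyEval 0 f := by
  simp [integral, polyPrim_polyDeriv]

theorem integral_d (𝓛 : DGLA K L) (f : K[X] ⊗[K] L) :
    integral (𝓛.polynomial.d f) = 𝓛.d (integral f) := by
  simp [integral, polyPrim_d, polyEval_d]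

theorem integral_lTensor (f : L →ₗ[K] M) (x : K[X] ⊗[K] L) :
    integral (f.lTensor K[X] x) = f (integral x) := by
  induction x with
  | zero => simp
  | add x y hx hy => simp [hx, hy]
  | tmul p y => simp [integral]

theorem polyEval_lTensor (c : K) (f : L →ₗ[K] M) (x : K[X] ⊗[K] L) :
    polyEval c (f.lTensor K[X] x) = f (polyEval c x) := by
  induction x with
  | zero => simp
  | add x y hx hy => simp [hx, hy]
  | tmul p y => simp

variable {𝓛 : DGLA K L} {𝓜 : DGLA K M} {S : Submodule K L} {T : Submodule K M}

/-- Evaluation of forms at a point. -/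
theorem isHom_polyEval (𝓛 : DGLA K L) (c : K) :
    IsHom 𝓛.path 𝓛 (polyEval c ∘ₗ LinearMap.fst K _ _) where
  map_mem := fun hx => 𝓛.polyEval_mem c hx.1
  map_d := fun x => by
    rw [← Prod.mk.eta (p := x), path_d]
    exact 𝓛.polyEval_d c x.1
  map_bracket := fun x y => 𝓛.polyEval_bracket c x.1 y.1

/-- The paths that start at zero and end in `S`. -/
noncomputable def pathsTo (S : Submodule K L) : Submodule K ((K[X] ⊗[K] L) × (K[X] ⊗[K] L)) :=
  LinearMap.ker (polyEval 0 ∘ₗ LinearMap.fst K _ _) ⊓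
    S.comap (polyEval 1 ∘ₗ LinearMap.fst K _ _)

theorem mem_pathsTo {x : (K[X] ⊗[K] L) × (K[X] ⊗[K] L)} :
    x ∈ pathsTo S ↔ polyEval 0 x.1 = 0 ∧ polyEval 1 x.1 ∈ S :=
  Iff.rfl

theorem IsSub.pathsTo (hS : 𝓛.IsSub S) : 𝓛.path.IsSub (pathsTo S) where
  proj_mem := fun n x hx => by
    refine Submodule.mem_inf.2 ⟨?_, ?_⟩
    · rw [LinearMap.mem_ker, map_proj (fun _ _ h => (isHom_polyEval 𝓛 0).map_mem h),
        LinearMap.mem_ker.1 hx.1, map_zero]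
    · rw [Submodule.mem_comap, map_proj (fun _ _ h => (isHom_polyEval 𝓛 1).map_mem h)]
      exact hS.proj_mem n _ hx.2
  d_mem := fun x hx => by
    refine Submodule.mem_inf.2 ⟨?_, ?_⟩
    · rw [LinearMap.mem_ker, (isHom_polyEval 𝓛 0).map_d, LinearMap.mem_ker.1 hx.1, map_zero]
    · rw [Submodule.mem_comap, (isHom_polyEval 𝓛 1).map_d]
      exact hS.d_mem _ hx.2
  bracket_mem := fun x hx y hy => by
    refine Submodule.mem_inf.2 ⟨?_, ?_⟩
    · rw [LinearMap.mem_ker, (isHom_polyEval 𝓛 0).map_bracket, LinearMap.mem_ker.1 hx.1, map_zero,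
        LinearMap.zero_apply]
    · rw [Submodule.mem_comap, (isHom_polyEval 𝓛 1).map_bracket]
      exact hS.bracket_mem _ hx.2 _ hy.2

/-- The homotopy fibre of the inclusion of a subalgebra. -/
noncomputable def hofib (hS : 𝓛.IsSub S) : DGLA K (pathsTo S) :=
  𝓛.path.restrict hS.pathsTo

theorem coe_hofib_d (hS : 𝓛.IsSub S) (x : pathsTo S) :
    (((hofib hS).d x : pathsTo S) : (K[X] ⊗[K] L) × (K[X] ⊗[K] L)) =
      (𝓛.polynomial.d x.1.1, polyDeriv x.1.1 - 𝓛.polynomial.d x.1.2) :=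
  𝓛.path_d x.1.1 x.1.2

/-- Stokes on `[0, 1]`: a closed form `f + dt g` satisfies `f' = d g`, and `f(0) = 0`. -/
theorem polyEval_one_eq_of_closed [CharZero K] (hS : 𝓛.IsSub S) {x : pathsTo S}
    (hx : (hofib hS).d x = 0) : polyEval 1 x.1.1 = 𝓛.d (integral x.1.2) := by
  have h := congrArg (fun y : pathsTo S => y.1.2) hx
  rw [coe_hofib_d] at h
  have h' := congrArg integral (sub_eq_zero.1 h)
  rw [integral_polyDeriv, integral_d, (mem_pathsTo.1 x.2).1, sub_zero] at h'
  exact h'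

/-- Stokes again, without closedness: modulo `S`, integration of the `dt`-part anticommutes with the
differentials, so it is a chain map from the homotopy fibre to the shifted quotient `L / S`. -/
theorem integral_hofib_d [CharZero K] (hS : 𝓛.IsSub S) (x : pathsTo S) :
    integral ((hofib hS).d x).1.2 + 𝓛.d (integral x.1.2) ∈ S := by
  rw [coe_hofib_d, map_sub, integral_polyDeriv, integral_d, (mem_pathsTo.1 x.2).1, sub_zero,
    sub_add_cancel]
  exact (mem_pathsTo.1 x.2).2

/-- Injectivity on cohomology of integration into the shifted `L / S`; surjectivity is provided by
`hofibCocycle`. Together they reduce questions about the fibre to the quotient complex. -/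
theorem exists_hofib_d_eq [CharZero K] (hS : 𝓛.IsSub S) {x : pathsTo S}
    (hx : (hofib hS).d x = 0) {w : L} (hw : integral x.1.2 - 𝓛.d w ∈ S) :
    ∃ u, (hofib hS).d u = x := by
  have h1 : 𝓛.polynomial.d x.1.1 = 0 := by
    have h := congrArg (fun y : pathsTo S => y.1.1) hx
    rwa [coe_hofib_d] at h
  have h2 : polyDeriv x.1.1 = 𝓛.polynomial.d x.1.2 := by
    have h := congrArg (fun y : pathsTo S => y.1.2) hx
    rw [coe_hofib_d] at h
    exact sub_eq_zero.1 h
  -- The form is `F + dt G` with `F = ∫₀ᵗ g - t d w` and `G = -w`. Then `F' - d G = g`, and `F(1) =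
  -- ∫ g - d w` lies in `S`, the correction by `t d w` being there for this endpoint condition.
  refine ⟨⟨(polyPrim x.1.2 - X ⊗ₜ 𝓛.d w, -(1 ⊗ₜ w)), mem_pathsTo.2 ⟨?_, ?_⟩⟩, Subtype.ext ?_⟩
  · simp [polyEval_zero_polyPrim]
  · simpa [integral] using hw
  · rw [coe_hofib_d]
    refine Prod.ext ?_ ?_
    · have := polyPrim_polyDeriv x.1.1
      rw [h2, polyPrim_d, (mem_pathsTo.1 x.2).1, TensorProduct.tmul_zero, sub_zero] at this
      simp [this, 𝓛.d_d]
    · simp [polyDeriv_polyPrim]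

/-- The cocycle of the homotopy fibre attached to `w` with `d w ∈ S`. -/
noncomputable def hofibCocycle (w : L) (hw : 𝓛.d w ∈ S) : pathsTo S :=
  ⟨(X ⊗ₜ 𝓛.d w, 1 ⊗ₜ w), mem_pathsTo.2 ⟨by simp, by simpa using hw⟩⟩

theorem hofib_d_hofibCocycle (hS : 𝓛.IsSub S) (w : L) (hw : 𝓛.d w ∈ S) :
    (hofib hS).d (hofibCocycle w hw) = 0 := by
  apply Subtype.ext
  rw [coe_hofib_d]
  simp [hofibCocycle, 𝓛.d_d]

theorem integral_hofibCocycle (w : L) (hw : 𝓛.d w ∈ S) :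
    integral (hofibCocycle w hw).1.2 = w :=
  integral_one_tmul w

theorem isHom_lTensor {f : L →ₗ[K] M} (hf : IsHom 𝓛 𝓜 f) :
    IsHom 𝓛.polynomial 𝓜.polynomial (f.lTensor K[X]) where
  map_mem := fun {n x} hx => by
    induction hx using Submodule.span_induction with
    | mem x h =>
      obtain ⟨p, y, hy, rfl⟩ := h
      exact 𝓜.tmul_mem_polynomial_gr (hf.map_mem hy) p
    | zero => simp
    | add x y _ _ hx hy => simpa using Submodule.add_mem _ hx hy
    | smul a x _ hx => simpa using Submodule.smul_mem _ a hx
  map_d := fun x => by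
    induction x with
    | zero => simp
    | add x y hx hy => simp [hx, hy]
    | tmul p y => simp [hf.map_d]
  map_bracket := fun x y => by
    induction x with
    | zero => simp
    | add x x' hx hx' => simp [hx, hx']
    | tmul p x =>
      induction y with
      | zero => simp
      | add y y' hy hy' => simp [hy, hy']
      | tmul q y => simp [hf.map_bracket]

theorem polyDeriv_lTensor (f : L →ₗ[K] M) (x : K[X] ⊗[K] L) :
    polyDeriv (f.lTensor K[X] x) = f.lTensor K[X] (polyDeriv x) := by
  induction x with
  | zero => simp
  | add x y hx hy => simp [hx, hy]
  | tmul p y => simp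

/-- The map of homotopy fibres induced by a map of pairs. -/
noncomputable def mapPathsTo (f : L →ₗ[K] M) (hf : ∀ x ∈ S, f x ∈ T) :
    pathsTo S →ₗ[K] pathsTo T :=
  ((f.lTensor K[X]).prodMap (f.lTensor K[X])).restrict fun x hx => by
    refine mem_pathsTo.2 ⟨?_, ?_⟩
    · simp [polyEval_lTensor, (mem_pathsTo.1 hx).1]
    · simpa [polyEval_lTensor] using hf _ (mem_pathsTo.1 hx).2

theorem isHom_mapPathsTo {f : L →ₗ[K] M} (h : IsHom 𝓛 𝓜 f) (hf : ∀ x ∈ S, f x ∈ T)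
    (hS : 𝓛.IsSub S) (hT : 𝓜.IsSub T) : IsHom (hofib hS) (hofib hT) (mapPathsTo f hf) where
  map_mem := fun hx => ⟨(isHom_lTensor h).map_mem hx.1, (isHom_lTensor h).map_mem hx.2⟩
  map_d := fun x => Subtype.ext (by
    rw [coe_hofib_d]
    refine Prod.ext ?_ ?_
    · change f.lTensor K[X] ((hofib hS).d x).1.1 = _
      rw [coe_hofib_d]
      exact (isHom_lTensor h).map_d _
    · change f.lTensor K[X] ((hofib hS).d x).1.2 = _
      rw [coe_hofib_d, map_sub, (isHom_lTensor h).map_d, ← polyDeriv_lTensor]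
      rfl)
  map_bracket := fun x y => Subtype.ext (Prod.ext ((isHom_lTensor h).map_bracket _ _) (by
    change f.lTensor K[X] (𝓛.polynomial.bracket x.1.2 y.1.1 +
      𝓛.polynomial.bracket (𝓛.polynomial.sgn x.1.1) y.1.2) = _
    rw [map_add, (isHom_lTensor h).map_bracket, (isHom_lTensor h).map_bracket,
      map_sgn fun _ _ hx => (isHom_lTensor h).map_mem hx]
    rfl))

theorem integral_mapPathsTo (f : L →ₗ[K] M) (hf : ∀ x ∈ S, f x ∈ T) (x : pathsTo S) :
    integral (mapPathsTo f hf x).1.2 = f (integral x.1.2) :=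
  integral_lTensor f x.1.2

/-- `L` as a subalgebra of its cone. -/
def coneBase (K : Type u) (L : Type v) [Field K] [AddCommGroup L] [Module K L] :
    Submodule K (L × L) :=
  LinearMap.ker (LinearMap.snd K L L)

theorem mem_coneBase {x : L × L} : x ∈ coneBase K L ↔ x.2 = 0 := Iff.rfl

theorem isSub_coneBase (𝓛 : DGLA K L) : 𝓛.cone.IsSub (coneBase K L) where
  proj_mem := fun n x hx => by
    have hsum := 𝓛.cone.exists_sum_proj x
    have h1 : 𝓛.cone.proj n x = 𝓛.cone.proj n (x.1, 0) := by
      rw [← mem_coneBase.1 hx]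
    rw [h1]
    generalize x.1 = y
    induction y using 𝓛.homogeneous_induction with
    | add y y' h h' =>
      have : ((y + y', 0) : L × L) = (y, 0) + (y', 0) := by simp
      rw [this, map_add]
      exact Submodule.add_mem _ h h'
    | hom p y hy =>
      have hm : ((y, 0) : L × L) ∈ 𝓛.cone.gr p := 𝓛.mem_cone_gr.2 ⟨hy, Submodule.zero_mem _⟩
      by_cases hp : p = n
      · subst hp
        rw [𝓛.cone.proj_same hm]
        rfl
      · rw [𝓛.cone.proj_ne hp hm]
        exact Submodule.zero_mem _
  d_mem := fun x hx => by
    rw [← Prod.mk.eta (p := x), cone_d, mem_coneBase]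
    simp [mem_coneBase.1 hx]
  bracket_mem := fun x hx y hy => by
    rw [← Prod.mk.eta (p := x), ← Prod.mk.eta (p := y), cone_bracket, mem_coneBase]
    simp [mem_coneBase.1 hx, mem_coneBase.1 hy]

/-- The homotopy fibre of the inclusion of `L` in its cone is quasi-isomorphic to `L`. -/
theorem isQuasiIso_hofib_cone [CharZero K] (𝓛 : DGLA K L) :
    IsQuasiIso (hofib 𝓛.isSub_coneBase) 𝓛 (LinearMap.fst K L L ∘ₗ polyEval 1 ∘ₗ
      LinearMap.fst K _ _ ∘ₗ (pathsTo (coneBase K L)).subtype) := by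
  refine IsHom.isQuasiIso ⟨?_, ?_, ?_⟩ ?_ ?_
  · exact fun hx => (𝓛.cone.polyEval_mem 1 hx.1).1
  · intro x
    have h := 𝓛.cone.polyEval_d 1 x.1.1
    rw [← Prod.mk.eta (p := polyEval 1 x.1.1), cone_d, mem_coneBase.1 (mem_pathsTo.1 x.2).2] at h
    have h' : _ = 𝓛.d (polyEval 1 x.1.1).1 + 0 := congrArg Prod.fst h
    rw [add_zero] at h'
    refine Eq.trans ?_ h'
    rw [LinearMap.comp_apply, LinearMap.comp_apply, LinearMap.comp_apply,
      Submodule.subtype_apply, coe_hofib_d]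
    rfl
  · exact fun x y => congrArg Prod.fst (𝓛.cone.polyEval_bracket 1 x.1.1 y.1.1)
  · intro x hx w hw
    have h := polyEval_one_eq_of_closed 𝓛.isSub_coneBase hx
    replace hw : (polyEval 1 x.1.1).1 = 𝓛.d w := hw
    rw [← Prod.mk.eta (p := integral x.1.2), cone_d] at h
    rw [h] at hw
    -- Write `∫ g = (a, b)`. Closedness gives first component `d a + b` at the endpoint, and this
    -- equals `d w`, so `b = -d (a - w)`, which is the second component of the cone differential of
    -- `(0, a - w)`.
    refine exists_hofib_d_eq 𝓛.isSub_coneBase hx (w := (0, (integral x.1.2).1 - w)) ?_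
    rw [cone_d, mem_coneBase]
    dsimp at hw
    simp [← hw]
  · intro z hz
    -- In the cone `z = d (ε z)` for a cocycle `z`, so the straight path from `0` to `z` lifts to a
    -- closed form.
    have hw : 𝓛.cone.d (0, z) ∈ coneBase K L := by
      rw [cone_d, mem_coneBase, hz, neg_zero]
    refine ⟨hofibCocycle (0, z) hw, 0, hofib_d_hofibCocycle _ _ _, ?_⟩
    simp [hofibCocycle, cone_d]

end HomotopyFiber

end DGLA

open scoped TensorProduct

namespace DGLA

/-! ### The formality criterion -/

section Formality

open Polynomial

variable {K : Type u} {L : Type v} {M : Type w} [Field K] [AddCommGroup L] [Module K L]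
  [AddCommGroup M] [Module K M]

/-- The cohomology can be represented by cocycles, linearly and degreewise. -/
theorem exists_graded_section (𝓛 : DGLA K L) :
    ∃ s : 𝓛.H →ₗ[K] 𝓛.cocycles, (∀ h, 𝓛.coboundaries.mkQ (s h) = h) ∧
      ∀ n, ∀ h ∈ 𝓛.grH n, (s h : L) ∈ 𝓛.gr n := by
  obtain ⟨σ, hσ⟩ := 𝓛.coboundaries.mkQ.exists_rightInverse_of_surjective
    (LinearMap.range_eq_top.2 𝓛.coboundaries.mkQ_surjective)
  let _ := (isInternal_grH (𝓛 := 𝓛)).chooseDecomposition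
  let π : ∀ n, 𝓛.cocycles →ₗ[K] 𝓛.cocycles := fun n =>
    (𝓛.proj n).restrict fun z hz => proj_mem_cocycles n hz
  -- An arbitrary linear section `σ` becomes graded by keeping, for a class of degree `n`, only the
  -- degree `n` part of its representative.
  let s : 𝓛.H →ₗ[K] 𝓛.cocycles :=
    DirectSum.toModule K ℤ 𝓛.cocycles (fun n => π n ∘ₗ σ ∘ₗ (𝓛.grH n).subtype) ∘ₗ
      (DirectSum.decomposeLinearEquiv 𝓛.grH).toLinearMap
  have hs : ∀ n, ∀ h ∈ 𝓛.grH n, s h = π n (σ h) := by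
    intro n h hh
    lift h to 𝓛.grH n using hh
    simp only [s, LinearMap.comp_apply, LinearEquiv.coe_coe,
      DirectSum.decomposeLinearEquiv_apply, DirectSum.decompose_coe]
    rw [← DirectSum.lof_eq_of K, DirectSum.toModule_lof]
    rfl
  refine ⟨s, fun h => ?_, fun n h hh => ?_⟩
  · induction h using 𝓛.cohomology.homogeneous_induction with
    | add x y hx hy => rw [map_add, map_add, hx, hy]
    | hom n h hh =>
      rw [hs n h hh]
      obtain ⟨z, hz, rfl⟩ := hh
      have h1 : 𝓛.coboundaries.mkQ (σ (𝓛.coboundaries.mkQ z)) = 𝓛.coboundaries.mkQ z :=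
        LinearMap.congr_fun hσ _
      obtain ⟨m, hm⟩ := (Submodule.Quotient.eq 𝓛.coboundaries).1 h1
      refine (Submodule.Quotient.eq 𝓛.coboundaries).2 ⟨𝓛.proj (n - 1) m, ?_⟩
      rw [𝓛.d_proj, sub_add_cancel, hm]
      rw [map_sub, map_sub, map_sub]
      exact congrArg _ (𝓛.proj_same hz)
  · rw [hs n h hh]
    exact 𝓛.proj_mem n _

/-- Transport of the structure to the universe lift. -/
def ulift (𝓛 : DGLA K L) : DGLA K (ULift.{w} L) where
  gr n := (𝓛.gr n).comap (ULift.moduleEquiv : ULift.{w} L ≃ₗ[K] L).toLinearMap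
  isInternal := by
    let e : ULift.{w} L ≃ₗ[K] L := ULift.moduleEquiv
    refine isInternal_of_proj _
      (fun n => e.symm.toLinearMap ∘ₗ 𝓛.proj n ∘ₗ e.toLinearMap) ?_ ?_ ?_
    · exact fun n x hx => ULift.ext _ _ (𝓛.proj_same hx)
    · exact fun m n h x hx => ULift.ext _ _ (𝓛.proj_ne h hx)
    · rintro ⟨x⟩
      induction x using 𝓛.homogeneous_induction with
      | add x y hx hy => exact Submodule.add_mem _ hx hy
      | hom n x hx => exact Submodule.mem_iSup_of_mem n hx
  d := ULift.moduleEquiv.symm.toLinearMap ∘ₗ 𝓛.d ∘ₗ ULift.moduleEquiv.toLinearMap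
  bracket := LinearMap.mk₂ K (fun x y => ⟨𝓛.bracket x.down y.down⟩)
    (fun _ _ _ => ULift.ext _ _ (by simp)) (fun _ _ _ => ULift.ext _ _ (by simp))
    (fun _ _ _ => ULift.ext _ _ (by simp)) (fun _ _ _ => ULift.ext _ _ (by simp))
  d_mem := fun hx => 𝓛.d_mem hx
  d_d := fun x => ULift.ext _ _ (𝓛.d_d x.down)
  bracket_mem := fun hx hy => 𝓛.bracket_mem hx hy
  antisymm := fun hx hy => ULift.ext _ _ (𝓛.antisymm hx hy)
  leibniz := fun y hx => ULift.ext _ _ (𝓛.leibniz y.down hx)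
  jacobi := fun z hx hy => ULift.ext _ _ (𝓛.jacobi z.down hx hy)

theorem isQuasiIso_ulift (𝓛 : DGLA K L) :
    IsQuasiIso (ulift.{u, v, w} 𝓛) 𝓛 ULift.moduleEquiv.toLinearMap := by
  refine IsHom.isQuasiIso ⟨fun hx => hx, fun _ => rfl, fun _ _ => rfl⟩ ?_ ?_
  · exact fun x _ w hw => ⟨⟨w⟩, ULift.ext _ _ hw.symm⟩
  · exact fun y hy => ⟨⟨y⟩, 0, ULift.ext _ _ hy, by simp⟩

theorem IsQuasiIso.comp {N : Type v₁} [AddCommGroup N] [Module K N] {𝓛 : DGLA K L}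
    {𝓜 : DGLA K M} {𝓝 : DGLA K N} {g : M →ₗ[K] N} {f : L →ₗ[K] M} (hg : IsQuasiIso 𝓜 𝓝 g)
    (hf : IsQuasiIso 𝓛 𝓜 f) : IsQuasiIso 𝓛 𝓝 (g ∘ₗ f) := by
  obtain ⟨hg, hg'⟩ := hg
  obtain ⟨hf, hf'⟩ := hf
  have h : IsHom 𝓛 𝓝 (g ∘ₗ f) :=
    ⟨fun hx => hg.map_mem (hf.map_mem hx), fun x => by simp [hf.map_d, hg.map_d],
      fun x y => by simp [hf.map_bracket, hg.map_bracket]⟩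
  refine ⟨h, ?_⟩
  have hcomp : (h.mapH : 𝓛.H → 𝓝.H) = hg.mapH ∘ hf.mapH := by
    funext x
    obtain ⟨z, rfl⟩ := 𝓛.coboundaries.mkQ_surjective x
    rfl
  rw [hcomp]
  exact hg'.comp hf'

/-- A criterion for formality. The cone of `L` maps to `M` in such a way that the induced map
`cone L / L → M / S` is an isomorphism, and `M / S` is represented by the abelian subalgebra
`c L`, so that the homotopy fibres of the two inclusions are quasi-isomorphic, one being equivalent
to `L` and the other one to an abelian algebra. -/
theorem isFormal_of_cone [CharZero K] {M : Type v} [AddCommGroup M] [Module K M]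
    (𝓛 : DGLA K L) (𝓜 : DGLA K M) {S : Submodule K M} (hS : 𝓜.IsSub S)
    (e : M →ₗ[K] L) (he : ∀ w, e w = 0 ↔ w ∈ S) (hed : ∀ w, e (𝓜.d w) = -𝓛.d (e w))
    (κ : L × L →ₗ[K] M) (hκ : IsHom 𝓛.cone 𝓜 κ) (heκ : ∀ x, e (κ x) = x.2)
    (c : L →ₗ[K] M) (hec : ∀ y, e (c y) = y) (hcd : ∀ y, 𝓜.d (c y) = -c (𝓛.d y))
    (hcgr : ∀ n, ∀ y ∈ 𝓛.gr (n + 1), c y ∈ 𝓜.gr n)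
    (hH : ∀ x y, 𝓛.d x = 0 → 𝓛.d y = 0 → 𝓛.bracket x y ∈ LinearMap.range 𝓛.d) :
    𝓛.IsFormal := by
  obtain ⟨s, hs, hsgr⟩ := 𝓛.exists_graded_section
  have hκS : ∀ x ∈ coneBase K L, κ x ∈ S := fun x hx => by
    rw [← he, heκ, mem_coneBase.1 hx]
  have hmap := isHom_mapPathsTo hκ hκS 𝓛.isSub_coneBase hS
  let φ := mapPathsTo κ hκS
  have hφ : IsQuasiIso (hofib 𝓛.isSub_coneBase) (hofib hS) φ := by
    refine hmap.isQuasiIso ?_ ?_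
    · intro x hx w hw
      have h1 := integral_hofib_d hS w
      rw [← hw, integral_mapPathsTo, ← he, map_add, heκ, hed, ← sub_eq_add_neg, sub_eq_zero] at h1
      -- By `h1` the second component of the integral is `d (e ∫ w)`; the cone differential of `(0,
      -- -e ∫ w)` has this second component.
      refine exists_hofib_d_eq 𝓛.isSub_coneBase hx (w := (0, -e (integral w.1.2))) ?_
      rw [cone_d, mem_coneBase]
      simp [h1]
    · intro y hy
      have h1 : 𝓛.d (e (integral y.1.2)) = 0 := by
        rw [← neg_eq_zero, ← hed, he, ← polyEval_one_eq_of_closed hS hy]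
        exact (mem_pathsTo.1 y.2).2
      have hw : 𝓛.cone.d (0, e (integral y.1.2)) ∈ coneBase K L := by
        rw [cone_d, mem_coneBase, h1, neg_zero]
      refine ⟨hofibCocycle _ hw, ?_⟩
      have hcl := hofib_d_hofibCocycle 𝓛.isSub_coneBase _ hw
      have hcl' : (hofib hS).d (φ (hofibCocycle _ hw) - y) = 0 := by
        refine (map_sub (hofib hS).d _ _).trans ?_
        rw [hy, ← hmap.map_d, hcl, map_zero, sub_zero]
      -- The two cocycles have integrals with the same image under `e`, hence congruent modulo `S`,
      -- and no correction term is needed.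
      obtain ⟨w, hw'⟩ := exists_hofib_d_eq hS hcl' (w := 0) (by
        rw [map_zero, sub_zero, ← he]
        change e (integral ((φ (hofibCocycle _ hw)).1.2 - y.1.2)) = 0
        rw [map_sub, map_sub, integral_mapPathsTo, heκ, integral_hofibCocycle, sub_self])
      exact ⟨w, hcl, hw'.symm⟩
  -- A class `h` goes to `dt c (s h)`. Forms with no function part have zero bracket, as `dt² = 0`,
  -- so `g` respects brackets once the bracket on cohomology is zero.
  let g : 𝓛.H →ₗ[K] pathsTo S :=
    LinearMap.codRestrict (pathsTo S)
      (LinearMap.inr K _ _ ∘ₗ TensorProduct.mk K K[X] M 1 ∘ₗ c ∘ₗ 𝓛.cocycles.subtype ∘ₗ s)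
      fun h => mem_pathsTo.2 ⟨by simp, by simp⟩
  have hg1 : ∀ h, (g h).1.1 = 0 := fun h => rfl
  have hg2 : ∀ h, (g h).1.2 = 1 ⊗ₜ c (s h) := fun h => rfl
  have hg : IsHom 𝓛.cohomology (hofib hS) g := by
    refine ⟨?_, ?_, ?_⟩
    · intro n x hx
      refine ⟨Submodule.zero_mem _, 𝓜.tmul_mem_polynomial_gr (hcgr _ _ ?_) 1⟩
      rw [sub_add_cancel]
      exact hsgr n x hx
    · intro x
      apply Subtype.ext
      rw [coe_hofib_d, hg1, hg2, polynomial_d_tmul, hcd, LinearMap.mem_ker.1 (s x).2]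
      refine (congrArg Subtype.val (map_zero g)).trans ?_
      simp [Prod.zero_eq_mk]
    · intro x y
      have h0 : 𝓛.cohomology.bracket x y = 0 := by
        rw [← hs x, ← hs y]
        exact (Submodule.Quotient.mk_eq_zero 𝓛.coboundaries).2
          (hH _ _ (s x).2 (s y).2)
      rw [h0, map_zero]
      apply Subtype.ext
      change 0 = 𝓜.path.bracket ((g x).1.1, (g x).1.2) ((g y).1.1, (g y).1.2)
      rw [path_bracket, hg1, hg1]
      simp [Prod.zero_eq_mk]
  have hgq : IsQuasiIso 𝓛.cohomology (hofib hS) g := by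
    refine hg.isQuasiIso ?_ ?_
    · intro x _ w hw
      have h1 := integral_hofib_d hS w
      rw [← hw, hg2, integral_one_tmul, ← he, map_add, hec, hed, ← sub_eq_add_neg,
        sub_eq_zero] at h1
      refine ⟨0, ?_⟩
      rw [map_zero, ← hs x]
      exact ((Submodule.Quotient.mk_eq_zero 𝓛.coboundaries).2 ⟨_, h1.symm⟩).symm
    · intro y hy
      have h1 : 𝓛.d (e (integral y.1.2)) = 0 := by
        rw [← neg_eq_zero, ← hed, he, ← polyEval_one_eq_of_closed hS hy]
        exact (mem_pathsTo.1 y.2).2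
      let z : 𝓛.cocycles := ⟨e (integral y.1.2), h1⟩
      let x : 𝓛.H := 𝓛.coboundaries.mkQ z
      obtain ⟨b, hb⟩ := (Submodule.Quotient.eq 𝓛.coboundaries).1 (hs x)
      have hb' : 𝓛.d b = s x - e (integral y.1.2) := hb
      have hcl : (hofib hS).d (g x - y) = 0 := by
        refine (map_sub (hofib hS).d _ _).trans ?_
        rw [hy, ← hg.map_d, sub_zero]
        exact map_zero g
      -- The chosen representative `s x` differs from `e (∫ y)` by `d b`; as `c` anticommutes with
      -- the differentials and splits `e`, the differential of `c (-b)` accounts for this difference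
      -- modulo `S`.
      obtain ⟨w, hw'⟩ := exists_hofib_d_eq hS hcl (w := c (-b)) (by
        rw [← he]
        change e (integral ((g x).1.2 - y.1.2) - _) = 0
        rw [map_sub, map_sub, map_sub, hg2, integral_one_tmul, hec, hed, hec, map_neg, hb']
        simp)
      exact ⟨x, w, rfl, hw'.symm⟩
  -- The zigzag is `L ← hofib(L → cone L) → hofib(S → M) ← H(L)`. The cohomology is lifted so that
  -- all intermediate objects live in the universe `max u v`.
  refine ⟨⟨pathsTo (coneBase K L), hofib 𝓛.isSub_coneBase⟩,
    ⟨ULift.{max u v} 𝓛.H, 𝓛.cohomology.ulift⟩, ⟨_, 𝓛.isQuasiIso_hofib_cone⟩, ?_,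
    ⟨_, 𝓛.cohomology.isQuasiIso_ulift⟩⟩
  refine .trans _ ⟨pathsTo S, hofib hS⟩ _ (.rel _ _ ⟨φ, hφ⟩) (.symm _ _ (.rel _ _ ?_))
  exact ⟨_, hgq.comp 𝓛.cohomology.isQuasiIso_ulift⟩

end Formality

end DGLA

/-! ### Formal vector fields on a graded vector space -/

section FormalVectorFields

variable (K : Type u) (V : Type v) [Field K] [AddCommGroup V] [Module K V]

/-- Formal power series maps from `V` to `V`, given by their Taylor coefficients. -/
abbrev FormalVF : Type v := ∀ n : ℕ, MultilinearMap K (fun _ : Fin n => V) V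

variable {K V}

namespace FormalVF

/-- The value at the origin. -/
def ev : FormalVF K V →ₗ[K] V where
  toFun D := D 0 Fin.elim0
  map_add' _ _ := rfl
  map_smul' _ _ := rfl

/-- The derivative in the direction of a vector. -/
def der : V →ₗ[K] FormalVF K V →ₗ[K] FormalVF K V :=
  LinearMap.mk₂ K (fun x D n => (D (n + 1)).curryLeft x)
    (fun _ _ _ => by ext; simp) (fun _ _ _ => by ext; simp)
    (fun _ _ _ => by ext; simp) (fun _ _ _ => by ext; simp)

theorem der_apply (x : V) (D : FormalVF K V) (n : ℕ) : der x D n = (D (n + 1)).curryLeft x := rfl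

/-- Induction on the number of arguments. -/
theorem component_eq_zero_iff {D : FormalVF K V} {n : ℕ} :
    D (n + 1) = 0 ↔ ∀ x, der x D n = 0 := by
  refine ⟨fun h x => by rw [der_apply, h]; rfl, fun h => ?_⟩
  rw [← MultilinearMap.uncurry_curryLeft (D (n + 1))]
  have : (D (n + 1)).curryLeft = 0 := LinearMap.ext h
  rw [this]
  rfl

theorem component_zero_eq_zero_iff {D : FormalVF K V} : D 0 = 0 ↔ ev D = 0 := by
  refine ⟨fun h => by simp [ev, h], fun h => ?_⟩
  ext w
  rw [Subsingleton.elim w Fin.elim0]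
  exact h

/-- The constant vector field. -/
def const : V →ₗ[K] FormalVF K V :=
  LinearMap.single K (fun n : ℕ => MultilinearMap K (fun _ : Fin n => V) V) 0 ∘ₗ
    (MultilinearMap.constLinearEquivOfIsEmpty (R := K) (S := K) (M₂ := V)
      (M₁ := fun _ : Fin 0 => V)).toLinearMap

@[simp] theorem ev_const (x : V) : ev (const (K := K) x) = x := by
  simp [ev, const]

@[simp] theorem der_const (x y : V) : der x (const (K := K) y) = 0 := by
  funext n
  rw [der_apply]
  simp [const]
  rfl

variable (P₀ P₁ : V →ₗ[K] V)

/-- The parity operator. -/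
def parity : FormalVF K V →ₗ[K] FormalVF K V where
  toFun D n := (P₀ - P₁).compMultilinearMap ((D n).compLinearMap fun _ => P₀ - P₁)
  map_add' _ _ := by ext; simp; abel
  map_smul' _ _ := by ext; simp

theorem ev_parity (D : FormalVF K V) : ev (parity P₀ P₁ D) = (P₀ - P₁) (ev D) := by
  simp only [ev, parity, LinearMap.coe_mk, AddHom.coe_mk, LinearMap.compMultilinearMap_apply,
    MultilinearMap.compLinearMap_apply]
  congr 2
  funext i
  exact i.elim0

theorem der_parity (x : V) (D : FormalVF K V) :
    der x (parity P₀ P₁ D) = parity P₀ P₁ (der ((P₀ - P₁) x) D) := by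
  funext n
  ext w
  simp only [der_apply, parity, LinearMap.coe_mk, AddHom.coe_mk, MultilinearMap.curryLeft_apply,
    LinearMap.compMultilinearMap_apply, MultilinearMap.compLinearMap_apply]
  congr 2
  funext i
  refine Fin.cases ?_ (fun i => ?_) i <;> simp

/-- The value at the origin of the graded commutator. -/
def bracketEv : FormalVF K V →ₗ[K] FormalVF K V →ₗ[K] V :=
  -- The Koszul sign must make sense without homogeneity: the odd part of `ev D` is paired with
  -- `parity E`, which is `E` up to the sign of its degree, and the even part with `E` itself.
  LinearMap.mk₂ K (fun D E => ev (der (ev E) D) - ev (der (P₀ (ev D)) E) -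
      ev (der (P₁ (ev D)) (parity P₀ P₁ E)))
    (fun _ _ _ => by simp; abel) (fun _ _ _ => by simp [smul_sub])
    (fun _ _ _ => by simp; abel) (fun _ _ _ => by simp [smul_sub])

/-- The Taylor coefficients of the graded commutator of vector fields. -/
def bracketAux : (n : ℕ) → FormalVF K V →ₗ[K] FormalVF K V →ₗ[K]
    MultilinearMap K (fun _ : Fin n => V) V
  | 0 => (bracketEv P₀ P₁).compr₂ (MultilinearMap.constLinearEquivOfIsEmpty (R := K) (S := K)
      (M₂ := V) (M₁ := fun _ : Fin 0 => V)).toLinearMap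
  | n + 1 => LinearMap.mk₂ K (fun D E => LinearMap.uncurryLeft
      (bracketAux n D ∘ₗ der.flip E + (bracketAux n).flip E ∘ₗ der.flip D ∘ₗ P₀ +
        (bracketAux n).flip (parity P₀ P₁ E) ∘ₗ der.flip D ∘ₗ P₁))
    (fun _ _ _ => by ext; simp; abel) (fun _ _ _ => by ext; simp)
    (fun _ _ _ => by ext; simp; abel) (fun _ _ _ => by ext; simp)

/-- The graded commutator of formal vector fields. -/
def bracket : FormalVF K V →ₗ[K] FormalVF K V →ₗ[K] FormalVF K V :=
  LinearMap.mk₂ K (fun D E n => bracketAux P₀ P₁ n D E)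
    (fun _ _ _ => by ext; simp) (fun _ _ _ => by ext; simp)
    (fun _ _ _ => by ext; simp) (fun _ _ _ => by ext; simp)

theorem ev_bracket (D E : FormalVF K V) : ev (bracket P₀ P₁ D E) =
    ev (der (ev E) D) - ev (der (P₀ (ev D)) E) - ev (der (P₁ (ev D)) (parity P₀ P₁ E)) := by
  simp [bracket, ev, bracketAux, bracketEv]

/-- Together with `ev_bracket` this determines the bracket. Identities below are proved coefficient
by coefficient: compare values at the origin, then note that a directional derivative of the
identity is a combination of instances of the same identity. -/
theorem der_bracket (x : V) (D E : FormalVF K V) : der x (bracket P₀ P₁ D E) =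
    bracket P₀ P₁ D (der x E) + bracket P₀ P₁ (der (P₀ x) D) E +
      bracket P₀ P₁ (der (P₁ x) D) (parity P₀ P₁ E) := by
  funext n
  ext w
  simp [der_apply, bracket, bracketAux]

theorem parity_component {D : FormalVF K V} {n : ℕ} (h : D n = 0) : parity P₀ P₁ D n = 0 := by
  simp only [parity, LinearMap.coe_mk, AddHom.coe_mk, h]
  ext
  simp

/-- The coefficient of degree `m` of the commutator involves only coefficients of degrees `i` and
`j` with `i + j = m + 1`. -/
theorem bracket_component_eq_zero {m : ℕ} {D E : FormalVF K V}
    (h : ∀ i j, i + j = m + 1 → D i = 0 ∨ E j = 0) : bracket P₀ P₁ D E m = 0 := by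
  have key : ∀ {D : FormalVF K V} {i : ℕ} (x : V), D (i + 1) = 0 → der x D i = 0 :=
    fun x h => component_eq_zero_iff.1 h x
  have evz : ∀ {D : FormalVF K V} (x : V), D 1 = 0 → ev (der x D) = 0 :=
    fun x h => component_zero_eq_zero_iff.1 (key x h)
  induction m generalizing D E with
  | zero =>
    rw [component_zero_eq_zero_iff, ev_bracket]
    have h1 : ev (der (ev E) D) = 0 := by
      rcases h 1 0 rfl with h | h
      · exact evz _ h
      · simp [component_zero_eq_zero_iff.1 h]
    have h2 : ev (der (P₀ (ev D)) E) = 0 := by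
      rcases h 0 1 rfl with h | h
      · simp [component_zero_eq_zero_iff.1 h]
      · exact evz _ h
    have h3 : ev (der (P₁ (ev D)) (parity P₀ P₁ E)) = 0 := by
      rcases h 0 1 rfl with h | h
      · simp [component_zero_eq_zero_iff.1 h]
      · exact evz _ (parity_component P₀ P₁ h)
    rw [h1, h2, h3]
    simp
  | succ m ih =>
    rw [component_eq_zero_iff]
    intro x
    rw [der_bracket, Pi.add_apply, Pi.add_apply, ih, ih, ih, add_zero, add_zero]
    · intro i j hij
      exact (h (i + 1) j (by omega)).imp (key _) (parity_component P₀ P₁)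
    · intro i j hij
      exact (h (i + 1) j (by omega)).imp (key _) id
    · intro i j hij
      exact (h i (j + 1) (by omega)).imp id (key _)

end FormalVF

end FormalVectorFields

/-! ### Homogeneous vector fields and their graded Lie algebra identities -/

section HomogeneousVectorFields

variable {K : Type u} {V : Type v} [Field K] [AddCommGroup V] [Module K V]

/-- `P₀` and `P₁` are the projections onto the even and the odd part of a graded space. -/
structure IsParity (G : ℤ → Submodule K V) (P₀ P₁ : V →ₗ[K] V) : Prop where
  even : ∀ {n : ℤ} {x : V}, x ∈ G n → Even n → P₀ x = x ∧ P₁ x = 0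
  odd : ∀ {n : ℤ} {x : V}, x ∈ G n → Odd n → P₀ x = 0 ∧ P₁ x = x
  iSup_eq_top : iSup G = ⊤

theorem IsParity.induction {G : ℤ → Submodule K V} {P₀ P₁ : V →ₗ[K] V} (h : IsParity G P₀ P₁)
    {P : V → Prop} (hom : ∀ n, ∀ x ∈ G n, P x) (add : ∀ x y, P x → P y → P (x + y)) (x : V) :
    P x := by
  have hx : x ∈ iSup G := by
    rw [h.iSup_eq_top]
    trivial
  exact Submodule.iSup_induction G (motive := P) hx hom (hom 0 0 (Submodule.zero_mem _)) add

theorem IsParity.sub_apply {G : ℤ → Submodule K V} {P₀ P₁ : V →ₗ[K] V} (h : IsParity G P₀ P₁)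
    {n : ℤ} {x : V} (hx : x ∈ G n) : (P₀ - P₁) x = n.negOnePow • x := by
  rcases Int.even_or_odd n with hn | hn
  · simp [h.even hx hn, Int.negOnePow_even n hn]
  · simp [h.odd hx hn, Int.negOnePow_odd n hn]

namespace FormalVF

/-- The coefficient of degree `n` is homogeneous of degree `p` and graded symmetric. -/
def IsHomogeneousAt (G : ℤ → Submodule K V) : ℕ → ℤ → FormalVF K V → Prop
  | 0, p, D => ev D ∈ G p
  | n + 1, p, D => (∀ q, ∀ x ∈ G q, IsHomogeneousAt G n (p + q) (der x D)) ∧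
      ∀ q r, ∀ x ∈ G q, ∀ y ∈ G r, ∀ m, n = m + 1 →
        der x (der y D) m = (q * r).negOnePow • der y (der x D) m

variable {G : ℤ → Submodule K V}

theorem IsHomogeneousAt.congr {n : ℕ} {p : ℤ} {D E : FormalVF K V} (hD : IsHomogeneousAt G n p D)
    (h : D n = E n) : IsHomogeneousAt G n p E := by
  induction n generalizing p D E with
  | zero =>
    have : ev D = ev E := congrArg (fun f => f Fin.elim0) h
    rwa [IsHomogeneousAt, ← this]
  | succ n ih =>
    have h' : ∀ x, der x D n = der x E n := fun x => by rw [der_apply, der_apply, h]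
    refine ⟨fun q x hx => ih (hD.1 q x hx) (h' x), ?_⟩
    rintro q r x hx y hy m rfl
    have h'' : ∀ x y, der x (der y D) m = der x (der y E) m := fun x y => by
      rw [der_apply, h', der_apply x (der y E)]
    rw [← h'', ← h'']
    exact hD.2 q r x hx y hy m rfl

theorem IsHomogeneousAt.zero (n : ℕ) (p : ℤ) : IsHomogeneousAt G n p 0 := by
  induction n generalizing p with
  | zero => exact Submodule.zero_mem _
  | succ n ih => exact ⟨fun q x _ => by simpa using ih (p + q), fun _ _ _ _ _ _ _ _ => by simp⟩

theorem IsHomogeneousAt.add {n : ℕ} {p : ℤ} {D E : FormalVF K V} (hD : IsHomogeneousAt G n p D)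
    (hE : IsHomogeneousAt G n p E) : IsHomogeneousAt G n p (D + E) := by
  induction n generalizing p D E with
  | zero => exact Submodule.add_mem _ hD hE
  | succ n ih =>
    refine ⟨fun q x hx => ?_, fun q r x hx y hy m hm => ?_⟩
    · rw [map_add]
      exact ih (hD.1 q x hx) (hE.1 q x hx)
    · simp only [map_add, Pi.add_apply, smul_add, hD.2 q r x hx y hy m hm,
        hE.2 q r x hx y hy m hm]

theorem IsHomogeneousAt.smul {n : ℕ} {p : ℤ} {D : FormalVF K V} (c : K)
    (hD : IsHomogeneousAt G n p D) : IsHomogeneousAt G n p (c • D) := by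
  induction n generalizing p D with
  | zero => exact Submodule.smul_mem _ _ hD
  | succ n ih =>
    refine ⟨fun q x hx => ?_, fun q r x hx y hy m hm => ?_⟩
    · rw [map_smul]
      exact ih (hD.1 q x hx)
    · simp only [map_smul, Pi.smul_apply, hD.2 q r x hx y hy m hm]
      rw [smul_comm]

theorem IsHomogeneousAt.units_smul {n : ℕ} {p : ℤ} {D : FormalVF K V} (ε : ℤˣ)
    (hD : IsHomogeneousAt G n p D) : IsHomogeneousAt G n p (ε • D) := by
  rcases Int.units_eq_one_or ε with rfl | rfl
  · simpa using hD
  · simpa using hD.smul (-1)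

variable (G) in
/-- Homogeneous vector fields. -/
def homogeneous (p : ℤ) : Submodule K (FormalVF K V) where
  carrier := {D | ∀ n, IsHomogeneousAt G n p D}
  zero_mem' n := .zero n p
  add_mem' hD hE n := (hD n).add (hE n)
  smul_mem' c _ hD n := (hD n).smul c

theorem ev_mem {p : ℤ} {D : FormalVF K V} (hD : D ∈ homogeneous G p) : ev D ∈ G p := hD 0

theorem der_mem {p q : ℤ} {D : FormalVF K V} {x : V} (hx : x ∈ G q) (hD : D ∈ homogeneous G p) :
    der x D ∈ homogeneous G (p + q) :=
  fun n => (hD (n + 1)).1 q x hx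

theorem der_comm {p q r : ℤ} {D : FormalVF K V} {x y : V} (hx : x ∈ G q) (hy : y ∈ G r)
    (hD : D ∈ homogeneous G p) : der x (der y D) = (q * r).negOnePow • der y (der x D) :=
  funext fun n => (hD (n + 2)).2 q r x hx y hy n rfl

theorem const_mem {p : ℤ} {x : V} (hx : x ∈ G p) : const x ∈ homogeneous G p := by
  rintro (_ | n)
  · rwa [IsHomogeneousAt, ev_const]
  · refine ⟨fun q y hy => ?_, fun q r y hy z hz m hm => by simp⟩
    rw [der_const]
    exact .zero n _

variable {P₀ P₁ : V →ₗ[K] V}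

theorem component_ext (h : IsParity G P₀ P₁) {D E : FormalVF K V} {n : ℕ}
    (hDE : ∀ q, ∀ x ∈ G q, der x D n = der x E n) : D (n + 1) = E (n + 1) := by
  rw [← sub_eq_zero, ← Pi.sub_apply, component_eq_zero_iff]
  intro x
  induction x using h.induction with
  | add x y hx hy => rw [map_add, LinearMap.add_apply, Pi.add_apply, hx, hy, add_zero]
  | hom q x hx => rw [map_sub, Pi.sub_apply, hDE q x hx, sub_self]

theorem component_zero_ext {D E : FormalVF K V} (h : ev D = ev E) : D 0 = E 0 := by
  rw [← sub_eq_zero, ← Pi.sub_apply, component_zero_eq_zero_iff, map_sub, h, sub_self]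

/-- Conjugation by the sign operator multiplies a homogeneous field by the sign of its degree; this
converts the definitions by `P₀` and `P₁` into the usual Koszul signs. -/
theorem parity_eq (h : IsParity G P₀ P₁) {p : ℤ} {D : FormalVF K V}
    (hD : D ∈ homogeneous G p) : parity P₀ P₁ D = p.negOnePow • D := by
  funext n
  induction n generalizing p D with
  | zero =>
    refine component_zero_ext ?_
    rw [ev_parity, h.sub_apply (ev_mem hD), map_zsmul_unit]
  | succ n ih =>
    refine component_ext h fun q x hx => ?_
    rw [der_parity, h.sub_apply hx, map_zsmul_unit, LinearMap.smul_apply, map_zsmul_unit,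
      map_zsmul_unit, Pi.smul_apply, Pi.smul_apply, ih (der_mem hx hD), Pi.smul_apply, smul_smul,
      Int.negOnePow_add]
    congr 1
    rcases Int.units_eq_one_or q.negOnePow with e | e <;> simp [e]

theorem ev_bracket_of_mem (h : IsParity G P₀ P₁) {p s : ℤ} {D E : FormalVF K V}
    (hD : D ∈ homogeneous G p) (hE : E ∈ homogeneous G s) : ev (bracket P₀ P₁ D E) =
      ev (der (ev E) D) - (p * s).negOnePow • ev (der (ev D) E) := by
  rw [ev_bracket, parity_eq h hE]
  rcases Int.even_or_odd p with hp | hp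
  · simp [h.even (ev_mem hD) hp, Int.negOnePow_even _ (hp.mul_right s)]
  · obtain ⟨m, rfl⟩ := hp
    simp [h.odd (ev_mem hD) ⟨m, rfl⟩, add_mul, mul_assoc, Int.negOnePow_add, map_zsmul_unit]

theorem der_bracket_of_mem (h : IsParity G P₀ P₁) {q s : ℤ} {x : V} {D E : FormalVF K V}
    (hx : x ∈ G q) (hE : E ∈ homogeneous G s) : der x (bracket P₀ P₁ D E) =
      bracket P₀ P₁ D (der x E) + (q * s).negOnePow • bracket P₀ P₁ (der x D) E := by
  rw [der_bracket, parity_eq h hE]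
  rcases Int.even_or_odd q with hq | hq
  · simp [h.even hx hq, Int.negOnePow_even _ (hq.mul_right s)]
  · obtain ⟨m, rfl⟩ := hq
    simp [h.odd hx ⟨m, rfl⟩, add_mul, mul_assoc, Int.negOnePow_add, map_zsmul_unit]

/-- For symmetry of second derivatives, the bracket is differentiated twice and the symmetry of the
second derivatives of `D` and of `E` is used; the mixed terms are exchanged with each other. -/
theorem bracket_mem (h : IsParity G P₀ P₁) {p s : ℤ} {D E : FormalVF K V}
    (hD : D ∈ homogeneous G p) (hE : E ∈ homogeneous G s) :
    bracket P₀ P₁ D E ∈ homogeneous G (p + s) := by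
  intro n
  induction n generalizing p s D E with
  | zero =>
    rw [IsHomogeneousAt, ev_bracket_of_mem h hD hE]
    have h1 := ev_mem (der_mem (ev_mem hE) hD)
    have h2 := ev_mem (der_mem (ev_mem hD) hE)
    rw [add_comm s p] at h2
    rcases Int.units_eq_one_or (p * s).negOnePow with e | e
    · simpa [e] using Submodule.sub_mem _ h1 h2
    · simpa [e] using Submodule.add_mem _ h1 h2
  | succ n ih =>
    refine ⟨fun q x hx => ?_, fun q r x hx y hy m hm => ?_⟩
    · rw [der_bracket_of_mem h hx hE]
      have h1 := ih hD (der_mem hx hE)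
      have h2 := ih (der_mem hx hD) hE
      rw [← add_assoc] at h1
      rw [add_right_comm] at h2
      exact h1.add (h2.units_smul _)
    · rw [der_bracket_of_mem h hx hE, der_bracket_of_mem h hy hE, map_add, map_add,
        map_zsmul_unit, map_zsmul_unit, der_bracket_of_mem h hx (der_mem hy hE),
        der_bracket_of_mem h hx hE, der_bracket_of_mem h hy (der_mem hx hE),
        der_bracket_of_mem h hy hE, der_comm hx hy hD, der_comm hx hy hE]
      simp only [map_zsmul_unit, LinearMap.smul_apply, Pi.add_apply, Pi.smul_apply, mul_add,
        Int.negOnePow_add, mul_comm r q]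
      rcases Int.units_eq_one_or (q * r).negOnePow with e | e <;>
      rcases Int.units_eq_one_or (q * s).negOnePow with e' | e' <;>
      rcases Int.units_eq_one_or (r * s).negOnePow with e'' | e'' <;>
      simp [e, e', e''] <;> abel

theorem bracket_antisymm (h : IsParity G P₀ P₁) {p s : ℤ} {D E : FormalVF K V}
    (hD : D ∈ homogeneous G p) (hE : E ∈ homogeneous G s) :
    bracket P₀ P₁ D E = -((p * s).negOnePow • bracket P₀ P₁ E D) := by
  funext n
  induction n generalizing p s D E with
  | zero =>
    refine component_zero_ext ?_
    rw [map_neg, map_zsmul_unit, ev_bracket_of_mem h hD hE, ev_bracket_of_mem h hE hD,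
      mul_comm s p]
    rcases Int.units_eq_one_or (p * s).negOnePow with e | e <;> simp [e]
  | succ n ih =>
    refine component_ext h fun q x hx => ?_
    have h1 := ih hD (der_mem hx hE)
    have h2 := ih (der_mem hx hD) hE
    rw [map_neg, map_zsmul_unit, der_bracket_of_mem h hx hE, der_bracket_of_mem h hx hD]
    simp only [Pi.add_apply, Pi.smul_apply, Pi.neg_apply, h1, h2, mul_add, add_mul,
      Int.negOnePow_add, mul_comm q p]
    rcases Int.units_eq_one_or (p * s).negOnePow with e | e <;>
    rcases Int.units_eq_one_or (p * q).negOnePow with e' | e' <;>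
    rcases Int.units_eq_one_or (q * s).negOnePow with e'' | e'' <;>
    simp [e, e', e'']

/-- At the origin the terms with two first derivatives cancel and those with a second derivative
match by its graded symmetry. Differentiating the identity gives the sum, with signs, of the
identities with one of `D`, `E`, `F` differentiated. -/
theorem bracket_jacobi (h : IsParity G P₀ P₁) {p r s : ℤ} {D E F : FormalVF K V}
    (hD : D ∈ homogeneous G p) (hE : E ∈ homogeneous G r) (hF : F ∈ homogeneous G s) :
    bracket P₀ P₁ D (bracket P₀ P₁ E F) = bracket P₀ P₁ (bracket P₀ P₁ D E) F +
      (p * r).negOnePow • bracket P₀ P₁ E (bracket P₀ P₁ D F) := by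
  funext n
  induction n generalizing p r s D E F with
  | zero =>
    refine component_zero_ext ?_
    have ha := ev_mem hD
    have hb := ev_mem hE
    have hc := ev_mem hF
    have h1 := congrArg ev (der_comm hb hc hD)
    have h2 := congrArg ev (der_comm ha hc hE)
    have h3 := congrArg ev (der_comm ha hb hF)
    rw [map_zsmul_unit] at h1 h2 h3
    rw [map_add, map_zsmul_unit, ev_bracket_of_mem h hD (bracket_mem h hE hF),
      ev_bracket_of_mem h hE (bracket_mem h hD hF), ev_bracket_of_mem h (bracket_mem h hD hE) hF,
      der_bracket_of_mem h ha hF, der_bracket_of_mem h hb hF, der_bracket_of_mem h hc hE]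
    simp only [map_add, map_zsmul_unit]
    rw [ev_bracket_of_mem h hE hF, ev_bracket_of_mem h hD hE, ev_bracket_of_mem h hD hF,
      ev_bracket_of_mem h hE (der_mem ha hF), ev_bracket_of_mem h (der_mem ha hE) hF,
      ev_bracket_of_mem h hD (der_mem hb hF), ev_bracket_of_mem h (der_mem hb hD) hF,
      ev_bracket_of_mem h hD (der_mem hc hE), ev_bracket_of_mem h (der_mem hc hD) hE]
    simp only [map_sub, map_zsmul_unit, LinearMap.sub_apply, LinearMap.smul_apply, h1, h2, h3,
      mul_add, add_mul, Int.negOnePow_add, mul_comm r p, mul_comm s r]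
    rcases Int.units_eq_one_or (p * r).negOnePow with e | e <;>
    rcases Int.units_eq_one_or (p * s).negOnePow with e' | e' <;>
    rcases Int.units_eq_one_or (r * s).negOnePow with e'' | e'' <;>
    simp [e, e', e''] <;> abel
  | succ n ih =>
    refine component_ext h fun q x hx => ?_
    have h1 := ih hD hE (der_mem hx hF)
    have h2 := ih hD (der_mem hx hE) hF
    have h3 := ih (der_mem hx hD) hE hF
    rw [map_add, map_zsmul_unit, der_bracket_of_mem h hx (bracket_mem h hE hF),
      der_bracket_of_mem h hx hF, der_bracket_of_mem h hx hF, der_bracket_of_mem h hx hE,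
      der_bracket_of_mem h hx (bracket_mem h hD hF), der_bracket_of_mem h hx hF]
    simp only [map_add, map_zsmul_unit, LinearMap.add_apply, LinearMap.smul_apply, Pi.add_apply,
      Pi.smul_apply, h1, h2, h3, mul_add, add_mul, Int.negOnePow_add, mul_comm q p, mul_comm q r]
    rcases Int.units_eq_one_or (p * r).negOnePow with e | e <;>
    rcases Int.units_eq_one_or (p * q).negOnePow with e' | e' <;>
    rcases Int.units_eq_one_or (q * s).negOnePow with e'' | e'' <;>
    rcases Int.units_eq_one_or (r * q).negOnePow with e''' | e''' <;>
    simp [e, e', e'', e'''] <;> abel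

end FormalVF

end HomogeneousVectorFields

/-! ### Vector fields preserving a subspace -/

section PreservingSubspace

variable {K : Type u} {V : Type v} [Field K] [AddCommGroup V] [Module K V]

namespace FormalVF

/-- The coefficient of degree `n` maps arguments in `B` to `B`. -/
def PreservesAt (B : Submodule K V) : ℕ → FormalVF K V → Prop
  | 0, D => ev D ∈ B
  | n + 1, D => ∀ x ∈ B, PreservesAt B n (der x D)

variable {B : Submodule K V}

theorem PreservesAt.congr {n : ℕ} {D E : FormalVF K V} (hD : PreservesAt B n D)
    (h : D n = E n) : PreservesAt B n E := by
  induction n generalizing D E with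
  | zero =>
    have : ev D = ev E := congrArg (fun f => f Fin.elim0) h
    rwa [PreservesAt, ← this]
  | succ n ih => exact fun x hx => ih (hD x hx) (by rw [der_apply, der_apply, h])

variable (B) in
/-- The vector fields whose restriction to `B` takes values in `B`. -/
def preserving : Submodule K (FormalVF K V) where
  carrier := {D | ∀ n, PreservesAt B n D}
  zero_mem' n := by
    induction n with
    | zero => exact Submodule.zero_mem _
    | succ n ih => exact fun x _ => by simpa using ih
  add_mem' {D E} hD hE n := by
    replace hD := hD n
    replace hE := hE n
    induction n generalizing D E with
    | zero => exact Submodule.add_mem _ hD hE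
    | succ n ih => exact fun x hx => by simpa using ih (hD x hx) (hE x hx)
  smul_mem' c {D} hD n := by
    replace hD := hD n
    induction n generalizing D with
    | zero => exact Submodule.smul_mem _ _ hD
    | succ n ih => exact fun x hx => by simpa using ih (hD x hx)

theorem ev_mem_of_preserving {D : FormalVF K V} (hD : D ∈ preserving B) : ev D ∈ B := hD 0

theorem der_mem_preserving {D : FormalVF K V} {x : V} (hx : x ∈ B) (hD : D ∈ preserving B) :
    der x D ∈ preserving B :=
  fun n => hD (n + 1) x hx

theorem mem_preserving {D : FormalVF K V} (h : ev D ∈ B) (h' : ∀ x ∈ B, der x D ∈ preserving B) :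
    D ∈ preserving B := by
  rintro (_ | n)
  · exact h
  · exact fun x hx => h' x hx n

theorem const_mem_preserving {x : V} (hx : x ∈ B) : const x ∈ preserving B :=
  mem_preserving (by rwa [ev_const]) fun y _ => by simp

variable {P₀ P₁ : V →ₗ[K] V} (h₀ : ∀ x ∈ B, P₀ x ∈ B) (h₁ : ∀ x ∈ B, P₁ x ∈ B)
include h₀ h₁

theorem parity_mem_preserving {D : FormalVF K V} (hD : D ∈ preserving B) :
    parity P₀ P₁ D ∈ preserving B := by
  intro n
  induction n generalizing D with
  | zero =>
    rw [PreservesAt, ev_parity]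
    exact Submodule.sub_mem _ (h₀ _ (hD 0)) (h₁ _ (hD 0))
  | succ n ih =>
    intro x hx
    rw [der_parity]
    exact ih (der_mem_preserving (Submodule.sub_mem _ (h₀ _ hx) (h₁ _ hx)) hD)

theorem bracket_mem_preserving {D E : FormalVF K V} (hD : D ∈ preserving B)
    (hE : E ∈ preserving B) : bracket P₀ P₁ D E ∈ preserving B := by
  intro n
  induction n generalizing D E with
  | zero =>
    rw [PreservesAt, ev_bracket]
    exact Submodule.sub_mem _ (Submodule.sub_mem _ (der_mem_preserving (hE 0) hD 0)
      (der_mem_preserving (h₀ _ (hD 0)) hE 0))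
      (der_mem_preserving (h₁ _ (hD 0)) (parity_mem_preserving h₀ h₁ hE) 0)
  | succ n ih =>
    intro x hx
    rw [der_bracket]
    -- The induction hypothesis concerns a single coefficient, so additivity of `preserving B` does
    -- not apply and is reproved in degree `n`.
    have hle : ∀ {D E : FormalVF K V}, PreservesAt B n D → PreservesAt B n E →
        PreservesAt B n (D + E) := by
      clear ih hx hD hE D E
      intro D E hD hE
      induction n generalizing D E with
      | zero => exact Submodule.add_mem _ hD hE
      | succ n ih => exact fun x hx => by simpa using ih (hD x hx) (hE x hx)
    exact hle (hle (ih hD (der_mem_preserving hx hE))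
      (ih (der_mem_preserving (h₀ _ hx) hD) hE))
      (ih (der_mem_preserving (h₁ _ hx) hD) (parity_mem_preserving h₀ h₁ hE))

end FormalVF

end PreservingSubspace

/-! ### The exponential of a field starting in degree two -/

section Exponential

variable {K : Type u} {V : Type v} [Field K] [AddCommGroup V] [Module K V]

namespace FormalVF

variable (P₀ P₁ : V →ₗ[K] V) (r : FormalVF K V)

/-- The divided powers `(ad r)ᵏ / k!`. -/
noncomputable def adPow : ℕ → FormalVF K V →ₗ[K] FormalVF K V
  | 0 => LinearMap.id
  | k + 1 => (k + 1 : K)⁻¹ • bracket P₀ P₁ r ∘ₗ adPow k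

theorem adPow_succ (k : ℕ) (D : FormalVF K V) :
    adPow P₀ P₁ r (k + 1) D = (k + 1 : K)⁻¹ • bracket P₀ P₁ r (adPow P₀ P₁ r k D) := rfl

/-- The operator `exp (ad r)`, for `r` whose coefficients of degrees `0` and `1` vanish. -/
noncomputable def expAd : FormalVF K V →ₗ[K] FormalVF K V where
  toFun D n := ∑ k ∈ Finset.range (n + 1), adPow P₀ P₁ r k D n
  map_add' D E := by
    funext n
    simp [Finset.sum_add_distrib]
  map_smul' c D := by
    funext n
    simp [Finset.smul_sum]

variable {P₀ P₁ r} (hr₀ : r 0 = 0) (hr₁ : r 1 = 0)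
include hr₀ hr₁

/-- A field `r` without constant and linear terms raises the order of vanishing by at least one,
which is why the truncated sums defining `expAd` are the full exponential series. -/
theorem adPow_component {k n : ℕ} (hn : n < k) (D : FormalVF K V) :
    adPow P₀ P₁ r k D n = 0 := by
  induction k generalizing n with
  | zero => omega
  | succ k ih =>
    rw [adPow_succ, Pi.smul_apply, bracket_component_eq_zero, smul_zero]
    intro i j hij
    rcases i with _ | _ | i
    · exact Or.inl hr₀
    · exact Or.inl hr₁
    · exact Or.inr (ih (by omega))

theorem expAd_component {N n : ℕ} (hn : n < N) (D : FormalVF K V) :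
    expAd P₀ P₁ r D n = (∑ k ∈ Finset.range N, adPow P₀ P₁ r k D) n := by
  rw [Finset.sum_apply]
  refine Finset.sum_subset (Finset.range_mono hn) fun k _ hk => ?_
  exact adPow_component hr₀ hr₁ (by simpa using hk) D

omit hr₀ hr₁ in
theorem ev_expAd (D : FormalVF K V) : ev (expAd P₀ P₁ r D) = ev D := by
  simp [ev, expAd, adPow]

/-- The series stops: `[r, θ + q] = -q`, and every further bracket with `r` is zero. -/
theorem expAd_of_bracket_eq {θ q : FormalVF K V} (hq : bracket P₀ P₁ r θ = -q)
    (hrq : bracket P₀ P₁ r q = 0) : expAd P₀ P₁ r (θ + q) = θ := by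
  funext n
  rw [expAd_component hr₀ hr₁ (N := n + 1 + 1) (by omega), Finset.sum_range_succ',
    Finset.sum_range_succ', Finset.sum_eq_zero]
  · simp [adPow, hq, hrq]
  · intro k hk
    clear hk
    induction k with
    | zero => simp [adPow, hq, hrq]
    | succ k ih => rw [adPow_succ, ih, map_zero, smul_zero]

omit hr₀ hr₁

variable {G : ℤ → Submodule K V} (h : IsParity G P₀ P₁) (hr : r ∈ homogeneous G 0)
include h hr

theorem adPow_mem {p : ℤ} {D : FormalVF K V} (hD : D ∈ homogeneous G p) (k : ℕ) :
    adPow P₀ P₁ r k D ∈ homogeneous G p := by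
  induction k with
  | zero => exact hD
  | succ k ih =>
    have := bracket_mem h hr ih
    rw [zero_add] at this
    exact Submodule.smul_mem _ _ this

/-- `ad r` is an even derivation of the bracket, so this is the Leibniz formula, free of binomial
coefficients thanks to divided powers. -/
theorem adPow_bracket [CharZero K] {p s : ℤ} {D E : FormalVF K V} (hD : D ∈ homogeneous G p)
    (hE : E ∈ homogeneous G s) (k : ℕ) : adPow P₀ P₁ r k (bracket P₀ P₁ D E) =
      ∑ ij ∈ Finset.HasAntidiagonal.antidiagonal k,
        bracket P₀ P₁ (adPow P₀ P₁ r ij.1 D) (adPow P₀ P₁ r ij.2 E) := by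
  induction k with
  | zero => simp [adPow]
  | succ k ih =>
    have hk : (k + 1 : K) ≠ 0 := by exact_mod_cast k.succ_ne_zero
    have hstep : ∀ (D : FormalVF K V) (i : ℕ), bracket P₀ P₁ r (adPow P₀ P₁ r i D) =
        (i + 1 : K) • adPow P₀ P₁ r (i + 1) D := fun D i => by
      have hi : (i + 1 : K) ≠ 0 := by exact_mod_cast i.succ_ne_zero
      rw [adPow_succ, smul_smul, mul_inv_cancel₀ hi, one_smul]
    have hsum : ∀ ij ∈ Finset.HasAntidiagonal.antidiagonal k,
        bracket P₀ P₁ r (bracket P₀ P₁ (adPow P₀ P₁ r ij.1 D) (adPow P₀ P₁ r ij.2 E)) =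
        (ij.1 + 1 : K) • bracket P₀ P₁ (adPow P₀ P₁ r (ij.1 + 1) D) (adPow P₀ P₁ r ij.2 E) +
        (ij.2 + 1 : K) • bracket P₀ P₁ (adPow P₀ P₁ r ij.1 D) (adPow P₀ P₁ r (ij.2 + 1) E) :=
      fun ij _ => by
        rw [bracket_jacobi h hr (adPow_mem h hr hD ij.1) (adPow_mem h hr hE ij.2), hstep, hstep]
        simp
    rw [adPow_succ, ih, map_sum, Finset.sum_congr rfl hsum, Finset.sum_add_distrib,
      inv_smul_eq_iff₀ hk]
    let f : ℕ × ℕ → FormalVF K V := fun ij =>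
      bracket P₀ P₁ (adPow P₀ P₁ r ij.1 D) (adPow P₀ P₁ r ij.2 E)
    have e1 := Finset.Nat.sum_antidiagonal_succ (n := k) (f := fun ij => (ij.1 : K) • f ij)
    have e2 := Finset.Nat.sum_antidiagonal_succ' (n := k) (f := fun ij => (ij.2 : K) • f ij)
    simp only [Nat.cast_zero, zero_smul, zero_add, Nat.cast_add, Nat.cast_one] at e1 e2
    change ∑ ij ∈ Finset.HasAntidiagonal.antidiagonal k, (ij.1 + 1 : K) • f (ij.1 + 1, ij.2) +
      ∑ ij ∈ Finset.HasAntidiagonal.antidiagonal k, (ij.2 + 1 : K) • f (ij.1, ij.2 + 1) = _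
    rw [← e1, ← e2, ← Finset.sum_add_distrib, Finset.smul_sum]
    refine Finset.sum_congr rfl fun ij hij => ?_
    rw [← add_smul, ← Nat.cast_add, Finset.HasAntidiagonal.mem_antidiagonal.1 hij]
    push_cast
    rfl

include hr₀ hr₁

theorem expAd_mem {p : ℤ} {D : FormalVF K V} (hD : D ∈ homogeneous G p) :
    expAd P₀ P₁ r D ∈ homogeneous G p := fun n => by
  have : ∑ k ∈ Finset.range (n + 1), adPow P₀ P₁ r k D ∈ homogeneous G p :=
    Submodule.sum_mem _ fun k _ => adPow_mem h hr hD k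
  exact (this n).congr (expAd_component hr₀ hr₁ n.lt_succ_self D).symm

/-- The exponential of a derivation is multiplicative, by the Cauchy product of truncated series. -/
theorem expAd_bracket [CharZero K] {p s : ℤ} {D E : FormalVF K V} (hD : D ∈ homogeneous G p)
    (hE : E ∈ homogeneous G s) : expAd P₀ P₁ r (bracket P₀ P₁ D E) =
      bracket P₀ P₁ (expAd P₀ P₁ r D) (expAd P₀ P₁ r E) := by
  funext n
  -- The coefficient of degree `n` of a bracket sees coefficients up to degree `n + 1` of its
  -- arguments, hence the truncation at `n + 2`.
  let S : FormalVF K V → FormalVF K V := fun D =>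
    ∑ k ∈ Finset.range (n + 2), adPow P₀ P₁ r k D
  have hS : ∀ D : FormalVF K V, ∀ m ≤ n + 1, (expAd P₀ P₁ r D - S D) m = 0 := fun D m hm => by
    rw [Pi.sub_apply, expAd_component hr₀ hr₁ (N := n + 2) (by omega), sub_self]
  have h1 : bracket P₀ P₁ (expAd P₀ P₁ r D - S D) (expAd P₀ P₁ r E) n = 0 :=
    bracket_component_eq_zero _ _ fun i j hij => Or.inl (hS D i (by omega))
  have h2 : bracket P₀ P₁ (S D) (expAd P₀ P₁ r E - S E) n = 0 :=
    bracket_component_eq_zero _ _ fun i j hij => Or.inr (hS E j (by omega))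
  rw [map_sub, LinearMap.sub_apply, Pi.sub_apply, sub_eq_zero] at h1
  rw [map_sub, Pi.sub_apply, sub_eq_zero] at h2
  rw [h1, h2, expAd_component hr₀ hr₁ (N := n + 2) (by omega)]
  have h3 : ∀ i j, n + 2 ≤ i + j →
      bracket P₀ P₁ (adPow P₀ P₁ r i D) (adPow P₀ P₁ r j E) n = 0 := fun i j hij =>
    bracket_component_eq_zero _ _ fun a b hab => by
      rcases lt_or_ge a i with ha | ha
      · exact Or.inl (adPow_component hr₀ hr₁ ha D)
      · exact Or.inr (adPow_component hr₀ hr₁ (by omega) E)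
  simp only [S, map_sum, LinearMap.sum_apply, Finset.sum_apply, adPow_bracket h hr hD hE]
  rw [Finset.sum_comm, ← Finset.sum_product', Finset.sum_sigma']
  symm
  -- The square of indices is cut down to the triangle `i + j < n + 2`; outside it the terms vanish
  -- by `h3`.
  rw [← Finset.sum_filter_of_ne (p := fun ij => ij.1 + ij.2 < n + 2)]
  · refine Finset.sum_nbij' (fun ij => ⟨ij.1 + ij.2, ij⟩) (fun x => x.2) ?_ ?_ ?_ ?_ ?_
    · intro ij hij
      simp only [Finset.mem_filter, Finset.mem_product, Finset.mem_range] at hij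
      simp [hij.2]
    · rintro ⟨k, ij⟩ hij
      simp only [Finset.mem_sigma, Finset.mem_range, Finset.HasAntidiagonal.mem_antidiagonal] at hij
      simp only [Finset.mem_filter, Finset.mem_product, Finset.mem_range]
      omega
    · exact fun _ _ => rfl
    · rintro ⟨k, ij⟩ hij
      simp only [Finset.mem_sigma, Finset.mem_range, Finset.HasAntidiagonal.mem_antidiagonal] at hij
      obtain ⟨_, rfl⟩ := hij
      rfl
    · exact fun _ _ => rfl
  · intro ij _ hne
    by_contra hlt
    exact hne (h3 _ _ (by omega))

omit h hr

theorem expAd_mem_preserving {B : Submodule K V} (h₀ : ∀ x ∈ B, P₀ x ∈ B)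
    (h₁ : ∀ x ∈ B, P₁ x ∈ B) (hrB : r ∈ preserving B) {D : FormalVF K V}
    (hD : D ∈ preserving B) : expAd P₀ P₁ r D ∈ preserving B := fun n => by
  have hk : ∀ k, adPow P₀ P₁ r k D ∈ preserving B := fun k => by
    induction k with
    | zero => exact hD
    | succ k ih => exact Submodule.smul_mem _ _ (bracket_mem_preserving h₀ h₁ hrB ih)
  have : ∑ k ∈ Finset.range (n + 1), adPow P₀ P₁ r k D ∈ preserving B :=
    Submodule.sum_mem _ fun k _ => hk k
  exact (this n).congr (expAd_component hr₀ hr₁ n.lt_succ_self D).symm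

end FormalVF

end Exponential

/-! ### From operators to vector fields: Koszul brackets -/

section KoszulBrackets

variable {K : Type u} {A : Type v} [Field K] [Ring A] [Algebra K A]

theorem gradedCommutator_apply (m n : ℤ) (f g : A →ₗ[K] A) (a : A) :
    gradedCommutator m n f g a = f (g a) - (m * n).negOnePow • g (f a) := by
  simp [gradedCommutator]

theorem IsHomogeneousMap.comp {𝒜 : ℤ → Submodule K A} {m n : ℤ} {f g : A →ₗ[K] A}
    (hf : IsHomogeneousMap 𝒜 m f) (hg : IsHomogeneousMap 𝒜 n g) :
    IsHomogeneousMap 𝒜 (m + n) (f ∘ₗ g) := fun p a ha => by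
  have := hf _ _ (hg p a ha)
  rwa [add_assoc, add_comm n m] at this

theorem IsHomogeneousMap.gradedCommutator {𝒜 : ℤ → Submodule K A} {m n : ℤ} {f g : A →ₗ[K] A}
    (hf : IsHomogeneousMap 𝒜 m f) (hg : IsHomogeneousMap 𝒜 n g) :
    IsHomogeneousMap 𝒜 (m + n) (gradedCommutator m n f g) := fun p a ha => by
  have h1 := hf.comp hg p a ha
  have h2 := hg.comp hf p a ha
  rw [add_comm n m] at h2
  rw [gradedCommutator_apply]
  rcases Int.units_eq_one_or (m * n).negOnePow with e | e
  · simpa [e] using Submodule.sub_mem _ h1 h2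
  · simpa [e] using Submodule.add_mem _ h1 h2

/-- The degrees serve only as labels for signs, so no homogeneity of the maps is needed. -/
theorem gradedCommutator_jacobi (m n q : ℤ) (f g h : A →ₗ[K] A) :
    gradedCommutator (m + n) q (gradedCommutator m n f g) h =
      gradedCommutator m (n + q) f (gradedCommutator n q g h) +
        (q * n).negOnePow • gradedCommutator (m + q) n (gradedCommutator m q f h) g := by
  simp only [gradedCommutator, add_mul, mul_add, Int.negOnePow_add, mul_comm q n]
  rcases Int.units_eq_one_or (m * n).negOnePow with e | e <;>
  rcases Int.units_eq_one_or (n * q).negOnePow with e' | e' <;>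
  rcases Int.units_eq_one_or (m * q).negOnePow with e'' | e'' <;>
  · simp only [e, e', e'']
    ext
    simp
    try abel

variable (P₀ P₁ : A →ₗ[K] A)

/-- The graded commutator with a left multiplication, as a linear function of both arguments. -/
def mulCommutator : A →ₗ[K] (A →ₗ[K] A) →ₗ[K] (A →ₗ[K] A) :=
  LinearMap.mk₂ K (fun x f => f ∘ₗ LinearMap.mulLeft K x - LinearMap.mulLeft K (P₀ x) ∘ₗ f -
      LinearMap.mulLeft K (P₁ x) ∘ₗ (P₀ - P₁) ∘ₗ f ∘ₗ (P₀ - P₁))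
    (fun _ _ _ => by ext; simp [add_mul]; abel) (fun _ _ _ => by ext; simp [smul_sub])
    (fun _ _ _ => by ext; simp [mul_add, mul_sub]; abel)
    (fun _ _ _ => by ext; simp [smul_sub, mul_sub])

/-- The coefficients of the Koszul brackets of a linear map. -/
def koszulAux : (n : ℕ) → (A →ₗ[K] A) →ₗ[K] MultilinearMap K (fun _ : Fin n => A) A
  | 0 => (MultilinearMap.constLinearEquivOfIsEmpty (R := K) (S := K) (M₂ := A)
      (M₁ := fun _ : Fin 0 => A)).toLinearMap ∘ₗ LinearMap.applyₗ 1
  | n + 1 =>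
    { toFun := fun f => LinearMap.uncurryLeft (koszulAux n ∘ₗ (mulCommutator P₀ P₁).flip f)
      map_add' := fun _ _ => by ext; simp
      map_smul' := fun _ _ => by ext; simp }

/-- The Koszul brackets `[⋯[[f, a₁], a₂], ⋯, aₙ](1)` of a linear map. -/
def koszul : (A →ₗ[K] A) →ₗ[K] FormalVF K A := LinearMap.pi (koszulAux P₀ P₁)

open FormalVF

theorem ev_koszul (f : A →ₗ[K] A) : ev (koszul P₀ P₁ f) = f 1 := by
  simp [ev, koszul, koszulAux]

theorem der_koszul (x : A) (f : A →ₗ[K] A) :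
    der x (koszul P₀ P₁ f) = koszul P₀ P₁ (mulCommutator P₀ P₁ x f) := by
  funext n
  ext w
  simp [der_apply, koszul, koszulAux]

variable {P₀ P₁} {𝒜 : ℤ → Submodule K A} (h : IsParity 𝒜 P₀ P₁)
include h

/-- Conjugating `f` by `P₀ - P₁` multiplies it by `(-1) ^ n`, the sign required when `x` is odd. -/
theorem mulCommutator_eq {n q : ℤ} {x : A} (hx : x ∈ 𝒜 q) {f : A →ₗ[K] A}
    (hf : IsHomogeneousMap 𝒜 n f) :
    mulCommutator P₀ P₁ x f = gradedCommutator n q f (LinearMap.mulLeft K x) := by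
  ext a
  induction a using h.induction with
  | add a b ha hb => rw [map_add, map_add, ha, hb]
  | hom p a ha =>
    have h1 : (P₀ - P₁) (f ((P₀ - P₁) a)) = n.negOnePow • f a := by
      rw [h.sub_apply ha, map_zsmul_unit, map_zsmul_unit, h.sub_apply (hf p a ha), smul_smul,
        Int.negOnePow_add]
      congr 1
      rcases Int.units_eq_one_or p.negOnePow with e | e <;> simp [e]
    rw [gradedCommutator_apply]
    change f (x * a) - P₀ x * f a - P₁ x * ((P₀ - P₁) (f ((P₀ - P₁) a))) =
      f (x * a) - (n * q).negOnePow • (x * f a)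
    rw [h1]
    rcases Int.even_or_odd q with hq | hq
    · simp [h.even hx hq, Int.negOnePow_even _ (hq.mul_left n)]
    · obtain ⟨m, rfl⟩ := hq
      simp [h.odd hx ⟨m, rfl⟩, mul_add, Int.negOnePow_add, mul_left_comm n 2 m, mul_smul_comm]

theorem der_koszul_of_mem {n q : ℤ} {x : A} (hx : x ∈ 𝒜 q) {f : A →ₗ[K] A}
    (hf : IsHomogeneousMap 𝒜 n f) :
    der x (koszul P₀ P₁ f) = koszul P₀ P₁ (gradedCommutator n q f (LinearMap.mulLeft K x)) := by
  rw [der_koszul, mulCommutator_eq h hx hf]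

variable [GradedAlgebra 𝒜]

omit h in
theorem isHomogeneousMap_mulLeft {q : ℤ} {x : A} (hx : x ∈ 𝒜 q) :
    IsHomogeneousMap 𝒜 q (LinearMap.mulLeft K x) := fun p a ha => by
  rw [add_comm]
  exact SetLike.GradedMul.mul_mem hx ha

variable (hc : ∀ (p q : ℤ) (a b : A), a ∈ 𝒜 p → b ∈ 𝒜 q → a * b = (p * q).negOnePow • (b * a))
include hc

/-- Graded symmetry reflects that left multiplications commute up to sign, so `[[f, x], y]` and
`[[f, y], x]` agree up to sign. -/
theorem koszul_mem {n : ℤ} {f : A →ₗ[K] A} (hf : IsHomogeneousMap 𝒜 n f) :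
    koszul P₀ P₁ f ∈ homogeneous 𝒜 n := by
  intro m
  induction m generalizing n f with
  | zero =>
    rw [IsHomogeneousAt, ev_koszul]
    simpa using hf 0 1 SetLike.GradedOne.one_mem
  | succ m ih =>
    refine ⟨fun q x hx => ?_, ?_⟩
    · rw [der_koszul_of_mem h hx hf]
      exact ih (hf.gradedCommutator (isHomogeneousMap_mulLeft hx))
    · rintro q r x hx y hy m rfl
      have hfx := hf.gradedCommutator (isHomogeneousMap_mulLeft hx)
      have hfy := hf.gradedCommutator (isHomogeneousMap_mulLeft hy)
      rw [der_koszul_of_mem h hx hf, der_koszul_of_mem h hy hf, der_koszul_of_mem h hx hfy,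
        der_koszul_of_mem h hy hfx, ← Pi.smul_apply, ← map_zsmul_unit]
      refine congrArg (fun T => koszul P₀ P₁ T m) (LinearMap.ext fun a => ?_)
      simp only [gradedCommutator_apply, LinearMap.mulLeft_apply, LinearMap.smul_apply,
        ← mul_assoc, hc q r x y hx hy, add_mul, Int.negOnePow_add, mul_comm r q, mul_sub,
        mul_smul_comm, smul_mul_assoc, map_zsmul_unit, smul_sub]
      rcases Int.units_eq_one_or (q * r).negOnePow with e | e <;>
      rcases Int.units_eq_one_or (n * q).negOnePow with e' | e' <;>
      rcases Int.units_eq_one_or (n * r).negOnePow with e'' | e'' <;>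
      · simp only [e, e', e'', one_smul, Units.neg_smul, neg_neg, sub_neg_eq_add,
          mul_neg, mul_one]
        try abel

/-- At the origin, `[f, g] 1` is compared with `[f, g 1] 1` and `[g, f 1] 1`; the products of `f 1`
and `g 1` cancel by graded commutativity. Differentiation in the direction `x` is commutation with
`x`, and the Jacobi identity for operators matches the Leibniz rule for the bracket of fields. -/
theorem koszul_gradedCommutator {m n : ℤ} {f g : A →ₗ[K] A} (hf : IsHomogeneousMap 𝒜 m f)
    (hg : IsHomogeneousMap 𝒜 n g) : koszul P₀ P₁ (gradedCommutator m n f g) =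
      bracket P₀ P₁ (koszul P₀ P₁ f) (koszul P₀ P₁ g) := by
  funext k
  induction k generalizing m n f g with
  | zero =>
    refine component_zero_ext ?_
    have hf1 : f 1 ∈ 𝒜 m := by simpa using hf 0 1 SetLike.GradedOne.one_mem
    have hg1 : g 1 ∈ 𝒜 n := by simpa using hg 0 1 SetLike.GradedOne.one_mem
    rw [ev_bracket_of_mem h (koszul_mem h hc hf) (koszul_mem h hc hg)]
    simp only [ev_koszul]
    rw [der_koszul_of_mem h hg1 hf, der_koszul_of_mem h hf1 hg]
    simp only [ev_koszul, gradedCommutator_apply, LinearMap.mulLeft_apply, mul_one,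
      hc m n _ _ hf1 hg1, mul_comm n m]
    rcases Int.units_eq_one_or (m * n).negOnePow with e | e <;> simp [e]
    abel
  | succ k ih =>
    refine component_ext h fun q x hx => ?_
    have hX := isHomogeneousMap_mulLeft (K := K) hx
    rw [der_koszul_of_mem h hx (hf.gradedCommutator hg),
      der_bracket_of_mem h hx (koszul_mem h hc hg), der_koszul_of_mem h hx hf,
      der_koszul_of_mem h hx hg, gradedCommutator_jacobi, map_add, map_zsmul_unit, Pi.add_apply,
      Pi.add_apply, Pi.smul_apply, Pi.smul_apply, ih hf (hg.gradedCommutator hX),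
      ih (hf.gradedCommutator hX) hg]

omit hc

omit [GradedAlgebra 𝒜] in
-- The coefficient of degree `j` is a `j`-fold iterated commutator, and `k + 1` commutators already
-- annihilate an operator of order at most `k`.
theorem koszul_component_eq_zero {k : ℕ} {n : ℤ} {f : A →ₗ[K] A} (hf : IsDiffOp 𝒜 k n f) {j : ℕ}
    (hj : k < j) : koszul P₀ P₁ f j = 0 := by
  induction k generalizing n f j with
  | zero =>
    obtain ⟨j, rfl⟩ := Nat.exists_eq_succ_of_ne_zero (by omega : j ≠ 0)
    refine component_ext h (E := 0) fun q x hx => ?_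
    rw [der_koszul_of_mem h hx hf.1, hf.2 q x hx]
    simp
  | succ k ih =>
    obtain ⟨j, rfl⟩ := Nat.exists_eq_succ_of_ne_zero (by omega : j ≠ 0)
    refine component_ext h (E := 0) fun q x hx => ?_
    rw [der_koszul_of_mem h hx hf.1, ih (hf.2 q x hx) (by omega)]
    simp

omit h

omit [GradedAlgebra 𝒜] in
theorem IsDiffOp.isHomogeneousMap {k : ℕ} {n : ℤ} {f : A →ₗ[K] A} (hf : IsDiffOp 𝒜 k n f) :
    IsHomogeneousMap 𝒜 n f := by
  cases k with
  | zero => exact hf.1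
  | succ k => exact hf.1

/-- The Leibniz rule says that `[d, x]` is multiplication by `d x`, which commutes with
multiplications. -/
theorem IsDGCA.isDiffOp {d : A →ₗ[K] A} (hA : IsDGCA 𝒜 d) : IsDiffOp 𝒜 1 1 d := by
  have hd : ∀ q, ∀ x ∈ 𝒜 q, gradedCommutator 1 q d (LinearMap.mulLeft K x) =
      LinearMap.mulLeft K (d x) := fun q x hx => by
    ext a
    rw [gradedCommutator_apply, LinearMap.mulLeft_apply, LinearMap.mulLeft_apply,
      LinearMap.mulLeft_apply, hA.leibniz q x a hx, one_mul, add_sub_cancel_right]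
  refine ⟨hA.d_mem, fun q x hx => ?_⟩
  rw [hd q x hx]
  have hdx := hA.d_mem q x hx
  rw [add_comm] at hdx
  refine ⟨isHomogeneousMap_mulLeft hdx, fun p a ha => ?_⟩
  ext b
  rw [gradedCommutator_apply, LinearMap.mulLeft_apply, LinearMap.mulLeft_apply,
    LinearMap.mulLeft_apply, LinearMap.mulLeft_apply, ← mul_assoc, ← mul_assoc,
    hA.mul_comm _ _ _ _ hdx ha, smul_mul_assoc, sub_self, LinearMap.zero_apply]

theorem IsDGCA.d_one {d : A →ₗ[K] A} (hA : IsDGCA 𝒜 d) : d 1 = 0 := by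
  simpa using hA.leibniz 0 1 1 SetLike.GradedOne.one_mem

end KoszulBrackets

/-! ### Fields with a single Taylor coefficient, and change of grading -/

section PureVectorFields

variable {K : Type u} {V : Type v} [Field K] [AddCommGroup V] [Module K V]

namespace FormalVF

/-- Vector fields with only one coefficient, in degree `n`. -/
def IsPure (n : ℕ) (D : FormalVF K V) : Prop := ∀ m, m ≠ n → D m = 0

theorem IsPure.bracket {P₀ P₁ : V →ₗ[K] V} {a b c : ℕ} {D E : FormalVF K V} (hD : IsPure a D)
    (hE : IsPure b E) (habc : a + b = c + 1) : IsPure c (bracket P₀ P₁ D E) := fun m hm => by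
  refine bracket_component_eq_zero _ _ fun i j hij => ?_
  by_cases hi : i = a
  · exact Or.inr (hE j (by omega))
  · exact Or.inl (hD i hi)

theorem isPure_single (n : ℕ) (D : FormalVF K V) : IsPure n (Pi.single n (D n) : FormalVF K V) :=
  fun _ hm => Pi.single_eq_of_ne hm _

theorem single_mem_homogeneous {G : ℤ → Submodule K V} {p : ℤ} {D : FormalVF K V}
    (hD : D ∈ homogeneous G p) (n : ℕ) : (Pi.single n (D n) : FormalVF K V) ∈ homogeneous G p := by
  intro m
  by_cases hm : m = n
  · subst hm
    exact (hD m).congr (by simp)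
  · exact (IsHomogeneousAt.zero m p).congr (isPure_single n D m hm).symm

/-- Regrading of pure vector fields under an even shift of the grading. -/
theorem IsHomogeneousAt.shift {G : ℤ → Submodule K V} {c : ℤ} (hc : Even c) {n : ℕ} {p p' : ℤ}
    {D : FormalVF K V} (hD : IsHomogeneousAt G n p D) (hp : p' = p - c + n * c) :
    IsHomogeneousAt (fun m => G (m + c)) n p' D := by
  induction n generalizing p p' D with
  | zero =>
    have : p' + c = p := by rw [hp]; simp
    simpa only [IsHomogeneousAt, this] using hD
  | succ n ih =>
    refine ⟨fun q x hx => ih (hD.1 _ x hx) (by rw [hp]; push_cast; ring), ?_⟩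
    intro q r x hx y hy m hm
    rw [hD.2 _ _ x hx y hy m hm]
    congr 1
    rw [add_mul, mul_add, mul_add, Int.negOnePow_add, Int.negOnePow_add, Int.negOnePow_add,
      Int.negOnePow_even _ (hc.mul_left q), Int.negOnePow_even _ (hc.mul_right r),
      Int.negOnePow_even _ (hc.mul_left c)]
    simp

theorem IsPure.mem_homogeneous {G : ℤ → Submodule K V} {n : ℕ} {p : ℤ} {D : FormalVF K V}
    (hD : IsPure n D) (h : IsHomogeneousAt G n p D) : D ∈ homogeneous G p := by
  intro m
  by_cases hm : m = n
  · subst hm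
    exact h
  · exact (IsHomogeneousAt.zero m p).congr (hD m hm).symm

end FormalVF

end PureVectorFields

/-! ### The Lie algebra defined by a linear and a quadratic field -/

section QuadraticVectorFields

variable {K : Type u} {V : Type v} [Field K] [AddCommGroup V] [Module K V]

namespace FormalVF

variable {G : ℤ → Submodule K V} {P₀ P₁ : V →ₗ[K] V}

theorem IsPure.der {n : ℕ} {D : FormalVF K V} (hD : IsPure (n + 1) D) (x : V) :
    IsPure n (der x D) :=
  fun m hm => component_eq_zero_iff.1 (hD (m + 1) (by omega)) x

theorem IsPure.eq_const {D : FormalVF K V} (hD : IsPure 0 D) : D = const (ev D) := by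
  funext n
  rcases n with _ | n
  · exact component_zero_ext (ev_const _).symm
  · rw [hD (n + 1) (by omega)]
    symm
    rw [component_eq_zero_iff]
    intro x
    rw [der_const]
    rfl

theorem IsPure.der_eq_const {D : FormalVF K V} (hD : IsPure 1 D) (x : V) :
    FormalVF.der x D = const (ev (FormalVF.der x D)) :=
  (hD.der x).eq_const

/-- Constant fields have zero derivatives, so commuting with them is directional differentiation. It
turns the identities among `δ` and `q` into identities of operations on `V`. -/
theorem bracket_const (h : IsParity G P₀ P₁) {p : ℤ} {D : FormalVF K V}
    (hD : D ∈ homogeneous G p) (v : V) : bracket P₀ P₁ D (const v) = der v D := by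
  induction v using h.induction with
  | add x y hx hy => rw [map_add, map_add, hx, hy, map_add, LinearMap.add_apply]
  | hom s v hv =>
    funext n
    induction n generalizing p D with
    | zero =>
      refine component_zero_ext ?_
      rw [ev_bracket_of_mem h hD (const_mem hv)]
      simp
    | succ n ih =>
      refine component_ext h fun q x hx => ?_
      rw [der_bracket_of_mem h hx (const_mem hv), der_const, map_zero, zero_add,
        der_comm hx hv hD, Pi.smul_apply, Pi.smul_apply, ih (der_mem hx hD)]

theorem const_bracket (h : IsParity G P₀ P₁) {p s : ℤ} {D : FormalVF K V}
    (hD : D ∈ homogeneous G p) {v : V} (hv : v ∈ G s) :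
    bracket P₀ P₁ (const v) D = -((s * p).negOnePow • der v D) := by
  rw [bracket_antisymm h (const_mem hv) hD, bracket_const h hD]

end FormalVF

open FormalVF

/-- A linear vector field `δ` with `[δ, δ] = 0` and a quadratic vector field `R` of degree `0` such
that `exp (ad R) δ = δ + [R, δ]`. -/
structure IsGaugePair (G : ℤ → Submodule K V) (P₀ P₁ : V →ₗ[K] V) (R δ : FormalVF K V) :
    Prop where
  parity : IsParity G P₀ P₁
  isInternal : DirectSum.IsInternal G
  R_mem : R ∈ homogeneous G 0
  R_pure : IsPure 2 R
  δ_mem : δ ∈ homogeneous G 1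
  δ_pure : IsPure 1 δ
  δ_δ : bracket P₀ P₁ δ δ = 0
  R_R_δ : bracket P₀ P₁ R (bracket P₀ P₁ R δ) = 0

namespace IsGaugePair

variable {G : ℤ → Submodule K V} {P₀ P₁ : V →ₗ[K] V} {R δ q : FormalVF K V}
  (H : IsGaugePair G P₀ P₁ R δ) (hq : q = bracket P₀ P₁ R δ)

include H hq

theorem q_mem : q ∈ homogeneous G 1 := by
  subst hq
  simpa using bracket_mem H.parity H.R_mem H.δ_mem

theorem q_pure : IsPure 2 q := by
  subst hq
  exact H.R_pure.bracket H.δ_pure rfl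

variable [CharZero K]

omit H hq in
theorem eq_zero_of_add_self {D : FormalVF K V} (h : D + D = 0) : D = 0 := by
  have h2 : (2 : K) • D = 0 := by rw [two_smul, h]
  exact (smul_eq_zero.1 h2).resolve_left two_ne_zero

/-- Apply `ad R` to `[δ, δ] = 0`; the result is twice `[δ, q]`. -/
theorem δ_q : bracket P₀ P₁ δ q = 0 := by
  have h := bracket_jacobi H.parity H.R_mem H.δ_mem H.δ_mem
  rw [H.δ_δ, map_zero, ← hq, bracket_antisymm H.parity (H.q_mem hq) H.δ_mem] at h
  exact eq_zero_of_add_self (by simpa using h.symm)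

/-- Apply `ad R` to `[q, δ] = 0` and use `[R, q] = 0`. -/
theorem q_q : bracket P₀ P₁ q q = 0 := by
  have h := bracket_jacobi H.parity H.R_mem (H.q_mem hq) H.δ_mem
  rw [bracket_antisymm H.parity (H.q_mem hq) H.δ_mem, H.δ_q hq, ← hq] at h
  have h' : bracket P₀ P₁ R q = 0 := by
    rw [hq]
    exact H.R_R_δ
  simpa [h'] using h.symm

omit hq in
theorem δ_δ_apply {p : ℤ} {D : FormalVF K V} (hD : D ∈ homogeneous G p) :
    bracket P₀ P₁ δ (bracket P₀ P₁ δ D) = 0 := by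
  have h := bracket_jacobi H.parity H.δ_mem H.δ_mem hD
  rw [H.δ_δ, map_zero, LinearMap.zero_apply, zero_add] at h
  refine eq_zero_of_add_self ?_
  nth_rewrite 1 [h]
  simp

theorem δ_der_q {a : ℤ} {x : V} (hx : x ∈ G a) :
    bracket P₀ P₁ δ (der x q) = -der (ev (der x δ)) q := by
  have h := congrArg (der x) (H.δ_q hq)
  have hdx : ev (der x δ) ∈ G (1 + a) := ev_mem (der_mem hx H.δ_mem)
  rw [map_zero, der_bracket_of_mem H.parity hx (H.q_mem hq), H.δ_pure.der_eq_const,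
    const_bracket H.parity (H.q_mem hq) hdx, add_eq_zero_iff_eq_neg] at h
  rw [h, mul_one, mul_one, Int.negOnePow_add]
  rcases Int.units_eq_one_or a.negOnePow with e | e <;> simp [e]

theorem q_der_q {a : ℤ} {x : V} (hx : x ∈ G a) : bracket P₀ P₁ q (der x q) = 0 := by
  have h := congrArg (der x) (H.q_q hq)
  rw [map_zero, der_bracket_of_mem H.parity hx (H.q_mem hq),
    bracket_antisymm H.parity (der_mem hx (H.q_mem hq)) (H.q_mem hq)] at h
  refine eq_zero_of_add_self (h ▸ ?_)
  rw [mul_one, mul_one, Int.negOnePow_add]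
  rcases Int.units_eq_one_or a.negOnePow with e | e <;> simp [e]

omit [CharZero K] in
theorem der_der_q (x y : V) : der y (der x q) = const (ev (der y (der x q))) :=
  ((H.q_pure hq).der x).der_eq_const y

/-- A second derivative of `[q, q] = 0`: the fields `∂q/∂x` form the adjoint representation. -/
theorem der_q_der_q {a b : ℤ} {x y : V} (hx : x ∈ G a) (hy : y ∈ G b) :
    bracket P₀ P₁ (der x q) (der y q) =
      -(a.negOnePow • der (ev (der y (der x q))) q) := by
  have hqx := der_mem hx (H.q_mem hq)
  have hqy := der_mem hy (H.q_mem hq)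
  have h := congrArg (der y) (H.q_der_q hq hx)
  rw [map_zero, der_bracket_of_mem H.parity hy hqx, H.der_der_q hq,
    bracket_const H.parity (H.q_mem hq), bracket_antisymm H.parity hqy hqx,
    add_eq_zero_iff_eq_neg] at h
  rw [h]
  simp only [mul_add, add_mul, Int.negOnePow_add, mul_one, one_mul, mul_comm b a]
  rcases Int.units_eq_one_or a.negOnePow with e | e <;>
  rcases Int.units_eq_one_or b.negOnePow with e' | e' <;>
  rcases Int.units_eq_one_or (a * b).negOnePow with e'' | e'' <;> simp [e, e', e'']

/-- The Leibniz rule in symmetric form, from the derivatives of `[δ, q] = 0` in the directions `x`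
and `y`. -/
theorem d_q {a b : ℤ} {x y : V} (hx : x ∈ G a) (hy : y ∈ G b) :
    ev (der (ev (der y (der x q))) δ) =
      -ev (der y (der (ev (der x δ)) q)) -
        a.negOnePow • ev (der (ev (der y δ)) (der x q)) := by
  have hqx := der_mem hx (H.q_mem hq)
  have hdy : ev (der y δ) ∈ G (1 + b) := ev_mem (der_mem hy H.δ_mem)
  have h := congrArg (fun D => ev (der y D)) (H.δ_der_q hq hx)
  rw [der_bracket_of_mem H.parity hy hqx, H.der_der_q hq, bracket_const H.parity H.δ_mem,
    H.δ_pure.der_eq_const y, const_bracket H.parity hqx hdy, map_add, map_neg, map_neg] at h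
  rw [← h]
  simp only [map_neg, map_zsmul_unit, mul_add, add_mul, Int.negOnePow_add, mul_one, one_mul]
  rcases Int.units_eq_one_or a.negOnePow with e | e <;>
  rcases Int.units_eq_one_or b.negOnePow with e' | e' <;>
  rcases Int.units_eq_one_or (b * a).negOnePow with e'' | e'' <;> simp [e, e', e'']

/-- The Jacobi identity in symmetric form, from three derivatives of `[q, q] = 0`. -/
theorem q_q_apply {a b c : ℤ} {x y z : V} (hx : x ∈ G a) (hy : y ∈ G b) (hz : z ∈ G c) :
    ev (der z (der (ev (der y (der x q))) q)) =
      -(a.negOnePow • ev (der (ev (der z (der y q))) (der x q))) -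
        (b + a * b).negOnePow • ev (der (ev (der z (der x q))) (der y q)) := by
  have hqx := der_mem hx (H.q_mem hq)
  have hqy := der_mem hy (H.q_mem hq)
  have hyz : ev (der z (der y q)) ∈ G _ := ev_mem (der_mem hz hqy)
  have hxz : ev (der z (der x q)) ∈ G _ := ev_mem (der_mem hz hqx)
  have h := congrArg (fun D => ev (der z D)) (H.der_q_der_q hq hx hy)
  rw [der_bracket_of_mem H.parity hz hqy, H.der_der_q hq y z, H.der_der_q hq x z,
    bracket_const H.parity hqx, const_bracket H.parity hqy hxz] at h
  simp only [map_neg, map_add, map_zsmul_unit, mul_add, add_mul, Int.negOnePow_add, mul_one,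
    one_mul] at h
  rw [Int.negOnePow_add]
  rcases Int.units_eq_one_or a.negOnePow with e | e <;>
  rcases Int.units_eq_one_or b.negOnePow with e' | e' <;>
  rcases Int.units_eq_one_or c.negOnePow with e₁ | e₁ <;>
  rcases Int.units_eq_one_or (c * b).negOnePow with e₂ | e₂ <;>
  rcases Int.units_eq_one_or (a * b).negOnePow with e'' | e'' <;>
  · simp only [Int.negOnePow_one, e, e', e'', e₁, e₂, one_smul, Units.neg_smul, mul_one, mul_neg,
      neg_neg] at h ⊢
    first
    | rw [← h]; abel
    | rw [← neg_neg (ev (der z (der (ev (der y (der x q))) q))), ← h]; abel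

omit [CharZero K] in
theorem ev_der_comm {a b : ℤ} {x y : V} (hx : x ∈ G a) (hy : y ∈ G b) :
    ev (der x (der y q)) = (a * b).negOnePow • ev (der y (der x q)) := by
  rw [der_comm hx hy (H.q_mem hq), map_zsmul_unit]

omit [CharZero K] in
theorem ev_der_der_mem {a b : ℤ} {x y : V} (hx : x ∈ G a) (hy : y ∈ G b) :
    ev (der y (der x q)) ∈ G (1 + a + b) :=
  ev_mem (der_mem hy (der_mem hx (H.q_mem hq)))

/-- The differential graded Lie algebra with bracket `(-1) ^ p q(x, y)`, for `x` of degree `p`. -/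
def dgla : DGLA K V where
  -- The graded symmetric operation `q` has degree `1` on `G`; the shift by one, with the sign in
  -- the bracket, makes it graded antisymmetric of degree `0`.
  gr n := G (n - 1)
  isInternal := by
    let _ := H.isInternal.chooseDecomposition
    let π : ℤ → V →ₗ[K] V := fun n => (G n).subtype ∘ₗ DirectSum.component K ℤ (fun i => G i) n ∘ₗ
      (DirectSum.decomposeLinearEquiv G).toLinearMap
    refine DGLA.isInternal_of_proj _ (fun n => π (n - 1)) ?_ ?_ ?_
    · exact fun n x hx => DirectSum.decompose_of_mem_same G hx
    · exact fun m n h x hx => DirectSum.decompose_of_mem_ne G hx (by omega)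
    · intro x
      induction x using H.parity.induction with
      | add x y hx hy => exact Submodule.add_mem _ hx hy
      | hom n x hx => exact Submodule.mem_iSup_of_mem (n + 1) (by simpa using hx)
  d := ev ∘ₗ der.flip δ
  bracket := LinearMap.mk₂ K (fun x y => ev (der y (der ((P₀ - P₁) x) q)))
    (fun _ _ _ => by simp only [map_add, LinearMap.add_apply])
    (fun _ _ _ => by simp only [map_smul, LinearMap.smul_apply])
    (fun _ _ _ => by simp only [map_add, LinearMap.add_apply])
    (fun _ _ _ => by simp only [map_smul, LinearMap.smul_apply])
  d_mem := fun {n x} hx => by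
    have := ev_mem (der_mem hx H.δ_mem)
    rwa [show 1 + (n - 1) = n + 1 - 1 by ring] at this
  d_d := fun x => by
    induction x using H.parity.induction with
    | add x y hx hy => rw [map_add, map_add, hx, hy, add_zero]
    | hom n x hx =>
      have h := congrArg ev (H.δ_δ_apply (const_mem hx))
      rwa [bracket_const H.parity H.δ_mem, H.δ_pure.der_eq_const,
        bracket_const H.parity H.δ_mem] at h
  bracket_mem := fun {p s x y} hx hy => by
    have := H.ev_der_der_mem hq hx hy
    rw [show 1 + (p - 1) + (s - 1) = p + s - 1 by ring] at this
    rw [LinearMap.mk₂_apply, H.parity.sub_apply hx]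
    simp only [map_zsmul_unit, LinearMap.smul_apply]
    rcases Int.units_eq_one_or (p - 1).negOnePow with e | e <;> simpa [e] using this
  antisymm := fun {p s x y} hx hy => by
    rw [LinearMap.mk₂_apply, LinearMap.mk₂_apply, H.parity.sub_apply hx, H.parity.sub_apply hy]
    simp only [map_zsmul_unit, LinearMap.smul_apply]
    rw [H.ev_der_comm hq hy hx]
    simp only [sub_mul, mul_sub, Int.negOnePow_sub, mul_one, one_mul, Int.negOnePow_one,
      mul_comm s p]
    rcases Int.units_eq_one_or p.negOnePow with e | e <;>
    rcases Int.units_eq_one_or s.negOnePow with e' | e' <;>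
    rcases Int.units_eq_one_or (p * s).negOnePow with e'' | e'' <;> simp [e, e', e'']
  leibniz := fun {p x} y hx => by
    induction y using H.parity.induction with
    | add y z hy hz => simp only [map_add, hy, hz, smul_add]; abel
    | hom s y hy =>
      have hdx := ev_mem (der_mem hx H.δ_mem)
      simp only [LinearMap.mk₂_apply, LinearMap.comp_apply, LinearMap.flip_apply]
      rw [H.parity.sub_apply hx, H.parity.sub_apply hdx]
      simp only [map_zsmul_unit, LinearMap.smul_apply]
      rw [H.d_q hq hx hy]
      simp only [Int.negOnePow_add, Int.negOnePow_sub, Int.negOnePow_one]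
      rcases Int.units_eq_one_or p.negOnePow with e | e <;> simp [e] <;> abel
  jacobi := fun {p s x y} z hx hy => by
    induction z using H.parity.induction with
    | add z t hz ht => simp only [map_add, hz, ht, smul_add]; abel
    | hom r z hz =>
      have hxy := H.ev_der_der_mem hq hx hy
      simp only [LinearMap.mk₂_apply]
      rw [H.parity.sub_apply hx, H.parity.sub_apply hy]
      simp only [map_zsmul_unit, LinearMap.smul_apply]
      rw [H.parity.sub_apply hxy]
      simp only [map_zsmul_unit, LinearMap.smul_apply]
      rw [H.q_q_apply hq hx hy hz]
      simp only [Int.negOnePow_add, Int.negOnePow_sub, Int.negOnePow_one, sub_mul, mul_sub,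
        mul_one, one_mul]
      rcases Int.units_eq_one_or p.negOnePow with e | e <;>
      rcases Int.units_eq_one_or s.negOnePow with e' | e' <;>
      rcases Int.units_eq_one_or (p * s).negOnePow with e'' | e'' <;>
      simp [e, e', e''] <;> abel

end IsGaugePair

end QuadraticVectorFields

/-! ### The algebra of vector fields preserving a subspace -/

section GaugeTrivial

variable {K : Type u} {V : Type v} [Field K] [AddCommGroup V] [Module K V]

open FormalVF

namespace IsGaugePair

variable {G : ℤ → Submodule K V} {P₀ P₁ : V →ₗ[K] V} {R δ q : FormalVF K V}
  (H : IsGaugePair G P₀ P₁ R δ) (hq : q = bracket P₀ P₁ R δ) [CharZero K]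

theorem mem_dgla_gr {n : ℤ} {x : V} : x ∈ (H.dgla hq).gr n ↔ x ∈ G (n - 1) := Iff.rfl

theorem dgla_bracket_of_mem {a : ℤ} {x : V} (hx : x ∈ G a) (y : V) :
    (H.dgla hq).bracket x y = a.negOnePow • ev (der y (der x q)) := by
  change ev (der y (der ((P₀ - P₁) x) q)) = _
  rw [H.parity.sub_apply hx]
  simp only [map_zsmul_unit, LinearMap.smul_apply]

include H in
-- At the origin this is independence of the grading of `V`, whose projections are borrowed from
-- `dgla`. A derivative shifts all degrees by the same amount, which the offset `c` records.
theorem eq_zero_of_sum_eq_zero {n : ℕ} {c : ℤ} {s : Finset ℤ} {f : ℤ → FormalVF K V}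
    (hf : ∀ p ∈ s, IsHomogeneousAt G n (p + c) (f p)) (hs : (∑ p ∈ s, f p) n = 0) :
    ∀ p ∈ s, f p n = 0 := by
  induction n generalizing c f with
  | zero =>
    intro p hp
    rw [component_zero_eq_zero_iff] at hs ⊢
    have h1 : ∀ m ∈ s, m ≠ p → (H.dgla rfl).proj (p + c + 1) (ev (f m)) = 0 := fun m hms hm =>
      (H.dgla rfl).proj_ne (m := m + c + 1) (by omega)
        ((H.mem_dgla_gr rfl).2 (show ev (f m) ∈ _ by simpa using (show ev (f m) ∈ G (m + c) from hf m hms)))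
    have h2 : (H.dgla rfl).proj (p + c + 1) (ev (f p)) = ev (f p) :=
      (H.dgla rfl).proj_same ((H.mem_dgla_gr rfl).2 (show ev (f p) ∈ _ by simpa using (show ev (f p) ∈ G (p + c) from hf p hp)))
    have h3 := congrArg ((H.dgla rfl).proj (p + c + 1)) hs
    rwa [map_sum, map_sum, Finset.sum_eq_single_of_mem p hp h1, h2,
      map_zero] at h3
  | succ n ih =>
    intro p hp
    refine component_ext (E := 0) H.parity fun t x hx => ?_
    rw [map_zero]
    refine ih (c := c + t) (f := fun p => der x (f p)) (fun p hp => ?_) ?_ p hp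
    · rw [← add_assoc]
      exact (hf p hp).1 t x hx
    · rw [← map_sum]
      exact component_eq_zero_iff.1 hs x

variable (G) in
/-- The homogeneous vector fields that preserve a subspace. -/
def fieldsDeg (B : Submodule K V) (p : ℤ) : Submodule K (FormalVF K V) :=
  homogeneous G p ⊓ preserving B

variable (G) in
/-- The finite sums of homogeneous vector fields that preserve a subspace. -/
def fields (B : Submodule K V) : Submodule K (FormalVF K V) := ⨆ p, fieldsDeg G B p

omit [CharZero K] in
theorem fieldsDeg_le (B : Submodule K V) (p : ℤ) : fieldsDeg G B p ≤ fields G B := le_iSup _ p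

omit [CharZero K] in
theorem fields_induction {B : Submodule K V} {P : fields G B → Prop}
    (hom : ∀ p D (hD : D ∈ fieldsDeg G B p), P ⟨D, fieldsDeg_le B p hD⟩)
    (add : ∀ D E, P D → P E → P (D + E)) (D : fields G B) : P D := by
  obtain ⟨D, hD⟩ := D
  refine Submodule.iSup_induction' (fieldsDeg G B) (motive := fun D hD => P ⟨D, hD⟩) hom ?_ ?_ hD
  · exact hom 0 0 (Submodule.zero_mem _)
  · exact fun D E hD hE h h' => add ⟨D, hD⟩ ⟨E, hE⟩ h h'

omit [CharZero K] in
theorem fields_le_preserving (B : Submodule K V) : fields G B ≤ preserving B :=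
  iSup_le fun _ => inf_le_right

include H

/-- An arbitrary formal field need not be a finite sum of homogeneous ones, hence the restriction to
`fields`; independence is tested on each Taylor coefficient. -/
theorem isInternal_fields (B : Submodule K V) :
    DirectSum.IsInternal fun p => (fieldsDeg G B p).submoduleOf (fields G B) := by
  rw [DirectSum.isInternal_submodule_iff_iSupIndep_and_iSup_eq_top,
    iSupIndep_iff_finsetSum_eq_zero_imp_eq_zero]
  refine ⟨fun s f hfF hf p hp => Subtype.ext ?_, eq_top_iff.2 fun D hD => ?_⟩
  · have hsum := congrArg (fields G B).subtype hf
    rw [map_sum, map_zero] at hsum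
    refine funext fun n => ?_
    exact H.eq_zero_of_sum_eq_zero (c := 0) (s := s) (f := fun p => (f p : FormalVF K V))
      (fun p hp => by simpa using (hfF p hp).1 n) (congrFun hsum n) p hp
  · clear hD
    induction D using fields_induction with
    | hom p D hD => exact Submodule.mem_iSup_of_mem p hD
    | add D E hD hE => exact Submodule.add_mem _ hD hE

variable {B : Submodule K V} (hδ : δ ∈ preserving B)
  (hB : ∀ n, ∀ x ∈ B, (H.dgla hq).proj n x ∈ B)
include hB

theorem parity_mem {x : V} (hx : x ∈ B) : P₀ x ∈ B ∧ P₁ x ∈ B := by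
  obtain ⟨s, hs⟩ := (H.dgla hq).exists_sum_proj x
  rw [← hs, map_sum, map_sum]
  have key : ∀ n, P₀ ((H.dgla hq).proj n x) ∈ B ∧ P₁ ((H.dgla hq).proj n x) ∈ B := fun n => by
    have h1 : (H.dgla hq).proj n x ∈ G (n - 1) := (H.dgla hq).proj_mem n x
    rcases Int.even_or_odd (n - 1) with hn | hn
    · rw [(H.parity.even h1 hn).1, (H.parity.even h1 hn).2]
      exact ⟨hB n x hx, Submodule.zero_mem _⟩
    · rw [(H.parity.odd h1 hn).1, (H.parity.odd h1 hn).2]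
      exact ⟨Submodule.zero_mem _, hB n x hx⟩
  exact ⟨Submodule.sum_mem _ fun n _ => (key n).1, Submodule.sum_mem _ fun n _ => (key n).2⟩

theorem bracket_mem_fieldsDeg {p s : ℤ} {D E : FormalVF K V} (hD : D ∈ fieldsDeg G B p)
    (hE : E ∈ fieldsDeg G B s) : bracket P₀ P₁ D E ∈ fieldsDeg G B (p + s) :=
  ⟨bracket_mem H.parity hD.1 hE.1, bracket_mem_preserving (fun _ hx => (H.parity_mem hq hB hx).1)
    (fun _ hx => (H.parity_mem hq hB hx).2) hD.2 hE.2⟩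

theorem bracket_mem_fields (D E : fields G B) :
    bracket P₀ P₁ (D : FormalVF K V) E ∈ fields G B := by
  induction D using fields_induction with
  | add D D' hD hD' => simpa using Submodule.add_mem _ hD hD'
  | hom p D hD =>
    induction E using fields_induction with
    | add E E' hE hE' => simpa using Submodule.add_mem _ hE hE'
    | hom s E hE => exact fieldsDeg_le B _ (H.bracket_mem_fieldsDeg hq hB hD hE)

include hδ

omit hB in
omit [CharZero K] in
theorem δ_mem_fields : δ ∈ fields G B := fieldsDeg_le B 1 ⟨H.δ_mem, hδ⟩

/-- The differential graded Lie algebra of vector fields preserving a subspace, with differential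
`-[δ, ·]`. -/
def fieldsDGLA : DGLA K (fields G B) where
  gr p := (fieldsDeg G B p).submoduleOf (fields G B)
  isInternal := H.isInternal_fields B
  -- The minus sign matches the cone differential `(x, y) ↦ (d x + y, -d y)`, since `[δ, const y]`
  -- is the constant `d y`.
  d := -(bracket P₀ P₁ δ).restrict fun D hD =>
    H.bracket_mem_fields hq hB ⟨δ, H.δ_mem_fields hδ⟩ ⟨D, hD⟩
  bracket := LinearMap.mk₂ K
    (fun D E => ⟨bracket P₀ P₁ (D : FormalVF K V) E, H.bracket_mem_fields hq hB D E⟩)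
    (fun _ _ _ => Subtype.ext (by simp)) (fun _ _ _ => Subtype.ext (by simp))
    (fun _ _ _ => Subtype.ext (by simp)) (fun _ _ _ => Subtype.ext (by simp))
  d_mem := fun {p D} hD => by
    have := H.bracket_mem_fieldsDeg hq hB ⟨H.δ_mem, hδ⟩ hD
    rw [add_comm] at this
    exact Submodule.neg_mem _ this
  d_d := fun D => by
    induction D using fields_induction with
    | add D E hD hE => rw [map_add, map_add, hD, hE, add_zero]
    | hom p D hD =>
      apply Subtype.ext
      change -bracket P₀ P₁ δ (-bracket P₀ P₁ δ D) = 0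
      rw [map_neg, neg_neg, H.δ_δ_apply hD.1]
  bracket_mem := fun hD hE => H.bracket_mem_fieldsDeg hq hB hD hE
  antisymm := fun hD hE => Subtype.ext (bracket_antisymm H.parity hD.1 hE.1)
  leibniz := fun {p D} E hD => by
    induction E using fields_induction with
    | add E F hE hF => simp only [map_add, hE, hF, smul_add]; abel
    | hom s E hE =>
      have hD' : (D : FormalVF K V) ∈ homogeneous G p := hD.1
      apply Subtype.ext
      change -bracket P₀ P₁ δ (bracket P₀ P₁ (D : FormalVF K V) E) =
        bracket P₀ P₁ (-bracket P₀ P₁ δ (D : FormalVF K V)) E +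
          p.negOnePow • bracket P₀ P₁ (D : FormalVF K V) (-bracket P₀ P₁ δ E)
      rw [bracket_jacobi H.parity H.δ_mem hD' hE.1, one_mul, map_neg, map_neg,
        LinearMap.neg_apply, smul_neg]
      abel
  jacobi := fun {p s D E} F hD hE => by
    induction F using fields_induction with
    | add F F' hF hF' => simp only [map_add, hF, hF', smul_add]; abel
    | hom r F hF => exact Subtype.ext (bracket_jacobi H.parity hD.1 hE.1 hF.1)

theorem isSub_dgla (hR : R ∈ preserving B) : (H.dgla hq).IsSub B where
  proj_mem := hB
  d_mem := fun x hx => ev_mem_of_preserving (der_mem_preserving hx hδ)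
  bracket_mem := fun x hx y hy => by
    have h := H.parity_mem hq hB hx
    have hqB : q ∈ preserving B := by
      rw [hq]
      exact bracket_mem_preserving (fun _ hx => (H.parity_mem hq hB hx).1)
        (fun _ hx => (H.parity_mem hq hB hx).2) hR hδ
    exact ev_mem_of_preserving (der_mem_preserving hy
      (der_mem_preserving (Submodule.sub_mem _ h.1 h.2) hqB))

omit hB hδ
include hq

/-- `exp (-ad R)` intertwines `[δ + q, ·]` and `[δ, ·]`. -/
theorem δ_expAd {p : ℤ} {D : FormalVF K V} (hD : D ∈ homogeneous G p) :
    bracket P₀ P₁ δ (expAd P₀ P₁ (-R) D) =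
      expAd P₀ P₁ (-R) (bracket P₀ P₁ δ D + bracket P₀ P₁ q D) := by
  have h0 : (-R) 0 = 0 := by simp [H.R_pure 0 (by omega)]
  have h1 : (-R) 1 = 0 := by simp [H.R_pure 1 (by omega)]
  have hR : -R ∈ homogeneous G 0 := Submodule.neg_mem _ H.R_mem
  -- Gauge triviality: `[-R, δ] = -q` and `[-R, q] = 0`.
  have hδq : expAd P₀ P₁ (-R) (δ + q) = δ := by
    refine expAd_of_bracket_eq h0 h1 ?_ ?_
    · rw [map_neg, LinearMap.neg_apply, hq]
    · rw [map_neg, LinearMap.neg_apply, hq, H.R_R_δ, neg_zero]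
  have h := expAd_bracket h0 h1 H.parity hR
    (Submodule.add_mem _ H.δ_mem (H.q_mem hq)) hD
  rw [hδq, map_add, LinearMap.add_apply] at h
  exact h.symm

omit hq

omit [CharZero K] in
/-- The bracket of cocycles is exact. -/
theorem bracket_mem_range_of_mem (hRB : R ∈ preserving B) {a b : ℤ} {x y : V} (hx : x ∈ G a)
    (hy : y ∈ G b) (hxB : x ∈ B) (hyB : y ∈ B) (hdx : ev (der x δ) = 0) (hdy : ev (der y δ) = 0) :
    ∃ z ∈ B, ev (der y (der x (bracket P₀ P₁ R δ))) = ev (der z δ) := by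
  have hRx := der_mem hx H.R_mem
  have hz := ev_mem (der_mem hy hRx)
  -- On cocycles the terms of `[R, δ](x, y)` in which `δ` is applied to `x` or `y` drop out, leaving
  -- `-d (R(x, y))`.
  refine ⟨-ev (der y (der x R)), ?_, ?_⟩
  · have := ev_mem_of_preserving (der_mem_preserving hyB (der_mem_preserving hxB hRB))
    exact Submodule.neg_mem _ this
  · have hδx : der x δ = 0 := by rw [H.δ_pure.der_eq_const, hdx, map_zero]
    have hδy : der y δ = 0 := by rw [H.δ_pure.der_eq_const, hdy, map_zero]
    rw [der_bracket_of_mem H.parity hx H.δ_mem, hδx, map_zero, zero_add, map_zsmul_unit,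
      der_bracket_of_mem H.parity hy H.δ_mem, hδy, map_zero, zero_add,
      (H.R_pure.der x).der_eq_const, const_bracket H.parity H.δ_mem hz]
    simp only [map_neg, map_zsmul_unit, LinearMap.neg_apply, mul_one,
      Int.negOnePow_add, zero_add]
    rcases Int.units_eq_one_or a.negOnePow with e | e <;>
    rcases Int.units_eq_one_or b.negOnePow with e' | e' <;> simp [e, e']

end IsGaugePair

end GaugeTrivial

/-! ### The cone mapped into vector fields -/

section GaugeTrivialFormal

variable {K : Type u} {V : Type v} [Field K] [AddCommGroup V] [Module K V]

open FormalVF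

namespace IsGaugePair

variable {G : ℤ → Submodule K V} {P₀ P₁ : V →ₗ[K] V} {R δ q : FormalVF K V}
  (H : IsGaugePair G P₀ P₁ R δ) (hq : q = bracket P₀ P₁ R δ)

variable (P₀ P₁ R q) in
/-- The vector field `exp (-ad R) (y - ∂q/∂x)`. -/
noncomputable def coneField : V × V →ₗ[K] FormalVF K V :=
  expAd P₀ P₁ (-R) ∘ₗ (const ∘ₗ LinearMap.snd K V V - der.flip q ∘ₗ LinearMap.fst K V V)

theorem coneField_apply (x y : V) :
    coneField P₀ P₁ R q (x, y) = expAd P₀ P₁ (-R) (const y - der x q) := rfl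

include H

theorem neg_R_zero : (-R) 0 = 0 := by simp [H.R_pure 0 (by omega)]

theorem neg_R_one : (-R) 1 = 0 := by simp [H.R_pure 1 (by omega)]

theorem ev_δ : ev δ = 0 := component_zero_eq_zero_iff.1 (H.δ_pure 0 (by omega))

include hq

theorem const_sub_der_mem {p : ℤ} {x y : V} (hx : x ∈ G (p - 1)) (hy : y ∈ G p) :
    const y - der x q ∈ homogeneous G p := by
  refine Submodule.sub_mem _ (const_mem hy) ?_
  simpa using der_mem hx (H.q_mem hq)

theorem ev_coneField (x y : V) : ev (coneField P₀ P₁ R q (x, y)) = y := by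
  have hz : ev (der x q) = 0 := component_zero_eq_zero_iff.1 ((H.q_pure hq).der x 0 (by omega))
  rw [coneField_apply, ev_expAd, map_sub, ev_const, hz, sub_zero]

theorem coneField_mem {p : ℤ} {x y : V} (hx : x ∈ G (p - 1)) (hy : y ∈ G p) :
    coneField P₀ P₁ R q (x, y) ∈ homogeneous G p :=
  expAd_mem H.neg_R_zero H.neg_R_one H.parity (Submodule.neg_mem _ H.R_mem)
    (H.const_sub_der_mem hq hx hy)

variable [CharZero K]

/-- Pull the bracket inside the exponential, where `δ` becomes `δ + q`. There `[δ + q, y - ∂q/∂x] =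
d y + ∂q/∂y + ∂q/∂(d x)`, by the first derivatives of `[δ, q] = 0` and `[q, q] = 0`. -/
theorem δ_coneField {p : ℤ} {x y : V} (hx : x ∈ G (p - 1)) (hy : y ∈ G p) :
    bracket P₀ P₁ δ (coneField P₀ P₁ R q (x, y)) =
      -coneField P₀ P₁ R q (ev (der x δ) + y, -ev (der y δ)) := by
  rw [coneField_apply, H.δ_expAd hq (H.const_sub_der_mem hq hx hy), coneField_apply, ← map_neg,
    map_sub, map_sub, bracket_const H.parity H.δ_mem, bracket_const H.parity (H.q_mem hq),
    H.δ_der_q hq hx, H.q_der_q hq hx, H.δ_pure.der_eq_const y]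
  congr 1
  simp only [map_add, map_neg, LinearMap.add_apply, ev_const]
  abel

/-- The exponential is multiplicative, so only the fields `y - ∂q/∂x` matter: constants commute, a
constant against `∂q/∂x` gives a constant bracket, and two fields `∂q/∂x` compose by `der_q_der_q`.
-/
theorem bracket_coneField {p s : ℤ} {x y x' y' : V} (hx : x ∈ G (p - 1)) (hy : y ∈ G p)
    (hx' : x' ∈ G (s - 1)) (hy' : y' ∈ G s) :
    coneField P₀ P₁ R q ((H.dgla hq).bracket x x',
      (H.dgla hq).bracket y x' + p.negOnePow • (H.dgla hq).bracket x y') =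
    bracket P₀ P₁ (coneField P₀ P₁ R q (x, y)) (coneField P₀ P₁ R q (x', y')) := by
  have hqx := der_mem hx (H.q_mem hq)
  have hqx' := der_mem hx' (H.q_mem hq)
  have h := const_bracket H.parity hqx' hy
  rw [der_comm hy hx' (H.q_mem hq), H.der_der_q hq] at h
  rw [coneField_apply, coneField_apply, coneField_apply,
    ← expAd_bracket H.neg_R_zero H.neg_R_one H.parity (Submodule.neg_mem _ H.R_mem)
      (H.const_sub_der_mem hq hx hy) (H.const_sub_der_mem hq hx' hy'),
    map_sub (bracket P₀ P₁), LinearMap.sub_apply, map_sub (bracket P₀ P₁ (const y)),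
    map_sub (bracket P₀ P₁ (der x q)), bracket_const H.parity (const_mem hy), der_const, h,
    bracket_const H.parity hqx, H.der_der_q hq x y', H.der_q_der_q hq hx hx',
    H.dgla_bracket_of_mem hq hx, H.dgla_bracket_of_mem hq hx, H.dgla_bracket_of_mem hq hy]
  congr 1
  simp only [map_add, map_zsmul_unit, LinearMap.smul_apply, Int.negOnePow_sub,
    mul_sub, mul_one, add_sub_cancel, Int.negOnePow_one]
  rcases Int.units_eq_one_or p.negOnePow with e | e <;>
  rcases Int.units_eq_one_or (p * s).negOnePow with e' | e' <;>
  · simp [e, e']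
    abel

variable {B : Submodule K V} (hδ : δ ∈ preserving B) (hR : R ∈ preserving B)
  (hB : ∀ n, ∀ x ∈ B, (H.dgla hq).proj n x ∈ B)
include hδ hR hB

theorem coneField_mem_fieldsDeg {p : ℤ} {x y : V} (hx : x ∈ G (p - 1)) (hy : y ∈ G p)
    (hxB : x ∈ B) (hyB : y ∈ B) : coneField P₀ P₁ R q (x, y) ∈ fieldsDeg G B p := by
  have h₀ := fun x hx => (H.parity_mem hq hB (x := x) hx).1
  have h₁ := fun x hx => (H.parity_mem hq hB (x := x) hx).2
  have hqB : q ∈ preserving B := hq ▸ bracket_mem_preserving h₀ h₁ hR hδ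
  exact ⟨H.coneField_mem hq hx hy, expAd_mem_preserving H.neg_R_zero H.neg_R_one h₀ h₁
    (Submodule.neg_mem _ hR) (Submodule.sub_mem _ (const_mem_preserving hyB)
      (der_mem_preserving hxB hqB))⟩

/-- The criterion `isFormal_of_cone`, with evaluation at the origin as `e`, its kernel as `S`,
`coneField` as `κ` and constant fields as `c`. -/
theorem isFormal_dgla : ((H.dgla hq).restrict (H.isSub_dgla hq hδ hB hR)).IsFormal := by
  set 𝓛 := (H.dgla hq).restrict (H.isSub_dgla hq hδ hB hR)
  set 𝓜 := H.fieldsDGLA hq hδ hB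
  have gr_iff : ∀ {n : ℤ} {x : B}, x ∈ 𝓛.gr n ↔ (x : V) ∈ G (n - 1) := Iff.rfl
  have gr_iff' : ∀ {n : ℤ} {x : B}, x ∈ 𝓛.gr (n + 1) ↔ (x : V) ∈ G n := by
    intro n x
    rw [gr_iff, add_sub_cancel_right]
  let e : fields G B →ₗ[K] B := (ev ∘ₗ (fields G B).subtype).codRestrict B fun D =>
    ev_mem_of_preserving (fields_le_preserving B D.2)
  have he_gr : ∀ n, ∀ w ∈ 𝓜.gr n, e w ∈ 𝓛.gr (n + 1) := fun n w hw =>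
    gr_iff'.2 (ev_mem hw.1)
  have hed : ∀ w, e (𝓜.d w) = -𝓛.d (e w) := fun w => Subtype.ext (by
    change ev (-bracket P₀ P₁ δ (w : FormalVF K V)) = -ev (der (ev (w : FormalVF K V)) δ)
    rw [map_neg, ev_bracket, H.ev_δ]
    simp)
  have he_proj : ∀ n w, e (𝓜.proj n w) = 𝓛.proj (n + 1) (e w) := fun n w => by
    induction w using 𝓜.homogeneous_induction with
    | add w w' hw hw' => simp only [map_add, hw, hw']
    | hom p w hw =>
      by_cases hp : p = n
      · subst hp
        rw [𝓜.proj_same hw, 𝓛.proj_same (he_gr _ _ hw)]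
      · rw [𝓜.proj_ne hp hw, 𝓛.proj_ne (by omega) (he_gr _ _ hw), map_zero]
  have hS : 𝓜.IsSub (LinearMap.ker e) :=
    { proj_mem := fun n w hw => by
        rw [LinearMap.mem_ker] at hw ⊢
        rw [he_proj, hw, map_zero]
      d_mem := fun w hw => by
        rw [LinearMap.mem_ker] at hw ⊢
        rw [hed, hw, map_zero, neg_zero]
      bracket_mem := fun w hw w' hw' => by
        have h1 : ev (w : FormalVF K V) = 0 := congrArg Subtype.val hw
        have h2 : ev (w' : FormalVF K V) = 0 := congrArg Subtype.val hw'
        refine Subtype.ext ?_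
        change ev (bracket P₀ P₁ (w : FormalVF K V) w') = 0
        rw [ev_bracket, h1, h2]
        simp }
  have hκ_mem : ∀ x : B × B,
      (coneField P₀ P₁ R q ∘ₗ B.subtype.prodMap B.subtype) x ∈ fields G B := fun x => by
    induction x using 𝓛.cone.homogeneous_induction with
    | add x y hx hy => simpa only [map_add] using Submodule.add_mem _ hx hy
    | hom n x hx =>
      obtain ⟨hx, hy⟩ := 𝓛.mem_cone_gr.1 hx
      exact fieldsDeg_le B n (H.coneField_mem_fieldsDeg hq hδ hR hB hx (gr_iff'.1 hy) x.1.2 x.2.2)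
  let κ : B × B →ₗ[K] fields G B :=
    (coneField P₀ P₁ R q ∘ₗ B.subtype.prodMap B.subtype).codRestrict (fields G B) hκ_mem
  have hκ : DGLA.IsHom 𝓛.cone 𝓜 κ :=
    { map_mem := fun {n x} hx => by
        obtain ⟨hx, hy⟩ := 𝓛.mem_cone_gr.1 hx
        exact H.coneField_mem_fieldsDeg hq hδ hR hB hx (gr_iff'.1 hy) x.1.2 x.2.2
      map_d := fun x => by
        induction x using 𝓛.cone.homogeneous_induction with
        | add x y hx hy => simp only [map_add, hx, hy]
        | hom n x hx =>
          obtain ⟨x, y⟩ := x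
          obtain ⟨hx, hy⟩ := 𝓛.mem_cone_gr.1 hx
          rw [𝓛.cone_d]
          refine Subtype.ext ?_
          refine Eq.trans ?_ (congrArg Neg.neg (H.δ_coneField hq hx (gr_iff'.1 hy))).symm
          rw [neg_neg]
          rfl
      map_bracket := DGLA.map_bracket_of_homogeneous fun p s x hx x' hx' => by
        obtain ⟨x, y⟩ := x
        obtain ⟨x', y'⟩ := x'
        obtain ⟨hx, hy⟩ := 𝓛.mem_cone_gr.1 hx
        obtain ⟨hx', hy'⟩ := 𝓛.mem_cone_gr.1 hx'
        rw [𝓛.cone_bracket, 𝓛.sgn_apply hx, map_zsmul_unit]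
        refine Subtype.ext ?_
        refine Eq.trans ?_ (H.bracket_coneField hq hx (gr_iff'.1 hy) hx' (gr_iff'.1 hy'))
        rfl }
  let c : B →ₗ[K] fields G B := (const ∘ₗ B.subtype).codRestrict (fields G B) fun y => by
    induction y using 𝓛.homogeneous_induction with
    | add x y hx hy => simpa only [map_add] using Submodule.add_mem _ hx hy
    | hom n x hx => exact fieldsDeg_le B (n - 1) ⟨const_mem hx, const_mem_preserving x.2⟩
  refine DGLA.isFormal_of_cone 𝓛 𝓜 hS e (fun w => LinearMap.mem_ker.symm) hed κ hκ
    (fun x => Subtype.ext (H.ev_coneField hq _ _)) c (fun y => Subtype.ext (ev_const (K := K) (y : V))) ?_ ?_ ?_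
  · refine fun y => Subtype.ext ?_
    change -bracket P₀ P₁ δ (const (y : V)) = -const (ev (der (y : V) δ))
    rw [bracket_const H.parity H.δ_mem, ← H.δ_pure.der_eq_const]
  · exact fun n y hy => ⟨const_mem (gr_iff'.1 hy), const_mem_preserving y.2⟩
  -- Exactness of the bracket is known for homogeneous cocycles; homogeneous components of cocycles
  -- are cocycles.
  · intro x y hx hy
    obtain ⟨s, hs⟩ := 𝓛.exists_sum_proj x
    obtain ⟨t, ht⟩ := 𝓛.exists_sum_proj y
    rw [← hs, ← ht, map_sum]
    refine Submodule.sum_mem _ fun m _ => ?_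
    rw [map_sum, LinearMap.sum_apply]
    refine Submodule.sum_mem _ fun n _ => ?_
    have hxn : 𝓛.d (𝓛.proj n x) = 0 := DGLA.proj_mem_cocycles n hx
    have hym : 𝓛.d (𝓛.proj m y) = 0 := DGLA.proj_mem_cocycles m hy
    have hxG := gr_iff.1 (𝓛.proj_mem n x)
    obtain ⟨z, hz, hz'⟩ := H.bracket_mem_range_of_mem hR hxG (gr_iff.1 (𝓛.proj_mem m y))
      (𝓛.proj n x).2 (𝓛.proj m y).2 (congrArg Subtype.val hxn) (congrArg Subtype.val hym)
    have hb : 𝓛.bracket (𝓛.proj n x) (𝓛.proj m y) = (n - 1).negOnePow • 𝓛.d ⟨z, hz⟩ := by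
      refine Subtype.ext ((H.dgla_bracket_of_mem hq hxG _).trans ?_)
      rw [hq, hz']
      rfl
    rw [hb]
    rcases Int.units_eq_one_or (n - 1).negOnePow with e | e
    · rw [e, one_smul]
      exact LinearMap.mem_range_self _ _
    · rw [e, Units.neg_smul, one_smul]
      exact Submodule.neg_mem _ (LinearMap.mem_range_self _ _)

end IsGaugePair

end GaugeTrivialFormal

/-! ### The vector fields of `d`, `i` and `l` -/

section QuasiBV

open FormalVF

section Shift

variable {K : Type u} {V : Type v} [Field K] [AddCommGroup V] [Module K V]
  {G : ℤ → Submodule K V}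

theorem exists_isParity (hG : DirectSum.IsInternal G) : ∃ P₀ P₁ : V →ₗ[K] V, IsParity G P₀ P₁ := by
  let _ := hG.chooseDecomposition
  let π : (ℤ → Prop) → V →ₗ[K] V := fun S =>
    open scoped Classical in
    DirectSum.toModule K ℤ V (fun n => if S n then (G n).subtype else 0) ∘ₗ
      (DirectSum.decomposeLinearEquiv G).toLinearMap
  have hπ : ∀ (S : ℤ → Prop) (n : ℤ) (x : V), x ∈ G n →
      (S n → π S x = x) ∧ (¬ S n → π S x = 0) := fun S n x hx => by
    lift x to G n using hx
    simp only [π, LinearMap.comp_apply, LinearEquiv.coe_coe,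
      DirectSum.decomposeLinearEquiv_apply, DirectSum.decompose_coe]
    rw [← DirectSum.lof_eq_of K, DirectSum.toModule_lof]
    exact ⟨fun h => by rw [if_pos h]; rfl, fun h => by rw [if_neg h]; rfl⟩
  exact ⟨π Even, π Odd, fun hx hn => ⟨(hπ _ _ _ hx).1 hn, (hπ _ _ _ hx).2 (Int.not_odd_iff_even.2 hn)⟩,
    fun hx hn => ⟨(hπ _ _ _ hx).2 (Int.not_even_iff_odd.2 hn), (hπ _ _ _ hx).1 hn⟩,
    hG.submodule_iSup_eq_top⟩

theorem iSup_shift (c : ℤ) : ⨆ n, G (n + c) = iSup G := (Equiv.addRight c).iSup_comp (g := G)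

theorem isInternal_shift (hG : DirectSum.IsInternal G) (c : ℤ) :
    DirectSum.IsInternal fun n => G (n + c) := by
  rw [DirectSum.isInternal_submodule_iff_iSupIndep_and_iSup_eq_top] at hG ⊢
  exact ⟨hG.1.comp (add_left_injective c), (iSup_shift c).trans hG.2⟩

theorem IsParity.shift {P₀ P₁ : V →ₗ[K] V} (h : IsParity G P₀ P₁) {c : ℤ} (hc : Even c) :
    IsParity (fun n => G (n + c)) P₀ P₁ :=
  ⟨fun hx hn => h.even hx (hn.add hc), fun hx hn => h.odd hx (hn.add_even hc),
    (iSup_shift c).trans h.iSup_eq_top⟩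

end Shift

variable {K : Type u} {A : Type v} [Field K] [Ring A] [Algebra K A]
  {𝒜 : ℤ → Submodule K A} [GradedAlgebra 𝒜] {P₀ P₁ : A →ₗ[K] A} (h : IsParity 𝒜 P₀ P₁)
  {d : A →ₗ[K] A} (hA : IsDGCA 𝒜 d)
include h hA

theorem ev_der_der_koszul {n p s : ℤ} {f : A →ₗ[K] A} (hf : IsHomogeneousMap 𝒜 n f)
    (hf1 : f 1 = 0) {x y : A} (hx : x ∈ 𝒜 p) (hy : y ∈ 𝒜 s) :
    ev (der y (der x (koszul P₀ P₁ f))) =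
      f (x * y) - (n * p).negOnePow • (x * f y) - f x * y := by
  rw [der_koszul_of_mem h hx hf,
    der_koszul_of_mem h hy (hf.gradedCommutator (isHomogeneousMap_mulLeft hx)), ev_koszul]
  simp only [gradedCommutator_apply, LinearMap.mulLeft_apply, mul_one, hf1, mul_zero, smul_zero,
    sub_zero]
  rw [hA.mul_comm _ _ _ _ (hf _ _ hx) hy, add_comm n p]

theorem ev_der_koszul_d (x : A) : ev (der x (koszul P₀ P₁ d)) = d x := by
  induction x using h.induction with
  | add x y hx hy => rw [map_add, map_add, LinearMap.add_apply, map_add, hx, hy]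
  | hom p x hx =>
    rw [der_koszul_of_mem h hx hA.d_mem, ev_koszul, gradedCommutator_apply]
    simp [hA.d_one]

theorem isPure_koszul_d : IsPure 1 (koszul P₀ P₁ d) := fun m hm => by
  rcases m with _ | m
  · rw [component_zero_eq_zero_iff, ev_koszul, hA.d_one]
  · exact koszul_component_eq_zero h hA.isDiffOp (by omega)

theorem bracket_koszul_d : bracket P₀ P₁ (koszul P₀ P₁ d) (koszul P₀ P₁ d) = 0 := by
  rw [← koszul_gradedCommutator h hA.mul_comm hA.d_mem hA.d_mem]
  convert map_zero (koszul P₀ P₁)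
  ext a
  rw [gradedCommutator_apply, hA.d_d]
  simp

variable (P₀ P₁) in
/-- The quadratic part of the vector field of Koszul brackets. -/
def quadraticPart (f : A →ₗ[K] A) : FormalVF K A := Pi.single 2 (koszul P₀ P₁ f 2)

omit hA [GradedAlgebra 𝒜] in
-- Vanishing at `1` removes the constant coefficient, and order at most `2` all those above degree
-- `2`. The linear part `D` plays no further role.
theorem IsQuasiBV.exists_koszul_eq {n : ℤ} {f : A →ₗ[K] A} (hf : IsQuasiBV 𝒜 n f) :
    ∃ D : FormalVF K A, IsPure 1 D ∧ koszul P₀ P₁ f = D + quadraticPart P₀ P₁ f := by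
  refine ⟨Pi.single 1 (koszul P₀ P₁ f 1), isPure_single 1 _, funext fun m => ?_⟩
  rcases m with _ | _ | _ | m
  · refine Eq.trans (b := 0) (component_zero_eq_zero_iff.2 ?_) ?_
    · rw [ev_koszul, hf.2]
    · simp [quadraticPart]
  · simp [quadraticPart]
  · simp [quadraticPart]
  · rw [koszul_component_eq_zero h hf.1 (by omega)]
    simp [quadraticPart]

omit h hA [GradedAlgebra 𝒜] in
theorem ev_der_der_of_isPure_one {D : FormalVF K A} (hD : IsPure 1 D) (x y : A) :
    ev (der y (der x D)) = 0 := by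
  rw [hD.der_eq_const, der_const, map_zero]

variable {k : ℤ} {i l : A →ₗ[K] A} (hi : IsQuasiBV 𝒜 (-2 * k) i)
include hi

/-- The linear part of the field of `i` does not contribute to second derivatives, and the Koszul
sign is trivial as `i` has even degree. -/
theorem ev_der_der_quadraticPart (x y : A) :
    ev (der y (der x (quadraticPart P₀ P₁ i))) = leibnizDefect i x y := by
  have h1 : ev (der y (der x (quadraticPart P₀ P₁ i))) = ev (der y (der x (koszul P₀ P₁ i))) := by
    obtain ⟨D, hD, hi'⟩ := hi.exists_koszul_eq h
    rw [hi', map_add, map_add, map_add, ev_der_der_of_isPure_one hD,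
      zero_add]
  rw [h1, leibnizDefect]
  clear h1
  induction x using h.induction with
  | add x x' hx hx' =>
    simp only [map_add, LinearMap.add_apply, add_mul, hx, hx']
    abel
  | hom p x hx =>
    induction y using h.induction with
    | add y y' hy hy' =>
      simp only [map_add, LinearMap.add_apply, mul_add, hy, hy']
      abel
    | hom s y hy =>
      rw [ev_der_der_koszul h hA hi.1.isHomogeneousMap hi.2 hx hy, Int.negOnePow_even, one_smul,
        sub_right_comm]
      exact ((even_neg_two.mul_right k).mul_right p)

variable (hl : l = gradedCommutator (-2 * k) 1 i d)
include hl

/-- The field of `l` is `[D + R, δ]`; as `δ` is linear, bracketing with it preserves polynomial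
degree, so the quadratic part is exactly `[R, δ]`. -/
theorem exists_koszul_gradedCommutator_eq : ∃ D : FormalVF K A, IsPure 1 D ∧ koszul P₀ P₁ l =
    D + bracket P₀ P₁ (quadraticPart P₀ P₁ i) (koszul P₀ P₁ d) := by
  obtain ⟨D, hD, hi'⟩ := hi.exists_koszul_eq h
  refine ⟨bracket P₀ P₁ D (koszul P₀ P₁ d), hD.bracket (isPure_koszul_d h hA) rfl, ?_⟩
  rw [hl, koszul_gradedCommutator h hA.mul_comm hi.1.isHomogeneousMap hA.d_mem, hi', map_add,
    LinearMap.add_apply]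

theorem ev_der_der_bracket {p : ℤ} {x : A} (hx : x ∈ 𝒜 p) (y : A) :
    p.negOnePow •
      ev (der y (der x (bracket P₀ P₁ (quadraticPart P₀ P₁ i) (koszul P₀ P₁ d)))) =
      koszulBracket l p x y := by
  have hl1 : l 1 = 0 := by simp [hl, gradedCommutator_apply, hi.2, hA.d_one]
  have hlh : IsHomogeneousMap 𝒜 (-2 * k + 1) l :=
    hl ▸ hi.1.isHomogeneousMap.gradedCommutator hA.d_mem
  have h1 : ev (der y (der x (bracket P₀ P₁ (quadraticPart P₀ P₁ i) (koszul P₀ P₁ d)))) =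
      ev (der y (der x (koszul P₀ P₁ l))) := by
    obtain ⟨D, hD, hl'⟩ := exists_koszul_gradedCommutator_eq h hA hi hl
    rw [hl', map_add, map_add, map_add, ev_der_der_of_isPure_one hD, zero_add]
  rw [h1, koszulBracket]
  clear h1
  induction y using h.induction with
  | add y y' hy hy' =>
    simp only [map_add, LinearMap.add_apply, mul_add, smul_add, smul_sub, hy, hy']
    abel
  | hom s y hy =>
    rw [ev_der_der_koszul h hA hlh hl1 hx hy, add_mul, Int.negOnePow_add,
      Int.negOnePow_even _ ((even_neg_two.mul_right k).mul_right p)]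
    rcases Int.units_eq_one_or p.negOnePow with e | e <;> simp [e] <;> abel

variable (hli : IsQuasiBV 𝒜 ((-2 * k + 1) + (-2 * k))
  (gradedCommutator (-2 * k + 1) (-2 * k) l i))
include hli

theorem bracket_quadraticPart_bracket :
    bracket P₀ P₁ (quadraticPart P₀ P₁ i)
      (bracket P₀ P₁ (quadraticPart P₀ P₁ i) (koszul P₀ P₁ d)) = 0 := by
  have hI := koszul_mem h hA.mul_comm hi.1.isHomogeneousMap
  have hR : quadraticPart P₀ P₁ i ∈ homogeneous 𝒜 (-2 * k) := single_mem_homogeneous hI 2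
  have hδ := koszul_mem h hA.mul_comm hA.d_mem
  have hlh : IsHomogeneousMap 𝒜 (-2 * k + 1) l :=
    hl ▸ hi.1.isHomogeneousMap.gradedCommutator hA.d_mem
  obtain ⟨D, hD, hi'⟩ := hi.exists_koszul_eq h
  obtain ⟨E, hE, hl'⟩ := exists_koszul_gradedCommutator_eq h hA hi hl
  have hR2 : IsPure 2 (quadraticPart P₀ P₁ i) := isPure_single 2 _
  have hq : IsPure 2 (bracket P₀ P₁ (quadraticPart P₀ P₁ i) (koszul P₀ P₁ d)) :=
    hR2.bracket (isPure_koszul_d h hA) rfl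
  have h0 : bracket P₀ P₁ (bracket P₀ P₁ (quadraticPart P₀ P₁ i) (koszul P₀ P₁ d))
      (quadraticPart P₀ P₁ i) = 0 := by
    have hadd : ∀ X Y Z W : FormalVF K A, bracket P₀ P₁ (X + Y) (Z + W) 3 =
        bracket P₀ P₁ X Z 3 + bracket P₀ P₁ X W 3 +
          (bracket P₀ P₁ Y Z 3 + bracket P₀ P₁ Y W 3) := fun X Y Z W => by
      rw [map_add (bracket P₀ P₁), LinearMap.add_apply, (bracket P₀ P₁ X).map_add,
        (bracket P₀ P₁ Y).map_add]
      rfl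
    funext m
    by_cases hm : m = 3
    · subst hm
      -- With fields `E + q` for `l` and `D + R` for `i`, where `D` and `E` are linear, only `[q,
      -- R]` reaches degree `3`; that coefficient vanishes because `[l, i]` has order at most `2`.
      have h3 := koszul_component_eq_zero h hli.1 (j := 3) (by omega)
      rw [koszul_gradedCommutator h hA.mul_comm hlh hi.1.isHomogeneousMap, hl', hi',
        hadd,
        hE.bracket (c := 1) hD rfl 3 (by omega), hE.bracket (c := 2) hR2 rfl 3 (by omega),
        hq.bracket (c := 2) hD rfl 3 (by omega), zero_add, zero_add, zero_add] at h3
      exact h3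
    · exact hq.bracket hR2 rfl m hm
  rw [bracket_antisymm h hR (bracket_mem h hR hδ), h0, smul_zero, neg_zero]

theorem isGaugePair : IsGaugePair (fun n => 𝒜 (n + 2 * k)) P₀ P₁ (quadraticPart P₀ P₁ i)
    (koszul P₀ P₁ d) where
  parity := h.shift (even_two_mul k)
  isInternal := isInternal_shift (DirectSum.Decomposition.isInternal 𝒜) _
  -- A coefficient with `n` arguments changes degree by `(n - 1) * 2k` under the shift: `R` goes
  -- from `-2k` to `0`, and the linear `δ` keeps degree `1`.
  R_mem := (isPure_single 2 _).mem_homogeneous <| IsHomogeneousAt.shift (even_two_mul k)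
    (single_mem_homogeneous (koszul_mem h hA.mul_comm hi.1.isHomogeneousMap) 2 2)
    (by push_cast; ring)
  R_pure := isPure_single 2 _
  δ_mem := (isPure_koszul_d h hA).mem_homogeneous <| IsHomogeneousAt.shift (even_two_mul k)
    (koszul_mem h hA.mul_comm hA.d_mem 1) (by push_cast; ring)
  δ_pure := isPure_koszul_d h hA
  δ_δ := bracket_koszul_d h hA
  R_R_δ := bracket_quadraticPart_bracket h hA hi hl hli

end QuasiBV

/-! ### Formality of the Koszul bracket on `B` -/

theorem corollary4p6 {K : Type u} {A : Type v} [Field K] [CharZero K] [Ring A] [Algebra K A]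
    (𝒜 : ℤ → Submodule K A) [GradedAlgebra 𝒜] (d : A →ₗ[K] A) (hA : IsDGCA 𝒜 d)
    (k : ℤ) (i l : A →ₗ[K] A) (hi : IsQuasiBV 𝒜 (-2 * k) i)
    (hl : l = gradedCommutator (-2 * k) 1 i d)
    (hli : IsQuasiBV 𝒜 ((-2 * k + 1) + (-2 * k))
      (gradedCommutator (-2 * k + 1) (-2 * k) l i))
    (B : Submodule K A)
    (hB : ∀ b ∈ B, ∀ n : ℤ, (DirectSum.decompose 𝒜 b n : A) ∈ B)
    (hdB : ∀ b ∈ B, d b ∈ B)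
    (hRB : ∀ a ∈ B, ∀ b ∈ B, leibnizDefect i a b ∈ B) :
    ∃ 𝓑 : DGLA K B,
      (∀ (n : ℤ) (x : B), x ∈ 𝓑.gr n ↔ (x : A) ∈ 𝒜 (n + (2 * k - 1))) ∧
      (∀ x : B, (𝓑.d x : A) = d x) ∧
      (∀ (p : ℤ) (x y : B), (x : A) ∈ 𝒜 p →
        (𝓑.bracket x y : A) = koszulBracket l p (x : A) (y : A)) ∧
      𝓑.IsFormal := by
  obtain ⟨P₀, P₁, h⟩ := exists_isParity (DirectSum.Decomposition.isInternal 𝒜)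
  have H := isGaugePair h hA hi hl hli
  have hδ : koszul P₀ P₁ d ∈ FormalVF.preserving B := by
    refine FormalVF.mem_preserving (by rw [H.ev_δ]; exact B.zero_mem) fun x hx => ?_
    rw [H.δ_pure.der_eq_const, ev_der_koszul_d h hA]
    exact FormalVF.const_mem_preserving (hdB x hx)
  have hR : quadraticPart P₀ P₁ i ∈ FormalVF.preserving B := by
    refine FormalVF.mem_preserving ?_ fun x hx => FormalVF.mem_preserving ?_ fun y hy => ?_
    · rw [FormalVF.component_zero_eq_zero_iff.1 (H.R_pure 0 (by omega))]
      exact B.zero_mem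
    · rw [FormalVF.component_zero_eq_zero_iff.1 (H.R_pure.der x 0 (by omega))]
      exact B.zero_mem
    · rw [(H.R_pure.der x).der_eq_const, ev_der_der_quadraticPart h hA hi]
      exact FormalVF.const_mem_preserving (hRB x hx y hy)
  have hgr : ∀ {n : ℤ} {x : A}, x ∈ (H.dgla rfl).gr n ↔ x ∈ 𝒜 (n + (2 * k - 1)) := by
    intro n x
    rw [H.mem_dgla_gr, show n - 1 + 2 * k = n + (2 * k - 1) by ring]
  have hproj : ∀ n, ∀ x ∈ B, (H.dgla rfl).proj n x ∈ B := by
    intro n x hx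
    have key : ∀ x, (H.dgla rfl).proj n x = DirectSum.decompose 𝒜 x (n + (2 * k - 1)) := by
      intro x
      induction x using (H.dgla rfl).homogeneous_induction with
      | add x y hx hy => simp [hx, hy]
      | hom p x hx =>
        by_cases hp : p = n
        · subst hp
          rw [(H.dgla rfl).proj_same hx, DirectSum.decompose_of_mem_same 𝒜 (hgr.1 hx)]
        · rw [(H.dgla rfl).proj_ne hp hx, DirectSum.decompose_of_mem_ne 𝒜 (hgr.1 hx) (by omega)]
    rw [key]
    exact hB x hx _
  refine ⟨(H.dgla rfl).restrict (H.isSub_dgla rfl hδ hproj hR), fun n x => hgr,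
    fun x => ev_der_koszul_d h hA x, fun p x y hx => ?_, H.isFormal_dgla rfl hδ hR hproj⟩
  -- In the shifted grading `x` has degree `p - 2k`, of the same parity as `p`, so the sign of the
  -- abstract bracket is the sign `(-1) ^ p` of the Koszul bracket.
  have hx' : (x : A) ∈ 𝒜 (p - 2 * k + 2 * k) := by rwa [sub_add_cancel]
  refine (H.dgla_bracket_of_mem (a := p - 2 * k) rfl hx' _).trans ?_
  rw [← ev_der_der_bracket h hA hi hl hx, Int.negOnePow_sub, Int.negOnePow_even _ (even_two_mul k),
    mul_one]
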